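/- Let $\alpha\in(\tfrac12,1)$, $\sigma\ge 0$, $\lambda\in\{1,-1\}$, $a<b$, let $N$ be a positive even integer, $\mu=\frac{2\pi}{b-a}$, $h=\frac{b-a}{N}$ and $x_j=a+jh$ for $0\le j\le N-1$. Let $D_1^\alpha$ be the $N\times N$ Fourier pseudospectral matrix $$(D_1^\alpha)_{j,l}=\sum_{k=-N/2}^{N/2}\frac1{Nc_k}\,ik\mu\,|k\mu|^{\alpha-1}e^{ik\mu(x_j-x_l)},\qquad c_k=1\ \text{for } |k|<\tfrac N2,\quad c_{\pm N/2}=2$$ (the term $k=0$ is $0$), which has real entries. On a probability space $(\Omega,\mathcal F,\mathbb P)$ with a filtration $(\mathcal F_t)_{t\ge0}$ let $(\beta_k)_{k\ge1}$ be independent $(\mathcal F_t)$-Brownian motions, let $\varphi_k$ be real functions with $\sum_k\varphi_k(x)^2<\infty$ for $x\in[a,b]$, and let $W(t,x)=\sum_k\beta_k(t)\varphi_k(x)$ (limit in probability), in an adapted version that is continuous in $t$. Consider, for $0\le j\le N-1$, the semi-discrete Stratonovich system $$\begin{aligned} dp_j+(D_1^\alpha\mathbf w)_j\,dt-\lambda(p_j^2+q_j^2)^\sigma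 q_j\,dt-q_j\circ dW(t,x_j)&=0,\\ dq_j-(D_1^\alpha\mathbf v)_j\,dt+\lambda(p_j^2+q_j^2)^\sigma p_j\,dt+p_j\circ dW(t,x_j)&=0,\\ (D_1^\alpha\mathbf p)_j=v_j,\qquad (D_1^\alpha\mathbf q)_j&=w_j. \end{aligned}$$ Here $\int X\circ dW=\int X\,dW+\frac12[X,W]$, where the Itô integral of a continuous adapted integrand and the covariation $[X,W]$ (a continuous process of locally bounded variation) are limits in probability of the corresponding sums over partitions with mesh tending to $0$. Let $z_j=(p_j,q_j,v_j,w_j)^T$ be the phase flow of this system: for every initial datum $y=(\mathbf p(0),\mathbf q(0))\in\mathbb R^{2N}$ a continuous adapted solution that starts from $y$, in a version that is almost surely continuous in $y$ for every $t$. Denote by $d$ the differential with respect to the initial datum $y$ and put $$\Psi_j=\tfrac12\,dz_j\wedge\mathbf M\,dz_j,\qquad d\tilde{\mathcal G}z_j=\sum_{k=0}^{N-1}(D_1^\alpha)_{j,k}\,dz_k,$$ $$\mathbf M=\begin{pmatrix}0&1&0&0\\-1&0&0&0\\0&0&0&0\\0&0&0&0\end{pmatrix},\qquad \mathbf K=\begin{pmatrix}0&0&-1&0\\0&0&0&-1\\1&0&0&0\\0&1&0&0\end{pmatrix}.$$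 Then $D_1^\alpha$ is skew-symmetric, and almost surely the following holds: for every $t\ge0$ the map $y\mapsto z(t)$ is differentiable, and for all $t\ge0$ and at every initial datum $$\frac{d}{dt}\Psi_j+dz_j\wedge\mathbf K\,d\tilde{\mathcal G}z_j=0,\qquad 0\le j\le N-1$$ (the time derivative at $t=0$ is one-sided), and the global symplectic form is conserved: $\frac{d}{dt}\sum_{j=0}^{N-1}\Psi_j=0$, so that $\sum_j\Psi_j(t)=\sum_j\Psi_j(0)$. -/

import Mathlib

open MeasureTheory ProbabilityTheory Filter Topology
open scoped NNReal ENNReal Matrix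

namespace StochFracNLS

noncomputable section

/-! ### The Fourier pseudospectral differentiation matrix -/

/-- The grid points `x_j = a + j h`, `h = (b - a) / N`, `0 ≤ j ≤ N - 1`. -/
def gridPoint (a b : ℝ) (N : ℕ) (j : Fin N) : ℝ := a + (j : ℝ) * ((b - a) / N)

/-- The base frequency `μ = 2π / (b - a)`. -/
def baseFreq (a b : ℝ) : ℝ := 2 * Real.pi / (b - a)

/-- `c_k = 2` for `k = ± N / 2` and `c_k = 1` for `|k| < N / 2`. -/
def modeWeight (N : ℕ) (k : ℤ) : ℝ := if 2 * |k| = (N : ℤ) then 2 else 1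

/-- The pseudospectral matrix of `𝒢̃` as the trigonometric sum
`∑_{k = -N/2}^{N/2} (N c_k)⁻¹ i k μ |k μ|^(α-1) e^{i k μ (x_j - x_l)}`. -/
def complexD1 (α a b : ℝ) (N : ℕ) : Matrix (Fin N) (Fin N) ℂ :=
  Matrix.of fun j l ↦ ∑ k ∈ Finset.Icc (-((N : ℤ) / 2)) ((N : ℤ) / 2),
    ((1 / (N * modeWeight N k) : ℝ) : ℂ) *
      (Complex.I * ((k * baseFreq a b * |k * baseFreq a b| ^ (α - 1) : ℝ) : ℂ)) *
      Complex.exp (Complex.I *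
        ((k * baseFreq a b * (gridPoint a b N j - gridPoint a b N l) : ℝ) : ℂ))

/-- The matrix `D₁^α`. The trigonometric sum has real values (`complexD1_eq_map_D1`), and this is
the sum as a real matrix. -/
def D1 (α a b : ℝ) (N : ℕ) : Matrix (Fin N) (Fin N) ℝ :=
  (complexD1 α a b N).map Complex.re

theorem complexD1_eq_map_D1 (α a b : ℝ) (N : ℕ) :
    complexD1 α a b N = (D1 α a b N).map Complex.ofReal := by
  ext j l
  simp only [D1, Matrix.map_apply]
  refine (Complex.conj_eq_iff_re.mp ?_).symm
  simp only [complexD1, Matrix.of_apply, map_sum]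
  refine Finset.sum_nbij' (fun k ↦ -k) (fun k ↦ -k) ?_ ?_ ?_ ?_ ?_
  · intro k hk
    simp only [Finset.mem_Icc] at hk ⊢
    omega
  · intro k hk
    simp only [Finset.mem_Icc] at hk ⊢
    omega
  · simp
  · simp
  · intro k _
    have h : modeWeight N (-k) = modeWeight N k := by simp [modeWeight]
    simp only [map_mul, Complex.conj_ofReal, Complex.conj_I, ← Complex.exp_conj, h]
    push_cast
    simp only [neg_mul, mul_neg, abs_neg]

/-! ### Stochastic integrals along partitions -/

/-- A finite partition `0 = τ₀ ≤ τ₁ ≤ ⋯ ≤ τ_n = t` of `[0, t]`. -/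
structure TimePartition (t : ℝ≥0) where
  n : ℕ
  pt : ℕ → ℝ≥0
  mono : Monotone pt
  pt_zero : pt 0 = 0
  pt_last : pt n = t

/-- The mesh `max_i (τ_{i+1} - τ_i)` of a partition. -/
def TimePartition.mesh {t : ℝ≥0} (π : TimePartition t) : ℝ≥0 :=
  (Finset.range π.n).sup fun i ↦ π.pt (i + 1) - π.pt i

/-- The filter "mesh of the partition of `[0, t]` tends to `0`". -/
def meshToZero (t : ℝ≥0) : Filter (TimePartition t) := comap TimePartition.mesh (𝓝 0)

variable {Ω : Type*} {mΩ : MeasurableSpace Ω}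

/-- `I` is the Itô integral process `∫₀ᵗ X dW` of the (continuous adapted) integrand `X`: for every
`t` the left-point sums over partitions of `[0, t]` converge to `I t` in probability. -/
def IsItoIntegral (P : Measure Ω) (X W I : ℝ≥0 → Ω → ℝ) : Prop :=
  ∀ t : ℝ≥0, TendstoInMeasure P
    (fun (π : TimePartition t) (ω : Ω) ↦ ∑ i ∈ Finset.range π.n,
      X (π.pt i) ω * (W (π.pt (i + 1)) ω - W (π.pt i) ω))
    (meshToZero t) (I t)

/-- `C` is the quadratic covariation `[X, W]`: a process with continuous paths of locally bounded
variation such that for every `t` the sums of products of increments over partitions of `[0, t]`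
converge to `C t` in probability. -/
def IsCovariation (P : Measure Ω) (X W C : ℝ≥0 → Ω → ℝ) : Prop :=
  (∀ᵐ ω ∂P, Continuous (fun t ↦ C t ω) ∧
    LocallyBoundedVariationOn (fun t ↦ C t ω) Set.univ) ∧
  ∀ t : ℝ≥0, TendstoInMeasure P
    (fun (π : TimePartition t) (ω : Ω) ↦ ∑ i ∈ Finset.range π.n,
      (X (π.pt (i + 1)) ω - X (π.pt i) ω) * (W (π.pt (i + 1)) ω - W (π.pt i) ω))
    (meshToZero t) (C t)

/-- `S` is the Stratonovich integral process `∫₀ᵗ X ∘ dW = ∫₀ᵗ X dW + ½ [X, W]_t`. -/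
def IsStratonovichIntegral (P : Measure Ω) (X W S : ℝ≥0 → Ω → ℝ) : Prop :=
  ∃ I C : ℝ≥0 → Ω → ℝ, IsItoIntegral P X W I ∧ IsCovariation P X W C ∧
    S = fun t ω ↦ I t ω + C t ω / 2

/-! ### The noise -/

/-- A sequence of independent Brownian motions associated with the filtration `ℱ`. -/
structure IsBrownianSequence (P : Measure Ω) (ℱ : Filtration ℝ≥0 mΩ)
    (β : ℕ → ℝ≥0 → Ω → ℝ) : Prop where
  brownian : ∀ k, IsBrownianReal (β k) P
  adapted : ∀ k, Adapted ℱ (β k)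
  indep : iIndepFun (fun k ω t ↦ β k t ω) P
  indep_past : ∀ s t, s ≤ t →
    Indep (MeasurableSpace.comap (fun ω k ↦ β k t ω - β k s ω) inferInstance) (ℱ s) P

/-- `W` is the Wiener process `W(t, x) = ∑_k β_k(t) φ_k(x)`, `x ∈ [a, b]`, with `φ_k = Φ e_k`
and `F_Φ(x) = ∑_k φ_k(x)² < ∞`, in a version that is adapted and continuous in time. -/
structure IsWienerField (P : Measure Ω) (ℱ : Filtration ℝ≥0 mΩ) (a b : ℝ)
    (β : ℕ → ℝ≥0 → Ω → ℝ) (φ : ℕ → ℝ → ℝ) (W : ℝ≥0 → ℝ → Ω → ℝ) : Prop where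
  brownian : IsBrownianSequence P ℱ β
  summable : ∀ x ∈ Set.Icc a b, Summable fun k ↦ φ k x ^ 2
  series : ∀ t, ∀ x ∈ Set.Icc a b, TendstoInMeasure P
    (fun (n : ℕ) (ω : Ω) ↦ ∑ k ∈ Finset.range n, β k t ω * φ k x) atTop (W t x)
  adapted : ∀ x ∈ Set.Icc a b, Adapted ℱ fun t ↦ W t x
  continuous : ∀ x ∈ Set.Icc a b, ∀ᵐ ω ∂P, Continuous fun t ↦ W t x ω

/-! ### The semi-discrete system and its phase flow -/

/-- The space of initial data `(p(0), q(0))`. -/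
abbrev Phase (N : ℕ) : Type := (Fin N → ℝ) × (Fin N → ℝ)

/-- `z_j = (p_j, q_j, v_j, w_j)` (components `0, 1, 2, 3`) solves the semi-discrete system
`dp_j + (D₁ w)_j dt - λ (p_j² + q_j²)^σ q_j dt - q_j ∘ dW(t, x_j) = 0`,
`dq_j - (D₁ v)_j dt + λ (p_j² + q_j²)^σ p_j dt + p_j ∘ dW(t, x_j) = 0`,
`(D₁ p)_j = v_j`, `(D₁ q)_j = w_j` with initial datum `(p, q)(0) = y`. -/
structure IsSemidiscreteSolution (P : Measure Ω) (ℱ : Filtration ℝ≥0 mΩ)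
    (W : ℝ≥0 → ℝ → Ω → ℝ) (α σ lam a b : ℝ) (N : ℕ) (y : Phase N)
    (z : ℝ≥0 → Ω → Fin N → Fin 4 → ℝ) : Prop where
  adapted : ∀ j c, Adapted ℱ fun t ω ↦ z t ω j c
  continuous : ∀ᵐ ω ∂P, Continuous fun t ↦ z t ω
  eq_p : ∀ j, ∃ S : ℝ≥0 → Ω → ℝ,
    IsStratonovichIntegral P (fun t ω ↦ z t ω j 1) (fun t ↦ W t (gridPoint a b N j)) S ∧
    ∀ᵐ ω ∂P, ∀ t : ℝ≥0, z t ω j 0 = y.1 j +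
      (∫ s in (0 : ℝ)..t,
        (-(D1 α a b N *ᵥ fun k ↦ z s.toNNReal ω k 3) j +
          lam * (z s.toNNReal ω j 0 ^ 2 + z s.toNNReal ω j 1 ^ 2) ^ σ * z s.toNNReal ω j 1)) +
      S t ω
  eq_q : ∀ j, ∃ S : ℝ≥0 → Ω → ℝ,
    IsStratonovichIntegral P (fun t ω ↦ z t ω j 0) (fun t ↦ W t (gridPoint a b N j)) S ∧
    ∀ᵐ ω ∂P, ∀ t : ℝ≥0, z t ω j 1 = y.2 j +
      (∫ s in (0 : ℝ)..t,
        ((D1 α a b N *ᵥ fun k ↦ z s.toNNReal ω k 2) j -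
          lam * (z s.toNNReal ω j 0 ^ 2 + z s.toNNReal ω j 1 ^ 2) ^ σ * z s.toNNReal ω j 0)) -
      S t ω
  eq_v : ∀ᵐ ω ∂P, ∀ t j, (D1 α a b N *ᵥ fun k ↦ z t ω k 0) j = z t ω j 2
  eq_w : ∀ᵐ ω ∂P, ∀ t j, (D1 α a b N *ᵥ fun k ↦ z t ω k 1) j = z t ω j 3

/-- `Z t ω y` is the phase flow of the semi-discrete system: for every initial datum `y` it is the
solution that starts from `y`, in a version that almost surely depends continuously on `y`. -/
structure IsPhaseFlow (P : Measure Ω) (ℱ : Filtration ℝ≥0 mΩ)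
    (W : ℝ≥0 → ℝ → Ω → ℝ) (α σ lam a b : ℝ) (N : ℕ)
    (Z : ℝ≥0 → Ω → Phase N → Fin N → Fin 4 → ℝ) : Prop where
  solution : ∀ y, IsSemidiscreteSolution P ℱ W α σ lam a b N y fun t ω ↦ Z t ω y
  continuous : ∀ᵐ ω ∂P, ∀ t, Continuous (Z t ω)

/-! ### Differential forms on the space of initial data -/

/-- The skew-symmetric matrix `𝐌`. -/
def matM : Matrix (Fin 4) (Fin 4) ℝ :=
  !![0, 1, 0, 0; -1, 0, 0, 0; 0, 0, 0, 0; 0, 0, 0, 0]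

/-- The skew-symmetric matrix `𝐊`. -/
def matK : Matrix (Fin 4) (Fin 4) ℝ :=
  !![0, 0, -1, 0; 0, 0, 0, -1; 1, 0, 0, 0; 0, 1, 0, 0]

/-- The wedge product of two covectors, as an alternating form in two tangent vectors. -/
def wedge {E : Type*} [NormedAddCommGroup E] [NormedSpace ℝ E]
    (θ ϑ : E →L[ℝ] ℝ) (ξ η : E) : ℝ := θ ξ * ϑ η - θ η * ϑ ξ

/-- `θ ∧ A ϑ = ∑_c θ_c ∧ (A ϑ)_c` for vectors `θ`, `ϑ` of covectors and a matrix `A`. -/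
def wedgeMat {E : Type*} [NormedAddCommGroup E] [NormedSpace ℝ E]
    (θ : Fin 4 → E →L[ℝ] ℝ) (A : Matrix (Fin 4) (Fin 4) ℝ) (ϑ : Fin 4 → E →L[ℝ] ℝ)
    (ξ η : E) : ℝ :=
  ∑ c, wedge (θ c) (∑ d, A c d • ϑ d) ξ η

/-- The differentials `dz_j = (dp_j, dq_j, dv_j, dw_j)` at `y` of a map `F` of the initial
datum. -/
def dz {N : ℕ} (F : Phase N → Fin N → Fin 4 → ℝ) (j : Fin N) (y : Phase N) :
    Fin 4 → Phase N →L[ℝ] ℝ :=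
  fun c ↦ fderiv ℝ (fun y' ↦ F y' j c) y

/-- `d𝒢̃z_j = ∑_k D_{j,k} dz_k`. -/
def dGz {N : ℕ} (D : Matrix (Fin N) (Fin N) ℝ) (F : Phase N → Fin N → Fin 4 → ℝ) (j : Fin N)
    (y : Phase N) : Fin 4 → Phase N →L[ℝ] ℝ :=
  fun c ↦ ∑ k, D j k • dz F k y c

/-- `Ψ_j = ½ dz_j ∧ 𝐌 dz_j`. -/
def symplForm {N : ℕ} (F : Phase N → Fin N → Fin 4 → ℝ) (j : Fin N) (y ξ η : Phase N) : ℝ :=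
  1 / 2 * wedgeMat (dz F j y) matM (dz F j y) ξ η

end

end StochFracNLS

/-!
Write `u_j = p_j + i q_j`. Stratonovich integrals obey the ordinary product rule, so the gauge
transform `e^{i W(t, x_j)} u_j(t)` removes the noise: the system becomes a random ordinary
differential equation with continuous coefficients. Only dyadic partitions are needed for this, and
along subsequences of them the convergence in probability becomes almost sure. As `D₁` is
skew-symmetric, `D₁²` is symmetric and the mass `∑ |u_j|²` is conserved, so solutions are bounded
and the flow is differentiable in the initial datum, its derivative solving the variational
equation. The area form `dp_j ∧ dq_j` is
invariant under rotations of the phase, so `Ψ_j` may be computed in the rotating frame, where the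
nonlinearity drops out because its derivative is symmetric; only the linear part `D₁²` contributes.
-/

noncomputable section

namespace StochFracNLS

/-! ### Flows of non-autonomous differential equations -/

section LinearODE

variable {F : Type*} [NormedAddCommGroup F] [NormedSpace ℝ F]

theorem exp_neg_mul_norm_integral_le {f : ℝ → F} {L D t : ℝ} (ht : 0 ≤ t) (hD : 0 ≤ D)
    (hf : ∀ s ∈ Set.Ioc 0 t, ‖f s‖ ≤ L * D * Real.exp (2 * L * s)) :
    Real.exp (-(2 * L * t)) * ‖∫ s in (0 : ℝ)..t, f s‖ ≤ D / 2 := by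
  have hderiv : ∀ s ∈ Set.uIcc 0 t, HasDerivAt (fun s ↦ D / 2 * Real.exp (2 * L * s))
      (L * D * Real.exp (2 * L * s)) s := fun s _ ↦
    (((hasDerivAt_const_mul (2 * L)).exp).const_mul (D / 2)).congr_deriv (by ring)
  have hint : IntervalIntegrable (fun s ↦ L * D * Real.exp (2 * L * s)) volume 0 t :=
    Continuous.intervalIntegrable (by fun_prop) _ _
  have hle := intervalIntegral.norm_integral_le_of_norm_le ht (Eventually.of_forall hf) hint
  rw [intervalIntegral.integral_eq_sub_of_hasDerivAt hderiv hint, mul_zero, Real.exp_zero] at hle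
  calc Real.exp (-(2 * L * t)) * ‖∫ s in (0 : ℝ)..t, f s‖
      ≤ Real.exp (-(2 * L * t)) * (D / 2 * Real.exp (2 * L * t) - D / 2 * 1) := by gcongr
    _ = D / 2 * (1 - Real.exp (-(2 * L * t))) := by
        have hexp : Real.exp (-(2 * L * t)) * Real.exp (2 * L * t) = 1 := by
          rw [← Real.exp_add, neg_add_cancel, Real.exp_zero]
        linear_combination D / 2 * hexp
    _ ≤ D / 2 := mul_le_of_le_one_right (by positivity) (by linarith [Real.exp_pos (-(2 * L * t))])

/-- The Picard map `v ↦ x₀ + ∫₀ A v` of the linear equation `x' = A x` on `[0, T]`, conjugated by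
the weight `exp (2 L t)` in order to be a contraction on the whole interval. -/
def weightedPicard {A : ℝ → F →L[ℝ] F} (hA : Continuous A) {T : ℝ} (hT : 0 ≤ T) (L : ℝ) (x₀ : F)
    (v : C(Set.Icc 0 T, F)) : C(Set.Icc 0 T, F) where
  toFun t := Real.exp (-(2 * L * t)) •
    (x₀ + ∫ s in (0 : ℝ)..t, A s (Real.exp (2 * L * s) • Set.IccExtend hT v s))
  continuous_toFun := by
    have hint : Continuous fun s ↦ A s (Real.exp (2 * L * s) • Set.IccExtend hT v s) :=
      hA.clm_apply ((by fun_prop : Continuous fun s ↦ Real.exp (2 * L * s)).smul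
        (v.continuous.Icc_extend' (h := hT)))
    have := intervalIntegral.continuous_primitive
      (fun r s ↦ hint.intervalIntegrable (μ := volume) r s) 0
    fun_prop

theorem contractingWith_weightedPicard {A : ℝ → F →L[ℝ] F} (hA : Continuous A) {T : ℝ}
    (hT : 0 ≤ T) {L : ℝ} (hL : ∀ s ∈ Set.Icc 0 T, ‖A s‖ ≤ L) (x₀ : F) :
    ContractingWith (1 / 2) (weightedPicard hA hT L x₀) := by
  refine ⟨by norm_num, LipschitzWith.of_dist_le_mul fun v v' ↦ ?_⟩
  rw [ContinuousMap.dist_le (by positivity)]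
  rintro ⟨t, ht⟩
  have hint : ∀ v : C(Set.Icc 0 T, F), IntervalIntegrable
      (fun s ↦ A s (Real.exp (2 * L * s) • Set.IccExtend hT v s)) volume 0 t := fun v ↦
    (hA.clm_apply ((by fun_prop : Continuous fun s ↦ Real.exp (2 * L * s)).smul
      (v.continuous.Icc_extend' (h := hT)))).intervalIntegrable _ _
  have hsub : ∀ s ∈ Set.Ioc 0 t, ‖A s (Real.exp (2 * L * s) • Set.IccExtend hT v s) -
      A s (Real.exp (2 * L * s) • Set.IccExtend hT v' s)‖ ≤
        L * dist v v' * Real.exp (2 * L * s) := by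
    intro s hs
    have hsT : s ∈ Set.Icc 0 T := ⟨hs.1.le, hs.2.trans ht.2⟩
    rw [← map_sub, ← smul_sub, Set.IccExtend_of_mem hT _ hsT, Set.IccExtend_of_mem hT _ hsT,
      mul_assoc L]
    refine (A s).le_of_opNorm_le_of_le (hL s hsT) ?_
    rw [norm_smul, Real.norm_eq_abs, Real.abs_exp, mul_comm, ← dist_eq_norm]
    gcongr
    exact ContinuousMap.dist_apply_le_dist _
  rw [dist_eq_norm]
  simp only [weightedPicard, ContinuousMap.coe_mk]
  rw [← smul_sub, add_sub_add_left_eq_sub, ← intervalIntegral.integral_sub (hint v) (hint v'),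
    norm_smul, Real.norm_eq_abs, Real.abs_exp]
  refine (exp_neg_mul_norm_integral_le ht.1 dist_nonneg hsub).trans_eq ?_
  push_cast
  ring

theorem exists_hasDerivWithinAt_linear [CompleteSpace F] {A : ℝ → F →L[ℝ] F} (hA : Continuous A)
    {T : ℝ} (hT : 0 ≤ T) (x₀ : F) :
    ∃ x : ℝ → F, x 0 = x₀ ∧
      ∀ t ∈ Set.Icc 0 T, HasDerivWithinAt x (A t (x t)) (Set.Icc 0 T) t := by
  obtain ⟨L, hL⟩ := (isCompact_Icc (a := (0 : ℝ)) (b := T)).exists_bound_of_continuousOn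
    hA.continuousOn
  have hΛ := contractingWith_weightedPicard hA hT hL x₀
  obtain ⟨v, hv⟩ : ∃ v, weightedPicard hA hT L x₀ v = v := ⟨_, hΛ.fixedPoint_isFixedPt⟩
  set f : ℝ → F := fun s ↦ A s (Real.exp (2 * L * s) • Set.IccExtend hT v s)
  have hfc : Continuous f :=
    hA.clm_apply ((by fun_prop : Continuous fun s ↦ Real.exp (2 * L * s)).smul
      (v.continuous.Icc_extend' (h := hT)))
  have hx : ∀ t ∈ Set.Icc 0 T, Real.exp (2 * L * t) • Set.IccExtend hT v t =
      x₀ + ∫ s in (0 : ℝ)..t, f s := by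
    intro t ht
    have hvt : v ⟨t, ht⟩ = Real.exp (-(2 * L * t)) • (x₀ + ∫ s in (0 : ℝ)..t, f s) :=
      (DFunLike.congr_fun hv _).symm
    rw [Set.IccExtend_of_mem hT _ ht, hvt, smul_smul, ← Real.exp_add, add_neg_cancel,
      Real.exp_zero, one_smul]
  refine ⟨fun t ↦ x₀ + ∫ s in (0 : ℝ)..t, f s, by simp, fun t ht ↦ ?_⟩
  have hderiv := (hfc.integral_hasStrictDerivAt 0 t).hasDerivAt.const_add x₀
  refine (hderiv.congr_deriv ?_).hasDerivWithinAt
  simp only [← hx t ht, f]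

end LinearODE

/-- `U t x` is the solution at time `t ≥ 0` of `u' = Φ t u` with `u 0 = x`, and the solutions that
start from a bounded set stay bounded on bounded time intervals. -/
structure IsBoundedFlow {E : Type*} [NormedAddCommGroup E] [NormedSpace ℝ E] (Φ U : ℝ → E → E) :
    Prop where
  map_zero : ∀ x, U 0 x = x
  hasDerivWithinAt : ∀ x t, 0 ≤ t → HasDerivWithinAt (fun s ↦ U s x) (Φ t (U t x)) (Set.Ici 0) t
  bounded : ∀ r T : ℝ, ∃ R : ℝ, ∀ x, ‖x‖ ≤ r → ∀ t ∈ Set.Icc 0 T, ‖U t x‖ ≤ R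

section Flow

variable {E : Type*} [NormedAddCommGroup E] [NormedSpace ℝ E] {Φ U : ℝ → E → E}
  {A : ℝ → E → E →L[ℝ] E}

namespace IsBoundedFlow

theorem continuousOn (h : IsBoundedFlow Φ U) (x : E) :
    ContinuousOn (fun s ↦ U s x) (Set.Ici 0) := fun t ht ↦
  (h.hasDerivWithinAt x t ht).continuousWithinAt

theorem continuousOn_Icc (h : IsBoundedFlow Φ U) (x : E) (T : ℝ) :
    ContinuousOn (fun s ↦ U s x) (Set.Icc 0 T) :=
  (h.continuousOn x).mono Set.Icc_subset_Ici_self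

theorem hasDerivWithinAt_Ici (h : IsBoundedFlow Φ U) (x : E) {t : ℝ} (ht : 0 ≤ t) :
    HasDerivWithinAt (fun s ↦ U s x) (Φ t (U t x)) (Set.Ici t) t :=
  (h.hasDerivWithinAt x t ht).mono (Set.Ici_subset_Ici.2 ht)

end IsBoundedFlow

theorem norm_sub_le_of_approx_linear {B : ℝ → E →L[ℝ] E} {f g f' : ℝ → E} {T η : ℝ} {L : ℝ≥0}
    (hL : 0 < L) (hη : 0 ≤ η) (hB : ∀ s ∈ Set.Icc 0 T, ‖B s‖₊ ≤ L)
    (hf : ContinuousOn f (Set.Icc 0 T))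
    (hf' : ∀ s ∈ Set.Ico 0 T, HasDerivWithinAt f (f' s) (Set.Ici s) s)
    (hfη : ∀ s ∈ Set.Ico 0 T, ‖f' s - B s (f s)‖ ≤ η)
    (hg : ∀ s ∈ Set.Icc 0 T, HasDerivWithinAt g (B s (g s)) (Set.Icc 0 T) s)
    (h0 : f 0 = g 0) {t : ℝ} (ht : t ∈ Set.Icc 0 T) :
    ‖f t - g t‖ ≤ η * (Real.exp (L * T) / L) := by
  have hgronwall := dist_le_of_approx_trajectories_ODE_of_mem (v := fun s x ↦ B s x) (K := L)
    (s := fun _ ↦ Set.univ) (εf := η) (εg := 0) (δ := 0)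
    (fun s hs ↦ (ContinuousLinearMap.lipschitzWith_of_opNorm_le
      (hB s (Set.Ico_subset_Icc_self hs))).lipschitzOnWith)
    hf hf' (fun s hs ↦ (dist_eq_norm _ _).trans_le (hfη s hs)) (fun _ _ ↦ Set.mem_univ _)
    (fun s hs ↦ (hg s hs).continuousWithinAt)
    (fun s hs ↦ (hg s (Set.Ico_subset_Icc_self hs)).mono_of_mem_nhdsWithin
      (Icc_mem_nhdsGE_of_mem hs))
    (fun s _ ↦ (dist_self _).le) (fun _ _ ↦ Set.mem_univ _) (dist_le_zero.2 h0) t ht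
  rw [dist_eq_norm, gronwallBound_of_K_ne_0 (NNReal.coe_pos.2 hL).ne'] at hgronwall
  simp only [zero_mul, zero_add, add_zero, sub_zero] at hgronwall
  have hexp : Real.exp (L * t) - 1 ≤ Real.exp (L * T) := by
    have : Real.exp (L * t) ≤ Real.exp (L * T) := by
      gcongr
      exact ht.2
    linarith
  calc ‖f t - g t‖ ≤ η / L * (Real.exp (L * t) - 1) := hgronwall
    _ ≤ η / L * Real.exp (L * T) := by gcongr
    _ = η * (Real.exp (L * T) / L) := by ring

variable [ProperSpace E]

theorem exists_forall_nnnorm_le (hA : Continuous (Function.uncurry A)) (T R : ℝ) :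
    ∃ L : ℝ≥0, 0 < L ∧ ∀ s ∈ Set.Icc 0 T, ∀ x ∈ Metric.closedBall (0 : E) R, ‖A s x‖₊ ≤ L := by
  have hK : IsCompact (Set.Icc 0 T ×ˢ Metric.closedBall (0 : E) R) :=
    isCompact_Icc.prod (isCompact_closedBall _ _)
  obtain ⟨L, hL⟩ := hK.exists_bound_of_continuousOn hA.continuousOn
  refine ⟨L.toNNReal + 1, by positivity, fun s hs x hx ↦ ?_⟩
  have hLs : ‖A s x‖₊ ≤ L.toNNReal :=
    NNReal.coe_le_coe.1 ((hL (s, x) ⟨hs, hx⟩).trans (Real.le_coe_toNNReal L))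
  exact hLs.trans (le_add_of_nonneg_right zero_le_one)

theorem exists_forall_norm_sub_sub_le (hΦ : ∀ t x, HasFDerivAt (Φ t) (A t x) x)
    (hA : Continuous (Function.uncurry A)) (T R : ℝ) {ε : ℝ} (hε : 0 < ε) :
    ∃ δ > 0, ∀ s ∈ Set.Icc 0 T, ∀ x ∈ Metric.closedBall (0 : E) R,
      ∀ y ∈ Metric.closedBall (0 : E) R, ‖x - y‖ < δ →
        ‖Φ s x - Φ s y - A s y (x - y)‖ ≤ ε * ‖x - y‖ := by
  have hK : IsCompact (Set.Icc 0 T ×ˢ Metric.closedBall (0 : E) R) :=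
    isCompact_Icc.prod (isCompact_closedBall _ _)
  obtain ⟨δ, hδ, hAδ⟩ := Metric.uniformContinuousOn_iff.1
    (hK.uniformContinuousOn_of_continuous hA.continuousOn) ε hε
  refine ⟨δ, hδ, fun s hs x hx y hy hxy ↦ ?_⟩
  have hconv : Convex ℝ (Metric.closedBall (0 : E) R ∩ Metric.ball y δ) :=
    (convex_closedBall _ _).inter (convex_ball _ _)
  refine hconv.norm_image_sub_le_of_norm_hasFDerivWithin_le'
    (fun z _ ↦ (hΦ s z).hasFDerivWithinAt) (fun z hz ↦ ?_) ⟨hy, Metric.mem_ball_self hδ⟩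
    ⟨hx, by rwa [Metric.mem_ball, dist_eq_norm]⟩
  rw [← dist_eq_norm]
  refine (hAδ (s, z) ⟨hs, hz.1⟩ (s, y) ⟨hs, hy⟩ ?_).le
  rw [Prod.dist_eq, dist_self]
  exact max_lt hδ hz.2

namespace IsBoundedFlow

theorem exists_norm_sub_le (h : IsBoundedFlow Φ U) (hΦ : ∀ t x, HasFDerivAt (Φ t) (A t x) x)
    (hA : Continuous (Function.uncurry A)) (r T : ℝ) :
    ∃ M > 0, ∀ x y : E, ‖x‖ ≤ r → ‖y‖ ≤ r → ∀ s ∈ Set.Icc 0 T,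
      ‖U s x - U s y‖ ≤ M * ‖x - y‖ := by
  obtain ⟨R, hR⟩ := h.bounded r T
  obtain ⟨L, -, hL⟩ := exists_forall_nnnorm_le hA T R
  have hball : ∀ x, ‖x‖ ≤ r → ∀ s ∈ Set.Ico 0 T, U s x ∈ Metric.closedBall (0 : E) R :=
    fun x hx s hs ↦ mem_closedBall_zero_iff.2 (hR x hx s (Set.Ico_subset_Icc_self hs))
  refine ⟨Real.exp (L * T), Real.exp_pos _, fun x y hx hy s hs ↦ ?_⟩
  have hgronwall := dist_le_of_trajectories_ODE_of_mem (v := Φ) (K := L)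
    (s := fun _ ↦ Metric.closedBall (0 : E) R) (δ := dist x y)
    (fun r hr ↦ (convex_closedBall (0 : E) R).lipschitzOnWith_of_nnnorm_hasFDerivWithin_le
      (fun z _ ↦ (hΦ r z).hasFDerivWithinAt) (hL r (Set.Ico_subset_Icc_self hr)))
    (h.continuousOn_Icc x T) (fun r hr ↦ h.hasDerivWithinAt_Ici x hr.1) (hball x hx)
    (h.continuousOn_Icc y T) (fun r hr ↦ h.hasDerivWithinAt_Ici y hr.1) (hball y hy)
    (by rw [h.map_zero, h.map_zero]) s hs
  rw [dist_eq_norm, dist_eq_norm, sub_zero, mul_comm] at hgronwall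
  refine hgronwall.trans ?_
  gcongr
  exact hs.2

theorem hasFDerivAt_of_variational (h : IsBoundedFlow Φ U)
    (hΦ : ∀ t x, HasFDerivAt (Φ t) (A t x) x) (hA : Continuous (Function.uncurry A)) (y : E)
    {T : ℝ} {J : ℝ → E →L[ℝ] E} (hJ0 : J 0 = ContinuousLinearMap.id ℝ E)
    (hJ : ∀ t ∈ Set.Icc 0 T, HasDerivWithinAt J ((A t (U t y)).comp (J t)) (Set.Icc 0 T) t)
    {t : ℝ} (ht : t ∈ Set.Icc 0 T) : HasFDerivAt (U t) (J t) y := by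
  obtain ⟨R, hR⟩ := h.bounded (‖y‖ + 1) T
  obtain ⟨L, hLpos, hL⟩ := exists_forall_nnnorm_le hA T R
  obtain ⟨M, hM, hlip⟩ := h.exists_norm_sub_le hΦ hA (‖y‖ + 1) T
  have hball : ∀ x, ‖x‖ ≤ ‖y‖ + 1 → ∀ s ∈ Set.Icc 0 T, U s x ∈ Metric.closedBall (0 : E) R :=
    fun x hx s hs ↦ mem_closedBall_zero_iff.2 (hR x hx s hs)
  have hy : ‖y‖ ≤ ‖y‖ + 1 := by linarith
  refine HasFDerivAt.of_isLittleO (Asymptotics.isLittleO_iff.2 fun ε hε ↦ ?_)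
  set G : ℝ := M * (Real.exp (L * T) / L)
  have hG : 0 < G := by positivity
  obtain ⟨δ, hδ, hlin⟩ := exists_forall_norm_sub_sub_le hΦ hA T R (div_pos hε hG)
  filter_upwards [Metric.ball_mem_nhds y (lt_min one_pos (div_pos hδ hM))] with x hx
  rw [Metric.mem_ball, dist_eq_norm, lt_min_iff, lt_div_iff₀' hM] at hx
  have hxr : ‖x‖ ≤ ‖y‖ + 1 := by linarith [norm_sub_norm_le x y]
  have herr : ∀ s ∈ Set.Ico 0 T, ‖Φ s (U s x) - Φ s (U s y) - A s (U s y) (U s x - U s y)‖ ≤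
      ε / G * (M * ‖x - y‖) := fun s hs ↦ by
    have hs' := Set.Ico_subset_Icc_self hs
    have hle := hlip x y hxr hy s hs'
    refine (hlin s hs' _ (hball x hxr s hs') _ (hball y hy s hs') (hle.trans_lt hx.2)).trans ?_
    gcongr
  have hJxy : ∀ s ∈ Set.Icc 0 T, HasDerivWithinAt (fun s ↦ J s (x - y))
      (A s (U s y) (J s (x - y))) (Set.Icc 0 T) s := fun s hs ↦ by
    simpa using (hJ s hs).clm_apply (hasDerivWithinAt_const s _ (x - y))
  have hmain := norm_sub_le_of_approx_linear (f := fun s ↦ U s x - U s y) hLpos (by positivity)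
    (fun s hs ↦ hL s hs _ (hball y hy s hs))
    ((h.continuousOn_Icc x T).sub (h.continuousOn_Icc y T))
    (fun s hs ↦ (h.hasDerivWithinAt_Ici x hs.1).sub (h.hasDerivWithinAt_Ici y hs.1))
    herr hJxy (by simp [h.map_zero, hJ0]) ht
  refine hmain.trans_eq ?_
  rw [show ε / G * (M * ‖x - y‖) * (Real.exp (L * T) / L) = ε / G * G * ‖x - y‖ by ring,
    div_mul_cancel₀ _ hG.ne']

theorem exists_hasFDerivAt (h : IsBoundedFlow Φ U) (hΦ : ∀ t x, HasFDerivAt (Φ t) (A t x) x)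
    (hA : Continuous (Function.uncurry A)) (y : E) {T : ℝ} (hT : 0 ≤ T) :
    ∃ J : ℝ → E →L[ℝ] E, ∀ t ∈ Set.Icc 0 T, HasFDerivAt (U t) (J t) y ∧
      HasDerivWithinAt J ((A t (U t y)).comp (J t)) (Set.Icc 0 T) t := by
  have hc : Continuous fun t ↦ U (max t 0) y :=
    (h.continuousOn y).comp_continuous (by fun_prop) fun t ↦ le_max_right t 0
  obtain ⟨J, hJ0, hJ⟩ := exists_hasDerivWithinAt_linear
    (A := fun t ↦ ContinuousLinearMap.compL ℝ E E E (A t (U (max t 0) y)))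
    ((ContinuousLinearMap.compL ℝ E E E).continuous.comp (hA.comp (continuous_id.prodMk hc)))
    hT (ContinuousLinearMap.id ℝ E)
  have hJ' : ∀ t ∈ Set.Icc 0 T,
      HasDerivWithinAt J ((A t (U t y)).comp (J t)) (Set.Icc 0 T) t := fun t ht ↦ by
    simpa only [max_eq_left ht.1, ContinuousLinearMap.compL_apply] using hJ t ht
  exact ⟨J, fun t ht ↦ ⟨h.hasFDerivAt_of_variational hΦ hA y hJ0 hJ' ht, hJ' t ht⟩⟩

theorem differentiableAt (h : IsBoundedFlow Φ U) (hΦ : ∀ t x, HasFDerivAt (Φ t) (A t x) x)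
    (hA : Continuous (Function.uncurry A)) (y : E) {t : ℝ} (ht : 0 ≤ t) :
    DifferentiableAt ℝ (U t) y := by
  obtain ⟨J, hJ⟩ := h.exists_hasFDerivAt hΦ hA y ht
  exact (hJ t ⟨ht, le_rfl⟩).1.differentiableAt

theorem hasDerivWithinAt_fderiv (h : IsBoundedFlow Φ U)
    (hΦ : ∀ t x, HasFDerivAt (Φ t) (A t x) x) (hA : Continuous (Function.uncurry A)) (y : E)
    {t : ℝ} (ht : 0 ≤ t) :
    HasDerivWithinAt (fun s ↦ fderiv ℝ (U s) y) ((A t (U t y)).comp (fderiv ℝ (U t) y))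
      (Set.Ici 0) t := by
  obtain ⟨J, hJ⟩ := h.exists_hasFDerivAt hΦ hA y (T := t + 1) (by linarith)
  have htT : t ∈ Set.Icc 0 (t + 1) := ⟨ht, by linarith⟩
  have hderiv := (hJ t htT).2.congr (fun s hs ↦ (hJ s hs).1.fderiv) (hJ t htT).1.fderiv
  rw [← (hJ t htT).1.fderiv] at hderiv
  refine hderiv.mono_of_mem_nhdsWithin ?_
  rw [← Set.Ici_inter_Iic]
  exact inter_mem self_mem_nhdsWithin (mem_nhdsWithin_of_mem_nhds (Iic_mem_nhds (by linarith)))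

end IsBoundedFlow

end Flow

section Dense

variable {E : Type*} [NormedAddCommGroup E] {Φ U : ℝ → E → E} {S : Set E}

theorem exists_forall_norm_le_of_dense (hS : Dense S) (hUc : ∀ t, 0 ≤ t → Continuous (U t))
    (hbdd : ∀ r T : ℝ, ∃ R : ℝ, ∀ x ∈ S, ‖x‖ ≤ r → ∀ t ∈ Set.Icc 0 T, ‖U t x‖ ≤ R) (r T : ℝ) :
    ∃ R : ℝ, ∀ x, ‖x‖ ≤ r → ∀ t ∈ Set.Icc 0 T, ‖U t x‖ ≤ R := by
  obtain ⟨R, hR⟩ := hbdd (r + 1) T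
  refine ⟨R, fun x hx t ht ↦ ?_⟩
  have : (𝓝[S] x).NeBot := mem_closure_iff_nhdsWithin_neBot.1 (hS x)
  have hlim : Tendsto (fun y ↦ ‖U t y‖) (𝓝[S] x) (𝓝 ‖U t x‖) :=
    (hUc t ht.1).norm.continuousAt.continuousWithinAt
  refine le_of_tendsto hlim ?_
  filter_upwards [self_mem_nhdsWithin,
    nhdsWithin_le_nhds (continuous_norm.continuousAt.eventually_lt_const
      (show ‖x‖ < r + 1 by linarith))] with y hy hyr
  exact hR y hy hyr.le t ht

theorem aestronglyMeasurable_comp_of_dense (hΦ : Continuous (Function.uncurry Φ))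
    (hS : Dense S) (hUc : ∀ t, 0 ≤ t → Continuous (U t))
    (hcont : ∀ x ∈ S, ContinuousOn (fun t ↦ U t x) (Set.Ici 0)) (x : E) (t : ℝ) :
    AEStronglyMeasurable (fun s ↦ Φ s (U s x)) (volume.restrict (Set.Ioc 0 t)) := by
  obtain ⟨y, hyS, hy⟩ := mem_closure_iff_seq_limit.1 (hS x)
  refine aestronglyMeasurable_of_tendsto_ae atTop (f := fun k s ↦ Φ s (U s (y k)))
    (fun k ↦ ?_) ?_
  · have hc : ContinuousOn (fun s ↦ Φ s (U s (y k))) (Set.Ici 0) :=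
      hΦ.comp_continuousOn (continuousOn_id.prodMk (hcont _ (hyS k)))
    exact (hc.mono fun s hs ↦ hs.1.le).aestronglyMeasurable measurableSet_Ioc
  · filter_upwards [ae_restrict_mem measurableSet_Ioc] with s hs
    exact ((hΦ.comp (Continuous.prodMk_right s)).comp (hUc s hs.1.le)).continuousAt.tendsto.comp hy

variable [NormedSpace ℝ E]

theorem hasDerivWithinAt_of_integral_eq [CompleteSpace E] (hΦ : Continuous (Function.uncurry Φ))
    {u : ℝ → E} {x : E} (hu : ContinuousOn u (Set.Ici 0))
    (heq : ∀ t, 0 ≤ t → u t = x + ∫ s in (0 : ℝ)..t, Φ s (u s)) {t : ℝ} (ht : 0 ≤ t) :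
    HasDerivWithinAt u (Φ t (u t)) (Set.Ici 0) t := by
  have huc : Continuous fun s ↦ u (max s 0) :=
    hu.comp_continuous (by fun_prop) fun t ↦ le_max_right t 0
  have hprim : HasDerivAt (fun r ↦ x + ∫ s in (0 : ℝ)..r, Φ s (u (max s 0)))
      (Φ t (u (max t 0))) t :=
    ((hΦ.comp (continuous_id.prodMk huc)).integral_hasStrictDerivAt 0 t).hasDerivAt.const_add x
  have hcongr : ∀ r ∈ Set.Ici (0 : ℝ), u r = x + ∫ s in (0 : ℝ)..r, Φ s (u (max s 0)) := by
    intro r hr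
    rw [heq r hr]
    congr 1
    refine intervalIntegral.integral_congr fun s hs ↦ ?_
    rw [Set.uIcc_of_le hr] at hs
    simp only [max_eq_left hs.1]
  simpa only [max_eq_left ht] using hprim.hasDerivWithinAt.congr hcongr (hcongr t ht)

theorem integral_eq_of_dense [ProperSpace E] (hΦ : Continuous (Function.uncurry Φ))
    (hS : Dense S) (hUc : ∀ t, 0 ≤ t → Continuous (U t))
    (hcont : ∀ x ∈ S, ContinuousOn (fun t ↦ U t x) (Set.Ici 0))
    (heq : ∀ x ∈ S, ∀ t, 0 ≤ t → U t x = x + ∫ s in (0 : ℝ)..t, Φ s (U s x))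
    (hbdd : ∀ r T : ℝ, ∃ R : ℝ, ∀ x, ‖x‖ ≤ r → ∀ t ∈ Set.Icc 0 T, ‖U t x‖ ≤ R) (x : E) {t : ℝ}
    (ht : 0 ≤ t) :
    IntervalIntegrable (fun s ↦ Φ s (U s x)) volume 0 t ∧
      U t x = x + ∫ s in (0 : ℝ)..t, Φ s (U s x) := by
  have : (𝓝[S] x).NeBot := mem_closure_iff_nhdsWithin_neBot.1 (hS x)
  obtain ⟨R, hR⟩ := hbdd (‖x‖ + 1) t
  obtain ⟨M, hM⟩ := ((isCompact_Icc (a := (0 : ℝ)) (b := t)).prod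
    (isCompact_closedBall (0 : E) R)).exists_bound_of_continuousOn hΦ.continuousOn
  have hΦM : ∀ y, ‖y‖ ≤ ‖x‖ + 1 → ∀ s ∈ Set.Ioc 0 t, ‖Φ s (U s y)‖ ≤ M := fun y hy s hs ↦
    have hst := Set.Ioc_subset_Icc_self hs
    hM (s, U s y) ⟨hst, mem_closedBall_zero_iff.2 (hR y hy s hst)⟩
  have hnear : ∀ᶠ y in 𝓝[S] x, ‖y‖ ≤ ‖x‖ + 1 :=
    nhdsWithin_le_nhds ((continuous_norm.continuousAt.eventually_lt_const
      (lt_add_one ‖x‖)).mono fun y hy ↦ hy.le)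
  have hmeas := fun y ↦ aestronglyMeasurable_comp_of_dense hΦ hS hUc hcont y t
  have hlim : ∀ s ∈ Set.Ioc 0 t, Tendsto (fun y ↦ Φ s (U s y)) (𝓝[S] x) (𝓝 (Φ s (U s x))) :=
    fun s hs ↦ ((hΦ.comp (Continuous.prodMk_right s)).comp
      (hUc s hs.1.le)).continuousAt.continuousWithinAt
  rw [intervalIntegrable_iff_integrableOn_Ioc_of_le ht]
  refine ⟨Integrable.of_bound (hmeas x) M ?_, ?_⟩
  · filter_upwards [ae_restrict_mem measurableSet_Ioc] with s hs
    exact hΦM x (by linarith) s hs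
  have hint : Tendsto (fun y ↦ y + ∫ s in (0 : ℝ)..t, Φ s (U s y)) (𝓝[S] x)
      (𝓝 (x + ∫ s in (0 : ℝ)..t, Φ s (U s x))) := by
    refine tendsto_nhdsWithin_of_tendsto_nhds tendsto_id |>.add ?_
    refine intervalIntegral.tendsto_integral_filter_of_dominated_convergence (fun _ ↦ M)
      ?_ ?_ intervalIntegrable_const ?_ <;> rw [Set.uIoc_of_le ht]
    · exact .of_forall hmeas
    · exact hnear.mono fun y hy ↦ .of_forall (hΦM y hy)
    · exact .of_forall hlim
  refine tendsto_nhds_unique (hUc t ht).continuousAt.continuousWithinAt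
    (hint.congr' ?_)
  filter_upwards [self_mem_nhdsWithin] with y hy
  exact (heq y hy t ht).symm

theorem IsBoundedFlow.of_dense [ProperSpace E] (hΦ : Continuous (Function.uncurry Φ))
    (hS : Dense S) (hUc : ∀ t, 0 ≤ t → Continuous (U t))
    (hcont : ∀ x ∈ S, ContinuousOn (fun t ↦ U t x) (Set.Ici 0))
    (heq : ∀ x ∈ S, ∀ t, 0 ≤ t → U t x = x + ∫ s in (0 : ℝ)..t, Φ s (U s x))
    (hbdd : ∀ r T : ℝ, ∃ R : ℝ, ∀ x ∈ S, ‖x‖ ≤ r → ∀ t ∈ Set.Icc 0 T, ‖U t x‖ ≤ R) :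
    IsBoundedFlow Φ U := by
  have hbdd' := exists_forall_norm_le_of_dense hS hUc hbdd
  have hint := fun x {t : ℝ} ↦ integral_eq_of_dense hΦ hS hUc hcont heq hbdd' x (t := t)
  refine ⟨fun x ↦ by simpa using (hint x le_rfl).2, fun x t ht ↦ ?_, hbdd'⟩
  refine hasDerivWithinAt_of_integral_eq hΦ (fun s hs ↦ ?_) (fun s hs ↦ (hint x hs).2) ht
  have hs1 : (0 : ℝ) ≤ s + 1 := by linarith [Set.mem_Ici.1 hs]
  have hprim : ContinuousOn (fun t ↦ x + ∫ r in (0 : ℝ)..t, Φ r (U r x)) (Set.Icc 0 (s + 1)) := by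
    refine continuousOn_const.add ?_
    rw [← Set.uIcc_of_le hs1]
    exact intervalIntegral.continuousOn_primitive_interval
      (((intervalIntegrable_iff' (by simp)).1 (hint x hs1).1))
  have hcontx : ContinuousOn (fun t ↦ U t x) (Set.Icc 0 (s + 1)) :=
    hprim.congr fun t ht ↦ (hint x ht.1).2
  refine (hcontx s ⟨hs, by linarith⟩).mono_of_mem_nhdsWithin ?_
  rw [← Set.Ici_inter_Iic]
  exact inter_mem self_mem_nhdsWithin (mem_nhdsWithin_of_mem_nhds (Iic_mem_nhds (by linarith)))

end Dense

/-! ### The power nonlinearity -/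

section PowerNonlin

variable {H : Type*} [NormedAddCommGroup H] {σ : ℝ}

theorem continuous_norm_sq_rpow (hσ : 0 ≤ σ) : Continuous fun u : H ↦ (‖u‖ ^ 2) ^ σ :=
  (continuous_norm.pow 2).rpow_const fun _ ↦ Or.inr hσ

theorem tendsto_norm_sq_rpow_nhds_zero (hσ : 0 < σ) :
    Tendsto (fun u : H ↦ (‖u‖ ^ 2) ^ σ) (𝓝 0) (𝓝 0) := by
  simpa [Real.zero_rpow hσ.ne'] using (continuous_norm_sq_rpow (H := H) hσ.le).tendsto 0

variable [InnerProductSpace ℝ H]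

/-- The nonlinearity `|u|^(2σ) u`. -/
def powerNonlin (σ : ℝ) (u : H) : H := (‖u‖ ^ 2) ^ σ • u

/-- The derivative of `powerNonlin` for `0 ≤ σ`. At `u = 0` the second summand vanishes whatever the
value of the power, which has a junk value there for `σ < 1`. -/
def powerNonlinDeriv (σ : ℝ) (u : H) : H →L[ℝ] H :=
  (‖u‖ ^ 2) ^ σ • ContinuousLinearMap.id ℝ H +
    (2 * σ * (‖u‖ ^ 2) ^ (σ - 1)) • (innerSL ℝ u).smulRight u

theorem powerNonlinDeriv_apply (σ : ℝ) (u v : H) : powerNonlinDeriv σ u v =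
    (‖u‖ ^ 2) ^ σ • v + (2 * σ * (‖u‖ ^ 2) ^ (σ - 1)) • inner ℝ u v • u := by
  simp [powerNonlinDeriv]

theorem inner_powerNonlinDeriv_comm (σ : ℝ) (u v v' : H) :
    inner ℝ (powerNonlinDeriv σ u v) v' = inner ℝ v (powerNonlinDeriv σ u v') := by
  simp only [powerNonlinDeriv_apply, inner_add_left, inner_add_right, real_inner_smul_left,
    real_inner_smul_right, real_inner_comm v u]
  ring

theorem powerNonlin_zero_exp : powerNonlin 0 = (id : H → H) := by
  ext u
  simp [powerNonlin]

theorem powerNonlin_zero_right (σ : ℝ) : powerNonlin σ (0 : H) = 0 := smul_zero _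

theorem powerNonlinDeriv_zero_exp (u : H) : powerNonlinDeriv 0 u = ContinuousLinearMap.id ℝ H := by
  ext
  simp [powerNonlinDeriv]

theorem powerNonlinDeriv_zero (hσ : 0 < σ) : powerNonlinDeriv σ (0 : H) = 0 := by
  ext
  simp [powerNonlinDeriv, Real.zero_rpow hσ.ne']

theorem continuous_powerNonlin (hσ : 0 ≤ σ) : Continuous (powerNonlin σ : H → H) :=
  (continuous_norm_sq_rpow hσ).smul continuous_id

theorem hasFDerivAt_powerNonlin_zero (hσ : 0 < σ) :
    HasFDerivAt (powerNonlin σ) (0 : H →L[ℝ] H) 0 := by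
  refine HasFDerivAt.of_isLittleO (Asymptotics.isLittleO_iff.2 fun c hc ↦ ?_)
  filter_upwards [(tendsto_norm_sq_rpow_nhds_zero (H := H) hσ).eventually_le_const hc] with u hu
  have hnorm : ‖powerNonlin σ u‖ = (‖u‖ ^ 2) ^ σ * ‖u‖ := by
    rw [powerNonlin, norm_smul, Real.norm_of_nonneg (by positivity)]
  simpa [hnorm, powerNonlin_zero_right] using mul_le_mul_of_nonneg_right hu (norm_nonneg u)

theorem hasFDerivAt_powerNonlin (hσ : 0 ≤ σ) (u : H) :
    HasFDerivAt (powerNonlin σ) (powerNonlinDeriv σ u) u := by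
  rcases hσ.eq_or_lt with rfl | hpos
  · rw [powerNonlin_zero_exp, powerNonlinDeriv_zero_exp]
    exact hasFDerivAt_id u
  rcases eq_or_ne u 0 with rfl | hu
  · rw [powerNonlinDeriv_zero hpos]
    exact hasFDerivAt_powerNonlin_zero hpos
  have hsq : HasFDerivAt (fun x : H ↦ ‖x‖ ^ 2) (2 • innerSL ℝ u) u :=
    (hasStrictFDerivAt_norm_sq u).hasFDerivAt
  have hne : ‖u‖ ^ 2 ≠ 0 := by simpa using hu
  refine ((hsq.rpow_const (p := σ) (Or.inl hne)).smul (hasFDerivAt_id u)).congr_fderiv ?_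
  ext
  simp only [powerNonlinDeriv_apply, id_eq, add_apply, smul_apply, ContinuousLinearMap.id_apply,
    ContinuousLinearMap.smulRight_apply, innerSL_apply_apply, smul_eq_mul, nsmul_eq_mul, smul_smul]
  push_cast
  ring_nf

theorem norm_rpow_smul_inner_smul_le (hσ : σ ≠ 0) (u v : H) :
    ‖(‖u‖ ^ 2) ^ (σ - 1) • inner ℝ u v • u‖ ≤ (‖u‖ ^ 2) ^ σ * ‖v‖ := by
  rcases eq_or_ne u 0 with rfl | hu
  · simp [Real.zero_rpow hσ]
  have hpow : (‖u‖ ^ 2) ^ σ = (‖u‖ ^ 2) ^ (σ - 1) * ‖u‖ ^ 2 := by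
    rw [← Real.rpow_add_one (by positivity), sub_add_cancel]
  rw [norm_smul, norm_smul, Real.norm_of_nonneg (by positivity), hpow]
  calc _ ≤ (‖u‖ ^ 2) ^ (σ - 1) * (‖u‖ * ‖v‖ * ‖u‖) := by
        gcongr
        exact norm_inner_le_norm u v
    _ = _ := by ring

theorem continuous_rpow_smul_inner_smul (hσ : 0 < σ) (v : H) :
    Continuous fun u : H ↦ (‖u‖ ^ 2) ^ (σ - 1) • inner ℝ u v • u := by
  refine continuous_iff_continuousAt.2 fun u ↦ ?_
  rcases eq_or_ne u 0 with rfl | hu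
  · have hlim := (tendsto_norm_sq_rpow_nhds_zero (H := H) hσ).mul_const ‖v‖
    rw [zero_mul] at hlim
    simpa [ContinuousAt] using
      squeeze_zero_norm (fun u ↦ norm_rpow_smul_inner_smul_le hσ.ne' u v) hlim
  have hne : ‖u‖ ^ 2 ≠ 0 := by simpa using hu
  have hpow : ContinuousAt (fun u : H ↦ (‖u‖ ^ 2) ^ (σ - 1)) u :=
    (continuous_norm.pow 2).continuousAt.rpow_const (Or.inl hne)
  exact hpow.smul (by fun_prop)

theorem continuous_powerNonlinDeriv_apply (hσ : 0 ≤ σ) (v : H) :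
    Continuous fun u ↦ powerNonlinDeriv σ u v := by
  rcases hσ.eq_or_lt with rfl | hpos
  · simp only [powerNonlinDeriv_zero_exp]
    exact continuous_const
  simp only [powerNonlinDeriv_apply, mul_smul]
  exact ((continuous_norm_sq_rpow hσ).smul continuous_const).add
    (((continuous_rpow_smul_inner_smul hpos v).const_smul σ).const_smul 2)

end PowerNonlin

/-! ### The deterministic vector field in a rotating frame -/

section MulVec

variable {ι H : Type*} [Fintype ι] [NormedAddCommGroup H]

/-- The action `x ↦ (∑ k, B j k • x k)_j` of a real matrix on vectors with entries in a real
normed space `H`; it generalizes `Matrix.mulVec`, which needs a product on `H`. -/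
def mulVecCLM [NormedSpace ℝ H] (B : Matrix ι ι ℝ) : (ι → H) →L[ℝ] (ι → H) :=
  ContinuousLinearMap.pi fun j ↦ ∑ k, B j k • ContinuousLinearMap.proj k

theorem mulVecCLM_apply [NormedSpace ℝ H] (B : Matrix ι ι ℝ) (x : ι → H) (j : ι) :
    mulVecCLM B x j = ∑ k, B j k • x k := by
  simp [mulVecCLM]

theorem mulVecCLM_mul [NormedSpace ℝ H] (B C : Matrix ι ι ℝ) (x : ι → H) :
    mulVecCLM (B * C) x = mulVecCLM B (mulVecCLM C x) := by
  ext j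
  simp only [mulVecCLM_apply, Matrix.mul_apply, Finset.sum_smul, Finset.smul_sum, mul_smul]
  exact Finset.sum_comm

theorem sum_inner_mulVecCLM_left [InnerProductSpace ℝ H] (B : Matrix ι ι ℝ) (x y : ι → H) :
    ∑ j, inner ℝ (mulVecCLM B x j) (y j) = ∑ j, inner ℝ (x j) (mulVecCLM Bᵀ y j) := by
  simp only [mulVecCLM_apply, sum_inner, inner_sum, real_inner_smul_left, real_inner_smul_right,
    Matrix.transpose_apply]
  exact Finset.sum_comm

end MulVec

section Field

variable {ι : Type*}

/-- The componentwise rotation `u_j ↦ e^{i θ_j} u_j`. -/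
def phaseShift (θ : ι → ℝ) : (ι → ℂ) →L[ℝ] (ι → ℂ) :=
  ContinuousLinearMap.pi fun j ↦
    ContinuousLinearMap.mul ℝ ℂ (Complex.exp (θ j * Complex.I)) ∘L ContinuousLinearMap.proj j

theorem phaseShift_apply (θ : ι → ℝ) (u : ι → ℂ) (j : ι) :
    phaseShift θ u j = Complex.exp (θ j * Complex.I) * u j := by
  simp [phaseShift]

theorem phaseShift_neg_phaseShift (θ : ι → ℝ) (u : ι → ℂ) :
    phaseShift (-θ) (phaseShift θ u) = u := by
  ext j
  rw [phaseShift_apply, phaseShift_apply, ← mul_assoc, ← Complex.exp_add]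
  simp

theorem phaseShift_phaseShift_neg (θ : ι → ℝ) (u : ι → ℂ) :
    phaseShift θ (phaseShift (-θ) u) = u := by
  simpa using phaseShift_neg_phaseShift (-θ) u

theorem inner_phaseShift_phaseShift (θ : ι → ℝ) (u v : ι → ℂ) (j : ι) :
    inner ℝ (phaseShift θ u j) (phaseShift θ v j) = inner ℝ (u j) (v j) := by
  simpa [phaseShift_apply] using (rotation (Circle.exp (θ j))).inner_map_map (u j) (v j)

theorem inner_phaseShift_right (θ : ι → ℝ) (u v : ι → ℂ) (j : ι) :
    inner ℝ (u j) (phaseShift θ v j) = inner ℝ (phaseShift (-θ) u j) (v j) := by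
  rw [← inner_phaseShift_phaseShift θ (phaseShift (-θ) u), phaseShift_phaseShift_neg]

theorem continuous_phaseShift_apply :
    Continuous fun p : (ι → ℝ) × (ι → ℂ) ↦ phaseShift p.1 p.2 := by
  refine continuous_pi fun j ↦ ?_
  simp only [phaseShift_apply]
  fun_prop

variable [Fintype ι] (B : Matrix ι ι ℝ) (lam σ : ℝ)

/-- The right-hand side `i (B u - λ |u|^(2σ) u)` of the noiseless system, where `u = p + i q`. -/
def schrodingerField (u : ι → ℂ) : ι → ℂ :=
  fun j ↦ Complex.I * (mulVecCLM B u j - lam • powerNonlin σ (u j))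

/-- The derivative of `schrodingerField`. -/
def schrodingerFieldDeriv (u : ι → ℂ) : (ι → ℂ) →L[ℝ] (ι → ℂ) :=
  ContinuousLinearMap.pi fun j ↦ ContinuousLinearMap.mul ℝ ℂ Complex.I ∘L
    (ContinuousLinearMap.proj j ∘L mulVecCLM B -
      lam • (powerNonlinDeriv σ (u j) ∘L ContinuousLinearMap.proj j))

/-- The field `schrodingerField` in the frame rotating with the phases `θ`: if `u` solves
`u' = schrodingerField u` up to a phase noise `θ`, then `phaseShift θ u` solves the equation of
this field. -/
def gaugedField (θ : ι → ℝ) (u : ι → ℂ) : ι → ℂ :=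
  phaseShift θ (schrodingerField B lam σ (phaseShift (-θ) u))

/-- The derivative of `gaugedField` in the second variable. -/
def gaugedFieldDeriv (θ : ι → ℝ) (u : ι → ℂ) : (ι → ℂ) →L[ℝ] (ι → ℂ) :=
  phaseShift θ ∘L schrodingerFieldDeriv B lam σ (phaseShift (-θ) u) ∘L phaseShift (-θ)

variable {σ}

theorem schrodingerFieldDeriv_apply (u v : ι → ℂ) (j : ι) :
    schrodingerFieldDeriv B lam σ u v j =
      Complex.I * (mulVecCLM B v j - lam • powerNonlinDeriv σ (u j) (v j)) := by
  rfl

theorem continuous_schrodingerField (hσ : 0 ≤ σ) : Continuous (schrodingerField B lam σ) := by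
  have := continuous_powerNonlin (H := ℂ) hσ
  unfold schrodingerField
  fun_prop

theorem hasFDerivAt_schrodingerField (hσ : 0 ≤ σ) (u : ι → ℂ) :
    HasFDerivAt (schrodingerField B lam σ) (schrodingerFieldDeriv B lam σ u) u :=
  hasFDerivAt_pi.2 fun j ↦ (ContinuousLinearMap.mul ℝ ℂ Complex.I).hasFDerivAt.comp u
    ((((ContinuousLinearMap.proj j).comp (mulVecCLM B)).hasFDerivAt).sub
      (((hasFDerivAt_powerNonlin hσ (u j)).comp u (hasFDerivAt_apply j u)).const_smul lam))

theorem continuous_schrodingerFieldDeriv (hσ : 0 ≤ σ) :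
    Continuous (schrodingerFieldDeriv B lam σ) := by
  refine continuous_clm_apply.2 fun v ↦ continuous_pi fun j ↦ ?_
  have := continuous_powerNonlinDeriv_apply hσ (v j)
  simp only [schrodingerFieldDeriv_apply]
  fun_prop

theorem hasFDerivAt_gaugedField (hσ : 0 ≤ σ) (θ : ι → ℝ) (u : ι → ℂ) :
    HasFDerivAt (gaugedField B lam σ θ) (gaugedFieldDeriv B lam σ θ u) u :=
  (phaseShift θ).hasFDerivAt.comp u
    ((hasFDerivAt_schrodingerField B lam hσ _).comp u (phaseShift (-θ)).hasFDerivAt)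

theorem continuous_gaugedField (hσ : 0 ≤ σ) :
    Continuous fun p : (ι → ℝ) × (ι → ℂ) ↦ gaugedField B lam σ p.1 p.2 :=
  continuous_phaseShift_apply.comp <| continuous_fst.prodMk <|
    (continuous_schrodingerField B lam hσ).comp <|
      continuous_phaseShift_apply.comp (continuous_fst.neg.prodMk continuous_snd)

theorem continuous_gaugedFieldDeriv (hσ : 0 ≤ σ) :
    Continuous fun p : (ι → ℝ) × (ι → ℂ) ↦ gaugedFieldDeriv B lam σ p.1 p.2 := by
  refine continuous_clm_apply.2 fun v ↦ ?_
  have hrot := continuous_phaseShift_apply (ι := ι)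
  exact hrot.comp <| continuous_fst.prodMk <|
    ((continuous_schrodingerFieldDeriv B lam hσ).comp
      (hrot.comp (continuous_fst.neg.prodMk continuous_snd))).clm_apply
      (hrot.comp (continuous_fst.neg.prodMk continuous_const))

variable {X : Type*} [TopologicalSpace X] {θ : X → ι → ℝ}

theorem continuous_uncurry_gaugedField (hσ : 0 ≤ σ) (hθ : Continuous θ) :
    Continuous (Function.uncurry fun t ↦ gaugedField B lam σ (θ t)) :=
  (continuous_gaugedField B lam hσ).comp (f := Prod.map θ id) (hθ.prodMap continuous_id)

theorem continuous_uncurry_gaugedFieldDeriv (hσ : 0 ≤ σ) (hθ : Continuous θ) :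
    Continuous (Function.uncurry fun t ↦ gaugedFieldDeriv B lam σ (θ t)) :=
  (continuous_gaugedFieldDeriv B lam hσ).comp (f := Prod.map θ id) (hθ.prodMap continuous_id)

theorem inner_I_mul_left (a b : ℂ) : inner ℝ (Complex.I * a) b = -inner ℝ a (Complex.I * b) := by
  simp [Complex.inner]
  ring

theorem inner_I_mul_self (a : ℂ) : inner ℝ a (Complex.I * a) = 0 := by
  have := inner_I_mul_left a a
  rw [real_inner_comm] at this
  linarith

theorem inner_schrodingerField (σ : ℝ) (u : ι → ℂ) (j : ι) :
    inner ℝ (u j) (schrodingerField B lam σ u j) =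
      inner ℝ (u j) (Complex.I * mulVecCLM B u j) := by
  rw [schrodingerField, mul_sub, inner_sub_right, powerNonlin, smul_smul, mul_smul_comm,
    inner_smul_right, inner_I_mul_self, mul_zero, sub_zero]

variable {B}

theorem sum_inner_I_mul_mulVecCLM (hB : Bᵀ = B) (u : ι → ℂ) :
    ∑ j, inner ℝ (u j) (Complex.I * mulVecCLM B u j) = 0 := by
  have hcomm : ∀ j, Complex.I * mulVecCLM B u j = mulVecCLM B (fun k ↦ Complex.I * u k) j :=
    fun j ↦ by simp only [mulVecCLM_apply, Finset.mul_sum, mul_smul_comm]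
  have hswap := sum_inner_mulVecCLM_left B u fun k ↦ Complex.I * u k
  simp only [hB, ← hcomm] at hswap
  have hskew : ∀ j, inner ℝ (mulVecCLM B u j) (Complex.I * u j) =
      -inner ℝ (u j) (Complex.I * mulVecCLM B u j) := fun j ↦ by
    rw [real_inner_comm, inner_I_mul_left]
  simp only [hskew, Finset.sum_neg_distrib] at hswap
  linarith

theorem sum_inner_gaugedField (hB : Bᵀ = B) (σ : ℝ) (θ : ι → ℝ) (u : ι → ℂ) :
    ∑ j, inner ℝ (u j) (gaugedField B lam σ θ u j) = 0 := by
  simp only [gaugedField, inner_phaseShift_right, inner_schrodingerField]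
  exact sum_inner_I_mul_mulVecCLM hB _

theorem sum_norm_sq_eq_of_gaugedField (hB : Bᵀ = B) {σ : ℝ} {θ : ℝ → ι → ℝ} {u : ℝ → ι → ℂ}
    (hu : ∀ t, 0 ≤ t →
      HasDerivWithinAt u (gaugedField B lam σ (θ t) (u t)) (Set.Ici 0) t) {t : ℝ} (ht : 0 ≤ t) :
    ∑ j, ‖u t j‖ ^ 2 = ∑ j, ‖u 0 j‖ ^ 2 := by
  have hderiv : ∀ s, 0 ≤ s → HasDerivWithinAt (fun r ↦ ∑ j, ‖u r j‖ ^ 2) 0 (Set.Ici 0) s := by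
    intro s hs
    refine (HasDerivWithinAt.fun_sum fun j _ ↦
      (hasDerivWithinAt_pi.1 (hu s hs) j).norm_sq).congr_deriv ?_
    rw [← Finset.mul_sum, sum_inner_gaugedField lam hB, mul_zero]
  exact constant_of_has_deriv_right_zero
    (fun s hs ↦ (hderiv s hs.1).continuousWithinAt.mono Set.Icc_subset_Ici_self)
    (fun s hs ↦ (hderiv s hs.1).mono (Set.Ici_subset_Ici.2 hs.1)) t ⟨ht, le_rfl⟩

theorem norm_le_of_sum_norm_sq_eq {u v : ι → ℂ} (h : ∑ j, ‖u j‖ ^ 2 = ∑ j, ‖v j‖ ^ 2) :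
    ‖u‖ ≤ √(Fintype.card ι) * ‖v‖ := by
  refine (pi_norm_le_iff_of_nonneg (by positivity)).2 fun j ↦ ?_
  refine abs_le_of_sq_le_sq' ?_ (by positivity) |>.2
  calc ‖u j‖ ^ 2 ≤ ∑ k, ‖u k‖ ^ 2 :=
        Finset.single_le_sum (f := fun k ↦ ‖u k‖ ^ 2) (fun k _ ↦ by positivity) (Finset.mem_univ j)
    _ = ∑ k, ‖v k‖ ^ 2 := h
    _ ≤ ∑ _k : ι, ‖v‖ ^ 2 := by
        gcongr with k
        exact norm_le_pi_norm v k
    _ = (√(Fintype.card ι) * ‖v‖) ^ 2 := by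
        rw [Finset.sum_const, Finset.card_univ, nsmul_eq_mul, mul_pow,
          Real.sq_sqrt (Nat.cast_nonneg _)]

end Field

/-! ### Differential forms along the flow -/

section Matrices

variable {E : Type*} [NormedAddCommGroup E] [NormedSpace ℝ E]

theorem half_wedgeMat_matM (θ : Fin 4 → E →L[ℝ] ℝ) (ξ η : E) :
    1 / 2 * wedgeMat θ matM θ ξ η = θ 0 ξ * θ 1 η - θ 0 η * θ 1 ξ := by
  simp [wedgeMat, wedge, matM, Fin.sum_univ_four]
  ring

theorem wedgeMat_matK (θ ϑ : Fin 4 → E →L[ℝ] ℝ) (ξ η : E) :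
    wedgeMat θ matK ϑ ξ η = -(θ 0 ξ * ϑ 2 η - θ 0 η * ϑ 2 ξ) - (θ 1 ξ * ϑ 3 η - θ 1 η * ϑ 3 ξ) +
      (θ 2 ξ * ϑ 0 η - θ 2 η * ϑ 0 ξ) + (θ 3 ξ * ϑ 1 η - θ 3 η * ϑ 1 ξ) := by
  simp [wedgeMat, wedge, matK, Fin.sum_univ_four]
  ring

end Matrices

section States

variable {N : ℕ}

/-- The complex coordinates `p + i q` on the space of initial data. -/
def complexEquiv (N : ℕ) : Phase N ≃L[ℝ] (Fin N → ℂ) :=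
  LinearEquiv.toContinuousLinearEquiv
    { toFun y j := y.1 j + y.2 j * Complex.I
      invFun x := (fun j ↦ (x j).re, fun j ↦ (x j).im)
      map_add' y y' := by
        ext j
        simp only [Prod.fst_add, Prod.snd_add, Pi.add_apply]
        push_cast
        ring
      map_smul' r y := by
        ext j
        simp [mul_assoc]
      left_inv y := by simp
      right_inv x := by
        ext j
        simp }

theorem complexEquiv_apply (y : Phase N) (j : Fin N) :
    complexEquiv N y j = y.1 j + y.2 j * Complex.I := rfl

/-- The complex unknown `p + i q` of a state `z = (p, q, v, w)`. -/
def complexState (z : Fin N → Fin 4 → ℝ) : Fin N → ℂ := fun j ↦ z j 0 + z j 1 * Complex.I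

theorem continuous_complexState :
    Continuous (complexState : (Fin N → Fin 4 → ℝ) → Fin N → ℂ) := by
  unfold complexState
  fun_prop

variable (D : Matrix (Fin N) (Fin N) ℝ)

/-- The state `(p, q, v, w)` with `v = D p`, `w = D q` of the complex unknown `p + i q`. -/
def fullState : (Fin N → ℂ) →L[ℝ] (Fin N → Fin 4 → ℝ) :=
  ContinuousLinearMap.pi fun j ↦ ContinuousLinearMap.pi
    ![Complex.reCLM ∘L ContinuousLinearMap.proj j, Complex.imCLM ∘L ContinuousLinearMap.proj j,
      Complex.reCLM ∘L ContinuousLinearMap.proj j ∘L mulVecCLM D,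
      Complex.imCLM ∘L ContinuousLinearMap.proj j ∘L mulVecCLM D]

theorem fullState_apply (u : Fin N → ℂ) (j : Fin N) :
    fullState D u j = ![(u j).re, (u j).im, (mulVecCLM D u j).re, (mulVecCLM D u j).im] := by
  ext c
  fin_cases c <;> rfl

theorem sum_mul_fullState (u : Fin N → ℂ) (j : Fin N) (c : Fin 4) :
    ∑ k, D j k * fullState D u k c = fullState D (mulVecCLM D u) j c := by
  fin_cases c <;> simp [fullState_apply, mulVecCLM_apply]

variable {D}

theorem mulVecCLM_complexState (z : Fin N → Fin 4 → ℝ) (j : Fin N) :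
    mulVecCLM D (complexState z) j =
      ((D *ᵥ fun k ↦ z k 0) j : ℝ) + ((D *ᵥ fun k ↦ z k 1) j : ℝ) * Complex.I := by
  simp only [mulVecCLM_apply, complexState, Matrix.mulVec, dotProduct, Complex.real_smul]
  push_cast
  rw [Finset.sum_mul, ← Finset.sum_add_distrib]
  exact Finset.sum_congr rfl fun k _ ↦ by ring

theorem fullState_complexState {z : Fin N → Fin 4 → ℝ}
    (hv : ∀ j, (D *ᵥ fun k ↦ z k 0) j = z j 2) (hw : ∀ j, (D *ᵥ fun k ↦ z k 1) j = z j 3) :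
    fullState D (complexState z) = z := by
  ext j c
  rw [fullState_apply, mulVecCLM_complexState, hv, hw]
  fin_cases c <;> simp [complexState]

variable {F : Phase N → Fin N → Fin 4 → ℝ} {L : Phase N →L[ℝ] (Fin N → ℂ)} {y : Phase N}

theorem dz_apply_of_hasFDerivAt (hF : HasFDerivAt F (fullState D ∘L L) y) (j : Fin N)
    (c : Fin 4) (ξ : Phase N) : dz F j y c ξ = fullState D (L ξ) j c := by
  rw [dz, (hasFDerivAt_pi'.1 (hasFDerivAt_pi'.1 hF j) c).fderiv]
  rfl

theorem dGz_apply_of_hasFDerivAt (hF : HasFDerivAt F (fullState D ∘L L) y) (j : Fin N)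
    (c : Fin 4) (ξ : Phase N) : dGz D F j y c ξ = fullState D (mulVecCLM D (L ξ)) j c := by
  simp only [dGz, sum_apply, smul_apply, smul_eq_mul,
    dz_apply_of_hasFDerivAt hF, sum_mul_fullState]

theorem symplForm_of_hasFDerivAt (hF : HasFDerivAt F (fullState D ∘L L) y) (j : Fin N)
    (ξ η : Phase N) : symplForm F j y ξ η = inner ℝ (Complex.I * L ξ j) (L η j) := by
  simp only [symplForm, half_wedgeMat_matM, dz_apply_of_hasFDerivAt hF, fullState_apply]
  simp [Complex.inner]
  ring

theorem wedgeMat_matK_of_hasFDerivAt (hF : HasFDerivAt F (fullState D ∘L L) y) (j : Fin N)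
    (ξ η : Phase N) : wedgeMat (dz F j y) matK (dGz D F j y) ξ η =
      inner ℝ (mulVecCLM (D * D) (L ξ) j) (L η j) -
        inner ℝ (L ξ j) (mulVecCLM (D * D) (L η) j) := by
  simp only [wedgeMat_matK, dz_apply_of_hasFDerivAt hF, dGz_apply_of_hasFDerivAt hF,
    fullState_apply, mulVecCLM_mul]
  simp [Complex.inner]
  ring

end States

section Forms

variable {ι : Type*}

theorem inner_I_mul_phaseShift (θ : ι → ℝ) (u v : ι → ℂ) (j : ι) :
    inner ℝ (Complex.I * phaseShift θ u j) (phaseShift θ v j) =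
      inner ℝ (Complex.I * u j) (v j) := by
  rw [← inner_phaseShift_phaseShift θ (fun k ↦ Complex.I * u k) v, phaseShift_apply θ u,
    phaseShift_apply θ fun k ↦ Complex.I * u k, mul_left_comm]

variable [Fintype ι] (B : Matrix ι ι ℝ) (lam σ : ℝ)

theorem inner_I_mul_schrodingerFieldDeriv (u v w : ι → ℂ) (j : ι) :
    inner ℝ (Complex.I * v j) (schrodingerFieldDeriv B lam σ u w j) +
        inner ℝ (Complex.I * schrodingerFieldDeriv B lam σ u v j) (w j) =
      inner ℝ (v j) (mulVecCLM B w j) - inner ℝ (mulVecCLM B v j) (w j) := by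
  simp only [schrodingerFieldDeriv_apply, inner_I_mul_left, ← mul_assoc, Complex.I_mul_I,
    neg_one_mul, inner_neg_right, neg_neg]
  simp only [inner_neg_left, inner_sub_left, inner_sub_right, real_inner_smul_left,
    real_inner_smul_right, inner_powerNonlinDeriv_comm]
  ring

variable {B lam σ}

theorem hasDerivWithinAt_inner_I_mul_of_variational {θ : ι → ℝ} {u : ι → ℂ} {v w : ℝ → ι → ℂ}
    {s : Set ℝ} {t : ℝ} (hv : HasDerivWithinAt v (gaugedFieldDeriv B lam σ θ u (v t)) s t)
    (hw : HasDerivWithinAt w (gaugedFieldDeriv B lam σ θ u (w t)) s t) (j : ι) :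
    HasDerivWithinAt (fun r ↦ inner ℝ (Complex.I * v r j) (w r j))
      (inner ℝ (phaseShift (-θ) (v t) j) (mulVecCLM B (phaseShift (-θ) (w t)) j) -
        inner ℝ (mulVecCLM B (phaseShift (-θ) (v t)) j) (phaseShift (-θ) (w t) j)) s t := by
  refine (((hasDerivWithinAt_pi.1 hv j).const_mul Complex.I).inner ℝ
    (hasDerivWithinAt_pi.1 hw j)).congr_deriv ?_
  rw [← inner_I_mul_schrodingerFieldDeriv B lam σ (phaseShift (-θ) u)]
  nth_rw 1 [← phaseShift_phaseShift_neg θ (v t)]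
  nth_rw 2 [← phaseShift_phaseShift_neg θ (w t)]
  exact congrArg₂ (· + ·) (inner_I_mul_phaseShift ..) (inner_I_mul_phaseShift ..)

end Forms

section StateFlow

variable {N : ℕ} {D : Matrix (Fin N) (Fin N) ℝ} {lam σ : ℝ} {θ : ℝ → Fin N → ℝ}
  {U : ℝ → (Fin N → ℂ) → Fin N → ℂ}

/-- The flow of states `(p, q, v, w)` whose complex unknown `p + i q` is `U` seen from the frame
rotating with the phases `θ`. -/
def stateFlow (D : Matrix (Fin N) (Fin N) ℝ) (θ : ℝ → Fin N → ℝ)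
    (U : ℝ → (Fin N → ℂ) → Fin N → ℂ) (t : ℝ) (y : Phase N) : Fin N → Fin 4 → ℝ :=
  fullState D (phaseShift (-θ t) (U t (complexEquiv N y)))

theorem hasFDerivAt_stateFlow {t : ℝ} {y : Phase N}
    (hU : DifferentiableAt ℝ (U t) (complexEquiv N y)) :
    HasFDerivAt (stateFlow D θ U t) (fullState D ∘L phaseShift (-θ t) ∘L
      fderiv ℝ (U t) (complexEquiv N y) ∘L (complexEquiv N : Phase N →L[ℝ] Fin N → ℂ)) y :=
  (fullState D).hasFDerivAt.comp y <| (phaseShift (-θ t)).hasFDerivAt.comp y <|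
    hU.hasFDerivAt.comp y (complexEquiv N).hasFDerivAt

theorem hasFDerivAt_stateFlow_of_isBoundedFlow (hσ : 0 ≤ σ) (hθ : Continuous θ)
    (hU : IsBoundedFlow (fun t ↦ gaugedField (D * D) lam σ (θ t)) U) {t : ℝ} (ht : 0 ≤ t)
    (y : Phase N) :
    HasFDerivAt (stateFlow D θ U t) (fullState D ∘L phaseShift (-θ t) ∘L
      fderiv ℝ (U t) (complexEquiv N y) ∘L (complexEquiv N : Phase N →L[ℝ] Fin N → ℂ)) y :=
  hasFDerivAt_stateFlow <| hU.differentiableAt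
    (fun t ↦ hasFDerivAt_gaugedField (D * D) lam hσ (θ t))
    (continuous_uncurry_gaugedFieldDeriv (D * D) lam hσ hθ) _ ht

theorem hasDerivWithinAt_fderiv_apply (hσ : 0 ≤ σ) (hθ : Continuous θ)
    (hU : IsBoundedFlow (fun t ↦ gaugedField (D * D) lam σ (θ t)) U) {t : ℝ} (ht : 0 ≤ t)
    (x v : Fin N → ℂ) :
    HasDerivWithinAt (fun s ↦ fderiv ℝ (U s) x v)
      (gaugedFieldDeriv (D * D) lam σ (θ t) (U t x) (fderiv ℝ (U t) x v)) (Set.Ici 0) t := by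
  have hderiv := hU.hasDerivWithinAt_fderiv
    (fun t ↦ hasFDerivAt_gaugedField (D * D) lam hσ (θ t))
    (continuous_uncurry_gaugedFieldDeriv (D * D) lam hσ hθ) x ht
  simpa using hderiv.clm_apply (hasDerivWithinAt_const t (Set.Ici 0) v)

theorem symplForm_stateFlow (hσ : 0 ≤ σ) (hθ : Continuous θ)
    (hU : IsBoundedFlow (fun t ↦ gaugedField (D * D) lam σ (θ t)) U) {t : ℝ} (ht : 0 ≤ t)
    (j : Fin N) (y ξ η : Phase N) :
    symplForm (stateFlow D θ U t) j y ξ η =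
      inner ℝ (Complex.I * fderiv ℝ (U t) (complexEquiv N y) (complexEquiv N ξ) j)
        (fderiv ℝ (U t) (complexEquiv N y) (complexEquiv N η) j) := by
  rw [symplForm_of_hasFDerivAt (hasFDerivAt_stateFlow_of_isBoundedFlow hσ hθ hU ht y)]
  exact inner_I_mul_phaseShift ..

theorem hasDerivWithinAt_symplForm_stateFlow (hσ : 0 ≤ σ) (hθ : Continuous θ)
    (hU : IsBoundedFlow (fun t ↦ gaugedField (D * D) lam σ (θ t)) U) {t : ℝ} (ht : 0 ≤ t)
    (j : Fin N) (y ξ η : Phase N) :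
    HasDerivWithinAt (fun s ↦ symplForm (stateFlow D θ U s) j y ξ η)
      (-wedgeMat (dz (stateFlow D θ U t) j y) matK (dGz D (stateFlow D θ U t) j y) ξ η)
      (Set.Ici 0) t := by
  rw [wedgeMat_matK_of_hasFDerivAt (hasFDerivAt_stateFlow_of_isBoundedFlow hσ hθ hU ht y), neg_sub]
  refine (hasDerivWithinAt_inner_I_mul_of_variational
    (hasDerivWithinAt_fderiv_apply hσ hθ hU ht (complexEquiv N y) (complexEquiv N ξ))
    (hasDerivWithinAt_fderiv_apply hσ hθ hU ht (complexEquiv N y) (complexEquiv N η)) j).congr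
    (fun s hs ↦ ?_) ?_
  exacts [symplForm_stateFlow hσ hθ hU hs j y ξ η, symplForm_stateFlow hσ hθ hU ht j y ξ η]

theorem transpose_mul_self_of_skew {n R : Type*} [Fintype n] [CommRing R] {D : Matrix n n R}
    (hD : Dᵀ = -D) : (D * D)ᵀ = D * D := by
  rw [Matrix.transpose_mul, hD, neg_mul_neg]

theorem hasDerivWithinAt_sum_symplForm_stateFlow (hD : Dᵀ = -D) (hσ : 0 ≤ σ) (hθ : Continuous θ)
    (hU : IsBoundedFlow (fun t ↦ gaugedField (D * D) lam σ (θ t)) U) {t : ℝ} (ht : 0 ≤ t)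
    (y ξ η : Phase N) :
    HasDerivWithinAt (fun s ↦ ∑ j, symplForm (stateFlow D θ U s) j y ξ η) 0 (Set.Ici 0) t := by
  refine (HasDerivWithinAt.fun_sum fun j _ ↦
    hasDerivWithinAt_symplForm_stateFlow hσ hθ hU ht j y ξ η).congr_deriv ?_
  simp only [wedgeMat_matK_of_hasFDerivAt
    (hasFDerivAt_stateFlow_of_isBoundedFlow hσ hθ hU ht y), Finset.sum_neg_distrib,
    Finset.sum_sub_distrib]
  rw [sum_inner_mulVecCLM_left, transpose_mul_self_of_skew hD, sub_self, neg_zero]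

theorem sum_symplForm_stateFlow_eq (hD : Dᵀ = -D) (hσ : 0 ≤ σ) (hθ : Continuous θ)
    (hU : IsBoundedFlow (fun t ↦ gaugedField (D * D) lam σ (θ t)) U) {t : ℝ} (ht : 0 ≤ t)
    (y ξ η : Phase N) :
    ∑ j, symplForm (stateFlow D θ U t) j y ξ η = ∑ j, symplForm (stateFlow D θ U 0) j y ξ η := by
  have hderiv := fun {s : ℝ} (hs : 0 ≤ s) ↦
    hasDerivWithinAt_sum_symplForm_stateFlow hD hσ hθ hU hs y ξ η
  exact constant_of_has_deriv_right_zero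
    (fun s hs ↦ (hderiv hs.1).continuousWithinAt.mono Set.Icc_subset_Ici_self)
    (fun s hs ↦ (hderiv hs.1).mono (Set.Ici_subset_Ici.2 hs.1)) t ⟨ht, le_rfl⟩

end StateFlow

/-! ### The differentiation matrix -/

section DifferentiationMatrix

variable (α a b : ℝ) (N : ℕ)

theorem complexD1_transpose : (complexD1 α a b N)ᵀ = -complexD1 α a b N := by
  ext j l
  simp only [Matrix.transpose_apply, Matrix.neg_apply, complexD1, Matrix.of_apply,
    ← Finset.sum_neg_distrib]
  refine Finset.sum_nbij' (fun k ↦ -k) (fun k ↦ -k) ?_ ?_ (by simp) (by simp) fun k _ ↦ ?_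
  · grind
  · grind
  have hweight : modeWeight N (-k) = modeWeight N k := by simp [modeWeight]
  have hphase : ((-k : ℤ) : ℝ) * baseFreq a b * (gridPoint a b N j - gridPoint a b N l) =
      k * baseFreq a b * (gridPoint a b N l - gridPoint a b N j) := by
    push_cast
    ring
  rw [hweight, hphase]
  push_cast
  simp only [neg_mul, mul_neg, abs_neg, neg_neg]

theorem D1_transpose : (D1 α a b N)ᵀ = -D1 α a b N := by
  rw [D1, ← Matrix.transpose_map, complexD1_transpose]
  ext j l
  simp

variable {a b N}

theorem gridPoint_mem_Icc (hab : a ≤ b) (j : Fin N) : gridPoint a b N j ∈ Set.Icc a b := by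
  have hN : (0 : ℝ) < N := by exact_mod_cast j.pos
  have hstep : 0 ≤ (b - a) / N := div_nonneg (sub_nonneg.2 hab) hN.le
  have hle : (j : ℝ) * ((b - a) / N) ≤ N * ((b - a) / N) :=
    mul_le_mul_of_nonneg_right (by exact_mod_cast j.2.le) hstep
  rw [mul_div_cancel₀ _ hN.ne'] at hle
  have hnonneg : 0 ≤ (j : ℝ) * ((b - a) / N) := by positivity
  exact ⟨by unfold gridPoint; linarith, by unfold gridPoint; linarith⟩

end DifferentiationMatrix

/-! ### Almost sure convergence along dyadic partitions -/

section CommonSubsequence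

variable {Ω : Type*} {mΩ : MeasurableSpace Ω} {P : Measure Ω} {E : Type*} [PseudoEMetricSpace E]

theorem ae_tendsto_of_forall_measure_edist_ge_le {f : ℕ → Ω → E} {g : Ω → E} {ε : ℕ → ℝ≥0∞}
    (hε : ∑' k, ε k ≠ ∞) (h : ∀ k, P {ω | ε k ≤ edist (f k ω) (g ω)} ≤ ε k) :
    ∀ᵐ ω ∂P, Tendsto (fun k ↦ f k ω) atTop (𝓝 (g ω)) := by
  have hsum : ∑' k, P {ω | ε k ≤ edist (f k ω) (g ω)} ≠ ∞ :=
    ne_top_of_le_ne_top hε (ENNReal.tsum_le_tsum h)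
  filter_upwards [ae_eventually_notMem hsum] with ω hω
  rw [tendsto_iff_edist_tendsto_0]
  refine tendsto_of_tendsto_of_tendsto_of_le_of_le' tendsto_const_nhds
    (ENNReal.tendsto_atTop_zero_of_tsum_ne_top hε) (Eventually.of_forall fun _ ↦ zero_le) ?_
  filter_upwards [hω] with k hk
  exact (not_le.1 hk).le

theorem exists_strictMono_forall_ae_tendsto {ι : Type*} [Countable ι] {f : ι → ℕ → Ω → E}
    {g : ι → Ω → E} (h : ∀ i, TendstoInMeasure P (f i) atTop (g i)) :
    ∃ ns : ℕ → ℕ, StrictMono ns ∧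
      ∀ᵐ ω ∂P, ∀ i, Tendsto (fun k ↦ f i (ns k) ω) atTop (𝓝 (g i ω)) := by
  obtain ⟨e, he⟩ := exists_injective_nat ι
  have hsmall : ∀ j : ℕ, ∀ᶠ n in atTop, ∀ i ∈ {i | e i ≤ j},
      P {ω | (2⁻¹ : ℝ≥0∞) ^ j ≤ edist (f i n ω) (g i ω)} ≤ 2⁻¹ ^ j := fun j ↦ by
    have hfin : {i | e i ≤ j}.Finite := (Set.finite_Iic j).preimage he.injOn
    have hpos : (0 : ℝ≥0∞) < 2⁻¹ ^ j := ENNReal.pow_pos (by simp) j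
    refine hfin.eventually_all.2 fun i _ ↦ ?_
    exact ((h i _ hpos).eventually_lt_const hpos).mono fun n hn ↦ hn.le
  obtain ⟨ns, hns, hP⟩ := extraction_forall_of_eventually hsmall
  refine ⟨ns, hns, ae_all_iff.2 fun i ↦ ?_⟩
  have htail : ∑' k, (2⁻¹ : ℝ≥0∞) ^ (k + e i) ≠ ∞ := by
    simp only [pow_add, ENNReal.tsum_mul_right, ENNReal.tsum_geometric]
    exact ENNReal.mul_ne_top (by simp) (by simp)
  filter_upwards [ae_tendsto_of_forall_measure_edist_ge_le htail
    fun k ↦ hP (k + e i) i (by simp)] with ω hω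
  exact (tendsto_add_atTop_iff_nat (e i)).1 hω

end CommonSubsequence

/-- The point `i T / 2 ^ n` of the dyadic partition of level `n` of `[0, T]`. It is defined for all
`i`, so that it also serves beyond `T`. -/
def dyadicPt (T : ℝ≥0) (n i : ℕ) : ℝ≥0 := i * T / 2 ^ n

theorem dyadicPt_mono (T : ℝ≥0) (n : ℕ) : Monotone (dyadicPt T n) := by
  intro i j hij
  unfold dyadicPt
  gcongr

theorem dyadicPt_zero (T : ℝ≥0) (n : ℕ) : dyadicPt T n 0 = 0 := by simp [dyadicPt]

theorem dyadicPt_two_pow (T : ℝ≥0) (n : ℕ) : dyadicPt T n (2 ^ n) = T := by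
  simp [dyadicPt, mul_div_cancel_left₀]

theorem dyadicPt_le {T : ℝ≥0} {n i : ℕ} (hi : i ≤ 2 ^ n) : dyadicPt T n i ≤ T :=
  (dyadicPt_mono T n hi).trans_eq (dyadicPt_two_pow T n)

theorem dyadicPt_add_mul_two_pow (T : ℝ≥0) (n m i : ℕ) :
    dyadicPt T (n + m) (i * 2 ^ m) = dyadicPt T n i := by
  unfold dyadicPt
  push_cast
  rw [pow_add]
  field_simp

theorem dyadicPt_succ_sub (T : ℝ≥0) (n i : ℕ) :
    dyadicPt T n (i + 1) - dyadicPt T n i = T / 2 ^ n := by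
  rw [tsub_eq_iff_eq_add_of_le (dyadicPt_mono T n i.le_succ)]
  unfold dyadicPt
  push_cast
  ring

theorem tendsto_div_two_pow (T : ℝ≥0) : Tendsto (fun n : ℕ ↦ T / 2 ^ n) atTop (𝓝 0) := by
  have h := (NNReal.tendsto_pow_atTop_nhds_zero_of_lt_one (r := 2⁻¹)
    (inv_lt_one_of_one_lt₀ one_lt_two)).const_mul T
  simpa [div_eq_mul_inv] using h

/-- The dyadic points of level `n` up to the index `L`, as a partition of `[0, L T / 2 ^ n]`. -/
def dyadicPartition (T : ℝ≥0) (n L : ℕ) {t : ℝ≥0} (h : dyadicPt T n L = t) :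
    TimePartition t where
  n := L
  pt := dyadicPt T n
  mono := dyadicPt_mono T n
  pt_zero := dyadicPt_zero T n
  pt_last := h

theorem tendsto_dyadicPartition (T : ℝ≥0) (n b : ℕ) :
    Tendsto (fun m ↦ dyadicPartition T (n + m) (b * 2 ^ m) (dyadicPt_add_mul_two_pow T n m b))
      atTop (meshToZero (dyadicPt T n b)) := by
  rw [meshToZero, tendsto_comap_iff]
  have hfine : Tendsto (fun m : ℕ ↦ T / 2 ^ (n + m)) atTop (𝓝 0) := by
    simpa only [add_comm n] using (tendsto_add_atTop_iff_nat n).2 (tendsto_div_two_pow T)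
  refine tendsto_of_tendsto_of_tendsto_of_le_of_le tendsto_const_nhds hfine
    (fun _ ↦ zero_le) fun m ↦ ?_
  simp only [Function.comp_apply, TimePartition.mesh, dyadicPartition]
  exact Finset.sup_le fun i _ ↦ (dyadicPt_succ_sub T (n + m) i).le

theorem eventually_forall_dist_dyadicPt_le {E : Type*} [PseudoMetricSpace E] {f : ℝ≥0 → E}
    (hf : Continuous f) (T : ℝ≥0) {ε : ℝ} (hε : 0 < ε) :
    ∀ᶠ n in atTop, ∀ i < 2 ^ n, ∀ s ∈ Set.Icc (dyadicPt T n i) (dyadicPt T n (i + 1)),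
      dist (f s) (f (dyadicPt T n i)) ≤ ε := by
  obtain ⟨δ, hδ, H⟩ := Metric.uniformContinuousOn_iff.1
    ((isCompact_Icc (a := 0) (b := T)).uniformContinuousOn_of_continuous hf.continuousOn) ε hε
  filter_upwards [(tendsto_div_two_pow T).eventually_lt_const (Real.toNNReal_pos.2 hδ)]
    with n hn i hi s hs
  have hsT : s ≤ T := hs.2.trans (dyadicPt_le hi)
  refine (H s ⟨zero_le, hsT⟩ _ ⟨zero_le, hs.1.trans hsT⟩ ?_).le
  rw [NNReal.dist_eq, ← NNReal.coe_sub hs.1, NNReal.abs_eq]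
  refine Real.lt_toNNReal_iff_coe_lt.1 (lt_of_le_of_lt ?_ hn)
  exact (tsub_le_tsub_right hs.2 _).trans_eq (dyadicPt_succ_sub T n i)

/-- The increment of `f` over the `i`-th interval of the dyadic partition of level `n`. -/
def dyadicIncr {E : Type*} [Sub E] (T : ℝ≥0) (n : ℕ) (f : ℝ≥0 → E) (i : ℕ) : E :=
  f (dyadicPt T n (i + 1)) - f (dyadicPt T n i)

section DyadicIncr

variable {E : Type*} [AddCommGroup E]

theorem sum_range_dyadicIncr (T : ℝ≥0) (n b : ℕ) (f : ℝ≥0 → E) :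
    ∑ i ∈ Finset.range b, dyadicIncr T n f i = f (dyadicPt T n b) - f 0 := by
  simp only [dyadicIncr, Finset.sum_range_sub fun i ↦ f (dyadicPt T n i), dyadicPt_zero]

theorem sum_range_dyadicIncr_add (T : ℝ≥0) (n m i : ℕ) (f : ℝ≥0 → E) :
    ∑ l ∈ Finset.range (2 ^ m), dyadicIncr T (n + m) f (i * 2 ^ m + l) = dyadicIncr T n f i := by
  have h := Finset.sum_range_sub (fun l ↦ f (dyadicPt T (n + m) (i * 2 ^ m + l))) (2 ^ m)
  simp only [dyadicIncr, add_assoc] at h ⊢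
  rw [h, add_zero, dyadicPt_add_mul_two_pow, ← dyadicPt_add_mul_two_pow T n m (i + 1),
    Nat.succ_mul]

theorem dyadicIncr_add (T : ℝ≥0) (n : ℕ) (f g : ℝ≥0 → E) (i : ℕ) :
    dyadicIncr T n (fun t ↦ f t + g t) i = dyadicIncr T n f i + dyadicIncr T n g i :=
  add_sub_add_comm ..

end DyadicIncr

theorem dyadicIncr_const_mul (T : ℝ≥0) (n : ℕ) (c : ℂ) (f : ℝ≥0 → ℂ) (i : ℕ) :
    dyadicIncr T n (fun t ↦ c * f t) i = c * dyadicIncr T n f i :=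
  (mul_sub ..).symm

theorem dyadicIncr_coe_nonneg (T : ℝ≥0) (n i : ℕ) :
    0 ≤ dyadicIncr T n (fun t ↦ (t : ℝ)) i :=
  sub_nonneg.2 (NNReal.coe_le_coe.2 (dyadicPt_mono T n i.le_succ))

theorem sum_range_mul_eq_sum_sum {M : Type*} [AddCommMonoid M] (f : ℕ → M) (n m : ℕ) :
    ∑ k ∈ Finset.range (n * m), f k =
      ∑ i ∈ Finset.range n, ∑ l ∈ Finset.range m, f (i * m + l) := by
  induction n with
  | zero => simp
  | succ n ih => rw [Nat.succ_mul, Finset.sum_range_add, ih, Finset.sum_range_succ]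

section DyadicSums

variable {Ω : Type*} {mΩ : MeasurableSpace Ω} {P : Measure Ω} {X w : ℝ≥0 → Ω → ℝ}

theorem IsItoIntegral.tendstoInMeasure_dyadic {I : ℝ≥0 → Ω → ℝ} (h : IsItoIntegral P X w I)
    (T : ℝ≥0) (n b : ℕ) :
    TendstoInMeasure P (fun m ω ↦ ∑ k ∈ Finset.range (b * 2 ^ m),
      X (dyadicPt T (n + m) k) ω * dyadicIncr T (n + m) (w · ω) k) atTop
      (I (dyadicPt T n b)) := by
  have hsum := (h (dyadicPt T n b)).comp (tendsto_dyadicPartition T n b)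
  simpa only [dyadicPartition, Function.comp_def, dyadicIncr] using hsum

theorem IsCovariation.tendstoInMeasure_dyadic {C : ℝ≥0 → Ω → ℝ} (h : IsCovariation P X w C)
    (T : ℝ≥0) (K b : ℕ) :
    TendstoInMeasure P (fun n ω ↦ ∑ i ∈ Finset.range (b * 2 ^ (n - K)),
      dyadicIncr T n (X · ω) i * dyadicIncr T n (w · ω) i) atTop (C (dyadicPt T K b)) := by
  have hrefine : TendstoInMeasure P (fun m ω ↦ ∑ i ∈ Finset.range (b * 2 ^ m),
      dyadicIncr T (K + m) (X · ω) i * dyadicIncr T (K + m) (w · ω) i) atTop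
      (C (dyadicPt T K b)) := by
    have hsum := (h.2 (dyadicPt T K b)).comp (tendsto_dyadicPartition T K b)
    simpa only [dyadicPartition, Function.comp_def, dyadicIncr] using hsum
  refine (hrefine.comp (tendsto_sub_atTop_nat K)).congr' ?_ (ae_eq_refl _)
  filter_upwards [eventually_ge_atTop K] with n hn
  simp only [Function.comp_apply, Nat.add_sub_cancel' hn]
  rfl

end DyadicSums

/-! ### Itô's isometry -/

section Isometry

variable {Ω : Type*} {mΩ : MeasurableSpace Ω} {P : Measure Ω} {H : Type*} [NormedAddCommGroup H]

theorem memLp_smul_of_norm_le [NormedSpace ℝ H] {V : Ω → ℝ} {Y : Ω → H} {K : ℝ}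
    {p : ℝ≥0∞} (hV : MemLp V p P) (hY : AEStronglyMeasurable Y P) (hYK : ∀ ω, ‖Y ω‖ ≤ K) :
    MemLp (fun ω ↦ V ω • Y ω) p P := by
  refine hV.of_le_mul (c := K) (hV.aestronglyMeasurable.smul hY) (Eventually.of_forall fun ω ↦ ?_)
  rw [norm_smul, mul_comm]
  exact mul_le_mul_of_nonneg_right (hYK ω) (norm_nonneg _)

theorem stronglyMeasurable_sum_range_smul [NormedSpace ℝ H] {G : ℕ → MeasurableSpace Ω}
    (hG : Monotone G) {V : ℕ → Ω → ℝ} {Y : ℕ → Ω → H} (hV : ∀ i, Measurable[G (i + 1)] (V i))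
    (hY : ∀ i, StronglyMeasurable[G i] (Y i)) (n : ℕ) :
    StronglyMeasurable[G n] fun ω ↦ ∑ i ∈ Finset.range n, V i ω • Y i ω := by
  refine Finset.stronglyMeasurable_fun_sum _ fun i hi ↦ ?_
  have hin : i < n := Finset.mem_range.1 hi
  exact ((hV i).stronglyMeasurable.mono (hG hin)).smul ((hY i).mono (hG hin.le))

variable [InnerProductSpace ℝ H]

theorem integral_norm_add_smul_sq_le [IsProbabilityMeasure P] {m : MeasurableSpace Ω}
    (hm : m ≤ mΩ) {M Y : Ω → H} {V : Ω → ℝ} {K : ℝ} (hM : StronglyMeasurable[m] M)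
    (hM2 : MemLp M 2 P) (hY : StronglyMeasurable[m] Y) (hYK : ∀ ω, ‖Y ω‖ ≤ K)
    (hind : Indep (MeasurableSpace.comap V inferInstance) m P) (hV : MemLp V 2 P)
    (hV0 : ∫ ω, V ω ∂P = 0) :
    ∫ ω, ‖M ω + V ω • Y ω‖ ^ 2 ∂P ≤ ∫ ω, ‖M ω‖ ^ 2 ∂P + K ^ 2 * ∫ ω, V ω ^ 2 ∂P := by
  have hVY : MemLp (fun ω ↦ V ω • Y ω) 2 P :=
    memLp_smul_of_norm_le hV (hY.mono hm).aestronglyMeasurable hYK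
  have hMY : StronglyMeasurable[m] fun ω ↦ inner ℝ (M ω) (Y ω) := hM.inner hY
  have hcross : ∫ ω, inner ℝ (M ω) (V ω • Y ω) ∂P = 0 := by
    have hindep : IndepFun (fun ω ↦ inner ℝ (M ω) (Y ω)) V P :=
      (IndepFun_iff_Indep _ _ _).2 (indep_of_indep_of_le_left hind.symm hMY.measurable.comap_le)
    simp only [real_inner_smul_right, mul_comm (V _)]
    rw [hindep.integral_fun_mul_eq_mul_integral (hMY.mono hm).aestronglyMeasurable
      hV.aestronglyMeasurable, hV0, mul_zero]
  have hMsq : Integrable (fun ω ↦ ‖M ω‖ ^ 2) P := hM2.integrable_norm_pow'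
  have hVYsq : Integrable (fun ω ↦ ‖V ω • Y ω‖ ^ 2) P := hVY.integrable_norm_pow'
  have hsq : ∫ ω, ‖V ω • Y ω‖ ^ 2 ∂P ≤ K ^ 2 * ∫ ω, V ω ^ 2 ∂P := by
    rw [← integral_const_mul]
    refine integral_mono hVYsq (hV.integrable_sq.const_mul _) fun ω ↦ ?_
    simp only [norm_smul, mul_pow, Real.norm_eq_abs, sq_abs]
    rw [mul_comm]
    gcongr
    exact hYK ω
  have hinner : Integrable (fun ω ↦ 2 * inner ℝ (M ω) (V ω • Y ω)) P := by
    have hsum : Integrable (fun ω ↦ ‖M ω + V ω • Y ω‖ ^ 2) P := (hM2.add hVY).integrable_norm_pow'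
    refine ((hsum.sub hMsq).sub hVYsq).congr (Eventually.of_forall fun ω ↦ ?_)
    simp only [Pi.sub_apply, norm_add_sq_real]
    ring
  calc ∫ ω, ‖M ω + V ω • Y ω‖ ^ 2 ∂P
      = ∫ ω, ‖M ω‖ ^ 2 ∂P + 2 * ∫ ω, inner ℝ (M ω) (V ω • Y ω) ∂P +
          ∫ ω, ‖V ω • Y ω‖ ^ 2 ∂P := by
        simp only [norm_add_sq_real]
        have hadd := hMsq.add hinner
        simp only [Pi.add_def] at hadd
        rw [integral_add hadd hVYsq, integral_add hMsq hinner, integral_const_mul]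
    _ ≤ ∫ ω, ‖M ω‖ ^ 2 ∂P + K ^ 2 * ∫ ω, V ω ^ 2 ∂P := by
        rw [hcross, mul_zero, add_zero]
        gcongr

theorem integral_norm_sum_smul_sq_le [IsProbabilityMeasure P] {G : ℕ → MeasurableSpace Ω}
    (hG : Monotone G) (hGm : ∀ i, G i ≤ mΩ) {V : ℕ → Ω → ℝ} {Y : ℕ → Ω → H} {K : ℝ}
    (hVm : ∀ i, Measurable[G (i + 1)] (V i)) (hY : ∀ i, StronglyMeasurable[G i] (Y i))
    (hYK : ∀ i ω, ‖Y i ω‖ ≤ K)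
    (hind : ∀ i, Indep (MeasurableSpace.comap (V i) inferInstance) (G i) P)
    (hV : ∀ i, MemLp (V i) 2 P) (hV0 : ∀ i, ∫ ω, V i ω ∂P = 0) (n : ℕ) :
    ∫ ω, ‖∑ i ∈ Finset.range n, V i ω • Y i ω‖ ^ 2 ∂P ≤
      K ^ 2 * ∑ i ∈ Finset.range n, ∫ ω, V i ω ^ 2 ∂P := by
  induction n with
  | zero => simp
  | succ n ih =>
    have hsum : MemLp (fun ω ↦ ∑ i ∈ Finset.range n, V i ω • Y i ω) 2 P :=
      memLp_finsetSum _ fun i _ ↦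
        memLp_smul_of_norm_le (hV i) ((hY i).mono (hGm i)).aestronglyMeasurable (hYK i)
    simp only [Finset.sum_range_succ, mul_add]
    exact (integral_norm_add_smul_sq_le (hGm n) (stronglyMeasurable_sum_range_smul hG hVm hY n)
      hsum (hY n) (hYK n) (hind n) (hV n) (hV0 n)).trans (by gcongr)

end Isometry

section Brownian

variable {Ω : Type*} {mΩ : MeasurableSpace Ω} {P : Measure Ω} {ℱ : Filtration ℝ≥0 mΩ}
  {β : ℕ → ℝ≥0 → Ω → ℝ}

/-- The increment over `[s, t]` of the partial sum of order `r` of the noise series `∑ c_k β_k`. -/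
def partialIncr (β : ℕ → ℝ≥0 → Ω → ℝ) (c : ℕ → ℝ) (r : ℕ) (s t : ℝ≥0) (ω : Ω) : ℝ :=
  ∑ k ∈ Finset.range r, (β k t ω - β k s ω) * c k

theorem IsBrownianSequence.memLp_sub (h : IsBrownianSequence P ℱ β) (k : ℕ) (s t : ℝ≥0) :
    MemLp (β k t - β k s) 2 P := by
  have hlaw := (h.brownian k).hasLaw_sub t s
  have hid := memLp_id_gaussianReal' (μ := 0) (v := nndist t.1 s.1) 2 (by simp)
  rw [← hlaw.map_eq] at hid
  exact (memLp_map_measure_iff aestronglyMeasurable_id hlaw.aemeasurable).1 hid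

theorem IsBrownianSequence.integral_sub (h : IsBrownianSequence P ℱ β) (k : ℕ) (s t : ℝ≥0) :
    ∫ ω, (β k t ω - β k s ω) ∂P = 0 := by
  rw [← integral_id_gaussianReal (μ := 0) (v := nndist t.1 s.1)]
  exact ((h.brownian k).hasLaw_sub t s).integral_eq

theorem IsBrownianSequence.variance_sub (h : IsBrownianSequence P ℱ β) (k : ℕ) {s t : ℝ≥0}
    (hst : s ≤ t) : Var[β k t - β k s; P] = (t : ℝ) - s := by
  rw [((h.brownian k).hasLaw_sub t s).variance_eq, variance_id_gaussianReal, coe_nndist,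
    Real.dist_eq]
  exact abs_of_nonneg (sub_nonneg.2 (NNReal.coe_le_coe.2 hst))

theorem IsBrownianSequence.memLp_partialIncr (h : IsBrownianSequence P ℱ β) (c : ℕ → ℝ) (r : ℕ)
    (s t : ℝ≥0) : MemLp (partialIncr β c r s t) 2 P :=
  memLp_finsetSum _ fun k _ ↦ (h.memLp_sub k s t).mul_const (c k)

theorem IsBrownianSequence.measurable_partialIncr (h : IsBrownianSequence P ℱ β) (c : ℕ → ℝ)
    (r : ℕ) {s t : ℝ≥0} (hst : s ≤ t) : Measurable[ℱ t] (partialIncr β c r s t) :=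
  Finset.measurable_fun_sum _ fun k _ ↦
    ((h.adapted k t).sub ((h.adapted k s).mono (ℱ.mono hst) le_rfl)).mul_const (c k)

theorem IsBrownianSequence.indep_partialIncr (h : IsBrownianSequence P ℱ β) (c : ℕ → ℝ)
    (r : ℕ) {s t : ℝ≥0} (hst : s ≤ t) :
    Indep (MeasurableSpace.comap (partialIncr β c r s t) inferInstance) (ℱ s) P := by
  refine indep_of_indep_of_le_left (h.indep_past s t hst) ?_
  have hmeas : Measurable fun x : ℕ → ℝ ↦ ∑ k ∈ Finset.range r, x k * c k := by fun_prop
  have hcomp : partialIncr β c r s t =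
      (fun x : ℕ → ℝ ↦ ∑ k ∈ Finset.range r, x k * c k) ∘ fun ω k ↦ β k t ω - β k s ω := rfl
  rw [hcomp, ← MeasurableSpace.comap_comp]
  exact MeasurableSpace.comap_mono hmeas.comap_le

variable [IsProbabilityMeasure P]

theorem IsBrownianSequence.integral_partialIncr (h : IsBrownianSequence P ℱ β) (c : ℕ → ℝ)
    (r : ℕ) (s t : ℝ≥0) : ∫ ω, partialIncr β c r s t ω ∂P = 0 := by
  have hint : ∀ k, Integrable (fun ω ↦ (β k t ω - β k s ω) * c k) P := fun k ↦
    ((h.memLp_sub k s t).integrable one_le_two).mul_const (c k)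
  simp only [partialIncr, integral_finsetSum _ fun k _ ↦ hint k, integral_mul_const,
    h.integral_sub, zero_mul, Finset.sum_const_zero]

theorem IsBrownianSequence.integral_sq_partialIncr (h : IsBrownianSequence P ℱ β) (c : ℕ → ℝ)
    (r : ℕ) {s t : ℝ≥0} (hst : s ≤ t) :
    ∫ ω, partialIncr β c r s t ω ^ 2 ∂P = (∑ k ∈ Finset.range r, c k ^ 2) * ((t : ℝ) - s) := by
  have hsum : partialIncr β c r s t =
      ∑ k ∈ Finset.range r, fun ω ↦ c k * (β k t - β k s) ω := by
    ext ω
    simp [partialIncr, mul_comm]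
  rw [← variance_of_integral_eq_zero (h.memLp_partialIncr c r s t).aemeasurable
    (h.integral_partialIncr c r s t), hsum,
    IndepFun.variance_sum (fun k _ ↦ (h.memLp_sub k s t).const_mul (c k)), Finset.sum_mul]
  · simp only [variance_const_mul, h.variance_sub _ hst]
  · intro k _ l _ hkl
    exact (h.indep.indepFun hkl).comp (φ := fun f : ℝ≥0 → ℝ ↦ c k * (f t - f s))
      (ψ := fun f : ℝ≥0 → ℝ ↦ c l * (f t - f s)) (by fun_prop) (by fun_prop)

end Brownian

theorem lintegral_le_of_tendsto_ae {Ω : Type*} {mΩ : MeasurableSpace Ω} {μ : Measure Ω}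
    {g : ℕ → Ω → ℝ≥0∞} {g' : Ω → ℝ≥0∞} {B : ℝ≥0∞} (hg : ∀ k, Measurable (g k))
    (hlim : ∀ᵐ ω ∂μ, Tendsto (fun k ↦ g k ω) atTop (𝓝 (g' ω))) (hB : ∀ k, ∫⁻ ω, g k ω ∂μ ≤ B) :
    ∫⁻ ω, g' ω ∂μ ≤ B :=
  calc ∫⁻ ω, g' ω ∂μ = ∫⁻ ω, liminf (fun k ↦ g k ω) atTop ∂μ :=
        lintegral_congr_ae (hlim.mono fun ω h ↦ h.liminf_eq.symm)
    _ ≤ liminf (fun k ↦ ∫⁻ ω, g k ω ∂μ) atTop := lintegral_liminf_le hg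
    _ ≤ B := liminf_le_of_le (by isBoundedDefault) fun _ hc ↦
        let ⟨k, hk⟩ := hc.exists; hk.trans (hB k)

section WienerField

variable {Ω : Type*} {mΩ : MeasurableSpace Ω} {P : Measure Ω} [IsProbabilityMeasure P]
  {ℱ : Filtration ℝ≥0 mΩ} {a b : ℝ} {β : ℕ → ℝ≥0 → Ω → ℝ} {φ : ℕ → ℝ → ℝ}
  {W : ℝ≥0 → ℝ → Ω → ℝ} {H : Type*} [NormedAddCommGroup H] [InnerProductSpace ℝ H]

theorem IsBrownianSequence.integral_norm_sum_partialIncr_smul_sq_le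
    (h : IsBrownianSequence P ℱ β) (c : ℕ → ℝ) (r : ℕ) {τ : ℕ → ℝ≥0} (hτ : Monotone τ)
    {Y : ℕ → Ω → H} {K : ℝ} (hY : ∀ i, StronglyMeasurable[ℱ (τ i)] (Y i))
    (hYK : ∀ i ω, ‖Y i ω‖ ≤ K) (n : ℕ) :
    ∫ ω, ‖∑ i ∈ Finset.range n, partialIncr β c r (τ i) (τ (i + 1)) ω • Y i ω‖ ^ 2 ∂P ≤
      K ^ 2 * ((∑ k ∈ Finset.range r, c k ^ 2) * ((τ n : ℝ) - τ 0)) := by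
  refine (integral_norm_sum_smul_sq_le (G := fun i ↦ ℱ (τ i)) (fun i j hij ↦ ℱ.mono (hτ hij))
    (fun i ↦ ℱ.le _) (fun i ↦ h.measurable_partialIncr c r (hτ i.le_succ)) hY hYK
    (fun i ↦ h.indep_partialIncr c r (hτ i.le_succ)) (fun i ↦ h.memLp_partialIncr c r _ _)
    (fun i ↦ h.integral_partialIncr c r _ _) n).trans_eq ?_
  simp only [h.integral_sq_partialIncr c r (hτ (Nat.le_succ _)), ← Finset.mul_sum]
  rw [Finset.sum_range_sub fun i ↦ (τ i : ℝ)]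

theorem IsWienerField.lintegral_norm_sum_smul_sq_le (hW : IsWienerField P ℱ a b β φ W) {x : ℝ}
    (hx : x ∈ Set.Icc a b) {τ : ℕ → ℝ≥0} (hτ : Monotone τ) {Y : ℕ → Ω → H} {K : ℝ}
    (hY : ∀ i, StronglyMeasurable[ℱ (τ i)] (Y i)) (hYK : ∀ i ω, ‖Y i ω‖ ≤ K) (n : ℕ) :
    ∫⁻ ω, ENNReal.ofReal
      (‖∑ i ∈ Finset.range n, (W (τ (i + 1)) x ω - W (τ i) x ω) • Y i ω‖ ^ 2) ∂P ≤
      ENNReal.ofReal (K ^ 2 * ((∑' k, φ k x ^ 2) * ((τ n : ℝ) - τ 0))) := by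
  obtain ⟨rs, -, hrs⟩ := exists_strictMono_forall_ae_tendsto fun i ↦ hW.series (τ i) x hx
  set S : ℕ → Ω → H := fun r ω ↦ ∑ i ∈ Finset.range n,
    partialIncr β (φ · x) r (τ i) (τ (i + 1)) ω • Y i ω
  have hSm : ∀ r, StronglyMeasurable (S r) := fun r ↦ (stronglyMeasurable_sum_range_smul
    (G := fun i ↦ ℱ (τ i)) (fun i j hij ↦ ℱ.mono (hτ hij))
    (fun i ↦ hW.brownian.measurable_partialIncr _ r (hτ i.le_succ)) hY n).mono (ℱ.le _)
  refine lintegral_le_of_tendsto_ae (g := fun k ω ↦ ENNReal.ofReal (‖S (rs k) ω‖ ^ 2))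
    (fun k ↦ ((hSm _).norm.measurable.pow_const 2).ennreal_ofReal) ?_ fun k ↦ ?_
  · filter_upwards [hrs] with ω hω
    refine ENNReal.tendsto_ofReal ((tendsto_finsetSum _ fun i _ ↦ ?_).norm.pow 2)
    have hincr : ∀ k, partialIncr β (φ · x) (rs k) (τ i) (τ (i + 1)) ω =
        ∑ j ∈ Finset.range (rs k), β j (τ (i + 1)) ω * φ j x -
          ∑ j ∈ Finset.range (rs k), β j (τ i) ω * φ j x := fun k ↦ by
      simp only [partialIncr, sub_mul, Finset.sum_sub_distrib]
    simp only [hincr]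
    exact ((hω (i + 1)).sub (hω i)).smul_const _
  · have hLp : MemLp (S (rs k)) 2 P := memLp_finsetSum (Finset.range n) fun i _ ↦
      memLp_smul_of_norm_le (hW.brownian.memLp_partialIncr (φ · x) (rs k) (τ i) (τ (i + 1)))
        ((hY i).mono (ℱ.le _)).aestronglyMeasurable (hYK i)
    rw [← ofReal_integral_eq_lintegral_ofReal hLp.integrable_norm_pow'
      (Eventually.of_forall fun _ ↦ sq_nonneg _)]
    refine ENNReal.ofReal_le_ofReal ((hW.brownian.integral_norm_sum_partialIncr_smul_sq_le
      (φ · x) (rs k) hτ hY hYK n).trans ?_)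
    have hτn : (0 : ℝ) ≤ τ n - τ 0 := sub_nonneg.2 (NNReal.coe_le_coe.2 (hτ n.zero_le))
    gcongr
    exact (hW.summable x hx).sum_le_tsum _ fun k _ ↦ sq_nonneg _

end WienerField

/-! ### The error of left-point sums -/

theorem tendstoInMeasure_of_forall_exists_setLIntegral_edist_le {Ω E : Type*}
    {mΩ : MeasurableSpace Ω} {P : Measure Ω} [IsFiniteMeasure P] [PseudoEMetricSpace E]
    {f : ℕ → Ω → E} {g : Ω → E} (hfg : ∀ n, AEMeasurable (fun ω ↦ edist (f n ω) (g ω)) P)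
    (h : ∀ δ : ℝ≥0∞, 0 < δ → ∃ A : ℕ → Set Ω, (∀ n, MeasurableSet (A n)) ∧
      (∀ᵐ ω ∂P, ∀ᶠ n in atTop, ω ∈ A n) ∧ ∀ n, ∫⁻ ω in A n, edist (f n ω) (g ω) ∂P ≤ δ) :
    TendstoInMeasure P f atTop g := by
  intro ε hε
  rw [ENNReal.tendsto_nhds_zero]
  intro η hη
  have hε₁ : min ε 1 ≠ 0 := (lt_min hε one_pos).ne'
  have hε₂ : min ε 1 ≠ ∞ := ((min_le_right _ _).trans_lt ENNReal.one_lt_top).ne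
  have hη₂ : 0 < η / 2 := ENNReal.half_pos hη.ne'
  obtain ⟨A, hAm, hAe, hA⟩ := h (min ε 1 * (η / 2)) (ENNReal.mul_pos hε₁ hη₂.ne')
  have hAc : Tendsto (fun n ↦ P (A n)ᶜ) atTop (𝓝 (P ∅)) :=
    tendsto_measure_of_ae_tendsto_indicator_of_isFiniteMeasure atTop MeasurableSet.empty
      (fun n ↦ (hAm n).compl) (hAe.mono fun ω hω ↦ hω.mono fun n hn ↦ by simp [hn])
  rw [measure_empty] at hAc
  filter_upwards [hAc.eventually_lt_const hη₂] with n hn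
  have hmarkov : P ({ω | min ε 1 ≤ edist (f n ω) (g ω)} ∩ A n) ≤ η / 2 := by
    rw [← Measure.restrict_apply' (hAm n)]
    refine (meas_ge_le_lintegral_div (hfg n).restrict hε₁ hε₂).trans ?_
    exact ENNReal.div_le_of_le_mul ((hA n).trans_eq (mul_comm _ _))
  have hsub : {ω | ε ≤ edist (f n ω) (g ω)} ⊆
      (A n)ᶜ ∪ ({ω | min ε 1 ≤ edist (f n ω) (g ω)} ∩ A n) := fun ω hω ↦
    (em (ω ∈ A n)).elim (fun hmem ↦ .inr ⟨le_trans (min_le_left ε 1) hω, hmem⟩) .inl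
  calc P {ω | ε ≤ edist (f n ω) (g ω)}
      ≤ P (A n)ᶜ + P ({ω | min ε 1 ≤ edist (f n ω) (g ω)} ∩ A n) :=
        (measure_mono hsub).trans (measure_union_le _ _)
    _ ≤ η / 2 + η / 2 := add_le_add hn.le hmarkov
    _ = η := ENNReal.add_halves η

/-- Truncation of a real number to `[-δ, δ]`. -/
def clip (δ x : ℝ) : ℝ := max (-δ) (min δ x)

theorem abs_clip_le {δ : ℝ} (hδ : 0 ≤ δ) (x : ℝ) : |clip δ x| ≤ δ :=
  abs_le.2 ⟨le_max_left _ _, max_le (neg_le_self hδ) (min_le_left _ _)⟩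

theorem clip_eq_self {δ x : ℝ} (h : |x| ≤ δ) : clip δ x = x := by
  rw [clip, min_eq_right (abs_le.1 h).2, max_eq_right (abs_le.1 h).1]

theorem measurable_clip (δ : ℝ) : Measurable (clip δ) := by
  unfold clip
  fun_prop

/-- The error over the `i`-th dyadic interval of level `n` when the integral path `I` of `x`
against `w` is replaced by the left-point product. -/
def leftPointError {E : Type*} [AddCommGroup E] [Module ℝ E] (T : ℝ≥0) (n : ℕ) (x : ℝ≥0 → E)
    (w : ℝ≥0 → ℝ) (I : ℝ≥0 → E) (i : ℕ) : E :=
  dyadicIncr T n I i - dyadicIncr T n w i • x (dyadicPt T n i)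

/-- The analogue of `leftPointError` where the integral is itself replaced by the left-point sums
of level `n + m`. -/
def leftPointSumError (T : ℝ≥0) (n m : ℕ) (x w : ℝ≥0 → ℝ) (i : ℕ) : ℝ :=
  ∑ l ∈ Finset.range (2 ^ m), dyadicIncr T (n + m) w (i * 2 ^ m + l) *
    (x (dyadicPt T (n + m) (i * 2 ^ m + l)) - x (dyadicPt T n i))

theorem tendsto_leftPointSumError {x w I : ℝ≥0 → ℝ} {T : ℝ≥0} {n : ℕ} {ms : ℕ → ℕ}
    (h : ∀ b, Tendsto (fun k ↦ ∑ l ∈ Finset.range (b * 2 ^ ms k),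
      x (dyadicPt T (n + ms k) l) * dyadicIncr T (n + ms k) w l) atTop (𝓝 (I (dyadicPt T n b))))
    (i : ℕ) :
    Tendsto (fun k ↦ leftPointSumError T n (ms k) x w i) atTop
      (𝓝 (leftPointError T n x w I i)) := by
  refine (((h (i + 1)).sub (h i)).sub_const (dyadicIncr T n w i • x (dyadicPt T n i))).congr
    fun k ↦ ?_
  rw [Nat.succ_mul, Finset.sum_range_add, add_sub_cancel_left,
    ← sum_range_dyadicIncr_add T n (ms k), smul_eq_mul, Finset.sum_mul, ← Finset.sum_sub_distrib]
  exact Finset.sum_congr rfl fun l _ ↦ by ring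

theorem sum_leftPointSumError_smul {H : Type*} [AddCommGroup H] [Module ℝ H] (T : ℝ≥0) (n m : ℕ)
    (x w : ℝ≥0 → ℝ) (c : ℕ → H) :
    ∑ i ∈ Finset.range (2 ^ n), leftPointSumError T n m x w i • c i =
      ∑ l ∈ Finset.range (2 ^ n * 2 ^ m), dyadicIncr T (n + m) w l •
        ((x (dyadicPt T (n + m) l) - x (dyadicPt T n (l / 2 ^ m))) • c (l / 2 ^ m)) := by
  rw [sum_range_mul_eq_sum_sum]
  refine Finset.sum_congr rfl fun i _ ↦ ?_
  rw [leftPointSumError, Finset.sum_smul]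
  refine Finset.sum_congr rfl fun l hl ↦ ?_
  have hdiv : (i * 2 ^ m + l) / 2 ^ m = i := by
    rw [add_comm, Nat.add_mul_div_right _ _ (by positivity),
      Nat.div_eq_of_lt (Finset.mem_range.1 hl), zero_add]
  rw [hdiv, smul_smul]

theorem dyadicPt_div_le (T : ℝ≥0) (n m l : ℕ) :
    dyadicPt T n (l / 2 ^ m) ≤ dyadicPt T (n + m) l := by
  rw [← dyadicPt_add_mul_two_pow T n m]
  exact dyadicPt_mono _ _ (Nat.div_mul_le_self _ _)

theorem le_dyadicPt_div_succ (T : ℝ≥0) (n m l : ℕ) :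
    dyadicPt T (n + m) l ≤ dyadicPt T n (l / 2 ^ m + 1) := by
  rw [← dyadicPt_add_mul_two_pow T n m]
  exact dyadicPt_mono _ _ (Nat.lt_mul_of_div_lt (Nat.lt_succ_self _) (by positivity)).le

section SmallOsc

variable {Ω : Type*} {mΩ : MeasurableSpace Ω}

/-- The event that `X` moves by at most `δ` within the intervals of the dyadic partition of level
`n` of `[0, T]`, tested at dyadic times. -/
def smallOsc (T : ℝ≥0) (X : ℝ≥0 → Ω → ℝ) (δ : ℝ) (n : ℕ) : Set Ω :=
  {ω | ∀ m, ∀ l < 2 ^ n * 2 ^ m,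
    |X (dyadicPt T (n + m) l) ω - X (dyadicPt T n (l / 2 ^ m)) ω| ≤ δ}

theorem measurableSet_smallOsc (T : ℝ≥0) {X : ℝ≥0 → Ω → ℝ} (hX : ∀ t, Measurable (X t)) (δ : ℝ)
    (n : ℕ) : MeasurableSet (smallOsc T X δ n) := by
  simp only [smallOsc, Set.ofPred_forall]
  exact MeasurableSet.iInter fun m ↦ MeasurableSet.iInter fun l ↦ MeasurableSet.iInter fun _ ↦
    measurableSet_le ((hX _).sub (hX _)).abs measurable_const

theorem eventually_mem_smallOsc (T : ℝ≥0) {X : ℝ≥0 → Ω → ℝ} {ω : Ω}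
    (hX : Continuous fun t ↦ X t ω) {δ : ℝ} (hδ : 0 < δ) :
    ∀ᶠ n in atTop, ω ∈ smallOsc T X δ n := by
  filter_upwards [eventually_forall_dist_dyadicPt_le hX T hδ] with n hn m l hl
  exact hn _ (Nat.div_lt_of_lt_mul (by rwa [mul_comm] at hl)) _
    ⟨dyadicPt_div_le T n m l, le_dyadicPt_div_succ T n m l⟩

end SmallOsc

section LeftPointError

variable {Ω : Type*} {mΩ : MeasurableSpace Ω} {P : Measure Ω} {X w I : ℝ≥0 → Ω → ℝ}

theorem IsItoIntegral.exists_ae_tendsto_leftPointSumError (hI : IsItoIntegral P X w I) (T : ℝ≥0)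
    (n : ℕ) :
    ∃ ms : ℕ → ℕ, ∀ᵐ ω ∂P, ∀ i, Tendsto (fun k ↦ leftPointSumError T n (ms k) (X · ω) (w · ω) i)
      atTop (𝓝 (leftPointError T n (X · ω) (w · ω) (I · ω) i)) := by
  obtain ⟨ms, -, hms⟩ :=
    exists_strictMono_forall_ae_tendsto fun b ↦ hI.tendstoInMeasure_dyadic T n b
  exact ⟨ms, hms.mono fun ω hω ↦ tendsto_leftPointSumError (I := (I · ω)) hω⟩

theorem measurable_leftPointSumError (hX : ∀ t, Measurable (X t)) (hw : ∀ t, Measurable (w t))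
    (T : ℝ≥0) (n m i : ℕ) : Measurable fun ω ↦ leftPointSumError T n m (X · ω) (w · ω) i :=
  Finset.measurable_fun_sum _ fun _ _ ↦ ((hw _).sub (hw _)).mul ((hX _).sub (hX _))

theorem IsItoIntegral.aemeasurable_leftPointError (hI : IsItoIntegral P X w I)
    (hX : ∀ t, Measurable (X t)) (hw : ∀ t, Measurable (w t)) (T : ℝ≥0) (n i : ℕ) :
    AEMeasurable (fun ω ↦ leftPointError T n (X · ω) (w · ω) (I · ω) i) P := by
  obtain ⟨ms, hms⟩ := hI.exists_ae_tendsto_leftPointSumError T n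
  exact aemeasurable_of_tendsto_metrizable_ae atTop
    (fun k ↦ (measurable_leftPointSumError hX hw T n (ms k) i).aemeasurable)
    (hms.mono fun ω hω ↦ hω i)

variable {ℱ : Filtration ℝ≥0 mΩ} {a b : ℝ} {β : ℕ → ℝ≥0 → Ω → ℝ} {φ : ℕ → ℝ → ℝ}
  {W : ℝ≥0 → ℝ → Ω → ℝ} {x : ℝ} {H : Type*} [NormedAddCommGroup H] [InnerProductSpace ℝ H]
  [IsProbabilityMeasure P]

theorem IsWienerField.setLIntegral_norm_sum_leftPointSumError_smul_sq_le
    (hW : IsWienerField P ℱ a b β φ W) (hx : x ∈ Set.Icc a b) (hX : Adapted ℱ X) {T : ℝ≥0}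
    {n : ℕ} {c : ℕ → Ω → H} (hc : ∀ i, StronglyMeasurable[ℱ (dyadicPt T n i)] (c i))
    (hc1 : ∀ i ω, ‖c i ω‖ ≤ 1) {δ : ℝ} (hδ : 0 ≤ δ) (m : ℕ) :
    ∫⁻ ω in smallOsc T X δ n, ENNReal.ofReal (‖∑ i ∈ Finset.range (2 ^ n),
      leftPointSumError T n m (X · ω) (W · x ω) i • c i ω‖ ^ 2) ∂P ≤
      ENNReal.ofReal (δ ^ 2 * ((∑' k, φ k x ^ 2) * T)) := by
  set Y : ℕ → Ω → H := fun l ω ↦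
    clip δ (X (dyadicPt T (n + m) l) ω - X (dyadicPt T n (l / 2 ^ m)) ω) • c (l / 2 ^ m) ω
    with hYdef
  have hY : ∀ l, StronglyMeasurable[ℱ (dyadicPt T (n + m) l)] (Y l) := fun l ↦ by
    have hle := ℱ.mono (dyadicPt_div_le T n m l)
    refine StronglyMeasurable.smul ?_ ((hc _).mono hle)
    exact ((measurable_clip δ).comp ((hX _).sub ((hX _).mono hle le_rfl))).stronglyMeasurable
  have hYδ : ∀ l ω, ‖Y l ω‖ ≤ δ := fun l ω ↦ by
    rw [hYdef, norm_smul, Real.norm_eq_abs]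
    exact (mul_le_mul (abs_clip_le hδ _) (hc1 _ _) (norm_nonneg _) hδ).trans_eq (mul_one δ)
  have heq : ∀ ω ∈ smallOsc T X δ n, ∑ i ∈ Finset.range (2 ^ n),
      leftPointSumError T n m (X · ω) (W · x ω) i • c i ω =
        ∑ l ∈ Finset.range (2 ^ n * 2 ^ m), dyadicIncr T (n + m) (W · x ω) l • Y l ω :=
    fun ω hω ↦ by
      rw [sum_leftPointSumError_smul T n m _ _ (c · ω)]
      refine Finset.sum_congr rfl fun l hl ↦ ?_
      simp only [hYdef, clip_eq_self (hω m l (Finset.mem_range.1 hl))]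
  calc _ ≤ ∫⁻ ω in smallOsc T X δ n, ENNReal.ofReal (‖∑ l ∈ Finset.range (2 ^ n * 2 ^ m),
          dyadicIncr T (n + m) (W · x ω) l • Y l ω‖ ^ 2) ∂P :=
        setLIntegral_mono' (measurableSet_smallOsc T (fun t ↦ (hX t).mono (ℱ.le t) le_rfl) δ n)
          fun ω hω ↦ by rw [heq ω hω]
    _ ≤ _ := setLIntegral_le_lintegral _ _
    _ ≤ _ := hW.lintegral_norm_sum_smul_sq_le hx (dyadicPt_mono T (n + m)) hY hYδ _
    _ = _ := by rw [← pow_add, dyadicPt_two_pow, dyadicPt_zero, NNReal.coe_zero, sub_zero]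

theorem IsItoIntegral.setLIntegral_norm_sum_leftPointError_smul_sq_le
    (hI : IsItoIntegral P X (W · x) I) (hW : IsWienerField P ℱ a b β φ W) (hx : x ∈ Set.Icc a b)
    (hX : Adapted ℱ X) {T : ℝ≥0} {n : ℕ} {c : ℕ → Ω → H}
    (hc : ∀ i, StronglyMeasurable[ℱ (dyadicPt T n i)] (c i)) (hc1 : ∀ i ω, ‖c i ω‖ ≤ 1) {δ : ℝ}
    (hδ : 0 ≤ δ) :
    ∫⁻ ω in smallOsc T X δ n, ENNReal.ofReal (‖∑ i ∈ Finset.range (2 ^ n),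
      leftPointError T n (X · ω) (W · x ω) (I · ω) i • c i ω‖ ^ 2) ∂P ≤
      ENNReal.ofReal (δ ^ 2 * ((∑' k, φ k x ^ 2) * T)) := by
  obtain ⟨ms, hms⟩ := hI.exists_ae_tendsto_leftPointSumError T n
  refine lintegral_le_of_tendsto_ae (fun k ↦ ?_)
    (ae_restrict_of_ae (hms.mono fun ω hω ↦ ENNReal.tendsto_ofReal
      ((tendsto_finsetSum _ fun i _ ↦ (hω i).smul_const (c i ω)).norm.pow 2)))
    fun k ↦ hW.setLIntegral_norm_sum_leftPointSumError_smul_sq_le hx hX hc hc1 hδ (ms k)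
  have hsum : StronglyMeasurable fun ω ↦ ∑ i ∈ Finset.range (2 ^ n),
      leftPointSumError T n (ms k) (X · ω) (W · x ω) i • c i ω :=
    Finset.stronglyMeasurable_fun_sum _ fun i _ ↦
      (measurable_leftPointSumError (fun t ↦ (hX t).mono (ℱ.le t) le_rfl)
        (fun t ↦ (hW.adapted x hx t).mono (ℱ.le t) le_rfl) T n _ i).stronglyMeasurable.smul
        ((hc i).mono (ℱ.le _))
  exact (hsum.norm.measurable.pow_const 2).ennreal_ofReal

theorem IsItoIntegral.tendstoInMeasure_norm_sum_leftPointError_smul_sq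
    (hI : IsItoIntegral P X (W · x) I) (hW : IsWienerField P ℱ a b β φ W) (hx : x ∈ Set.Icc a b)
    (hX : Adapted ℱ X) (hXc : ∀ᵐ ω ∂P, Continuous (X · ω)) (T : ℝ≥0) {c : ℕ → ℕ → Ω → H}
    (hc : ∀ n i, StronglyMeasurable[ℱ (dyadicPt T n i)] (c n i)) (hc1 : ∀ n i ω, ‖c n i ω‖ ≤ 1) :
    TendstoInMeasure P (fun n ω ↦ ‖∑ i ∈ Finset.range (2 ^ n),
      leftPointError T n (X · ω) (W · x ω) (I · ω) i • c n i ω‖ ^ 2) atTop fun _ ↦ (0 : ℝ) := by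
  have hXm : ∀ t, Measurable (X t) := fun t ↦ (hX t).mono (ℱ.le t) le_rfl
  have hedist : ∀ y : H, edist (‖y‖ ^ 2) 0 = ENNReal.ofReal (‖y‖ ^ 2) := fun y ↦ by
    rw [edist_zero_right, Real.enorm_of_nonneg (sq_nonneg _)]
  refine tendstoInMeasure_of_forall_exists_setLIntegral_edist_le (fun n ↦ ?_) fun η hη ↦ ?_
  · simp only [hedist]
    refine (AEStronglyMeasurable.norm (Finset.aestronglyMeasurable_fun_sum _ fun i _ ↦ ?_)
      ).aemeasurable.pow_const 2 |>.ennreal_ofReal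
    exact (hI.aemeasurable_leftPointError hXm
      (fun t ↦ (hW.adapted x hx t).mono (ℱ.le t) le_rfl) T n i).aestronglyMeasurable.smul
      ((hc n i).mono (ℱ.le _)).aestronglyMeasurable
  · have hlim : Tendsto (fun δ : ℝ ↦ ENNReal.ofReal (δ ^ 2 * ((∑' k, φ k x ^ 2) * T)))
        (𝓝[>] 0) (𝓝 0) := by
      refine Tendsto.mono_left ?_ nhdsWithin_le_nhds
      exact ((ENNReal.continuous_ofReal.comp (by fun_prop)).tendsto' _ _ (by simp))
    obtain ⟨δ, hδη, hδ⟩ := ((hlim.eventually_lt_const hη).and self_mem_nhdsWithin).exists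
    refine ⟨smallOsc T X δ, measurableSet_smallOsc T hXm δ,
      hXc.mono fun ω hω ↦ eventually_mem_smallOsc T hω hδ, fun n ↦ ?_⟩
    simp only [hedist]
    exact (hI.setLIntegral_norm_sum_leftPointError_smul_sq_le hW hx hX (hc n) (hc1 n)
      (le_of_lt hδ)).trans hδη.le

theorem IsItoIntegral.tendstoInMeasure_sum_leftPointError_sq
    (hI : IsItoIntegral P X (W · x) I) (hW : IsWienerField P ℱ a b β φ W) (hx : x ∈ Set.Icc a b)
    (hX : Adapted ℱ X) (hXc : ∀ᵐ ω ∂P, Continuous (X · ω)) (T : ℝ≥0) :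
    TendstoInMeasure P (fun n ω ↦ ∑ i ∈ Finset.range (2 ^ n),
      leftPointError T n (X · ω) (W · x ω) (I · ω) i ^ 2) atTop fun _ ↦ (0 : ℝ) := by
  -- Orthonormal weights in `ℓ²` turn the square of the sum into the sum of the squares.
  let e : ℕ → lp (fun _ : ℕ ↦ ℝ) 2 := fun i ↦ lp.single 2 i 1
  have hnorm : ∀ (s : Finset ℕ) (r : ℕ → ℝ), ‖∑ i ∈ s, r i • e i‖ ^ 2 = ∑ i ∈ s, r i ^ 2 :=
    fun s r ↦ by
      have h := lp.norm_sum_single (E := fun _ : ℕ ↦ ℝ) (p := 2) (by simp) r s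
      simpa [e, ← lp.single_smul] using h
  have he : ∀ i, ‖e i‖ ≤ 1 := fun i ↦ by simp [e, lp.norm_single]
  simpa only [hnorm] using hI.tendstoInMeasure_norm_sum_leftPointError_smul_sq hW hx hX hXc T
    (c := fun _ i _ ↦ e i) (fun _ _ ↦ stronglyMeasurable_const) fun _ i _ ↦ he i

theorem IsItoIntegral.tendstoInMeasure_norm_sum_leftPointError_smul_exp_sq
    (hI : IsItoIntegral P X (W · x) I) (hW : IsWienerField P ℱ a b β φ W) (hx : x ∈ Set.Icc a b)
    (hX : Adapted ℱ X) (hXc : ∀ᵐ ω ∂P, Continuous (X · ω)) (T : ℝ≥0) :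
    TendstoInMeasure P (fun n ω ↦ ‖∑ i ∈ Finset.range (2 ^ n),
      leftPointError T n (X · ω) (W · x ω) (I · ω) i •
        Complex.exp (W (dyadicPt T n i) x ω * Complex.I)‖ ^ 2) atTop fun _ ↦ (0 : ℝ) :=
  hI.tendstoInMeasure_norm_sum_leftPointError_smul_sq hW hx hX hXc T
    (c := fun n i ω ↦ Complex.exp (W (dyadicPt T n i) x ω * Complex.I))
    (fun _ _ ↦ (((Complex.measurable_ofReal.comp (hW.adapted x hx _)).mul_const _).cexp
      ).stronglyMeasurable)
    fun _ _ _ ↦ (Complex.norm_exp_ofReal_mul_I _).le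

end LeftPointError

/-! ### The gauge transform of a path -/

section BlockSums

theorem sum_range_mul_div_mul (n : ℕ) {m : ℕ} (hm : 0 < m) (c a : ℕ → ℂ) :
    ∑ l ∈ Finset.range (n * m), c (l / m) * a l = ∑ b ∈ Finset.range n,
      c b * (∑ i ∈ Finset.range ((b + 1) * m), a i - ∑ i ∈ Finset.range (b * m), a i) := by
  rw [sum_range_mul_eq_sum_sum]
  refine Finset.sum_congr rfl fun b _ ↦ ?_
  rw [Nat.succ_mul, Finset.sum_range_add, add_sub_cancel_left, Finset.mul_sum]
  refine Finset.sum_congr rfl fun r hr ↦ ?_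
  rw [add_comm, Nat.add_mul_div_right _ _ hm, Nat.div_eq_of_lt (Finset.mem_range.1 hr), zero_add]

theorem norm_sum_mul_sub_sum_div_mul_le {n m : ℕ} {G c a : ℕ → ℂ} {η : ℝ}
    (h : ∀ l < n * m, ‖G l - c (l / m)‖ ≤ η) :
    ‖∑ l ∈ Finset.range (n * m), G l * a l - ∑ l ∈ Finset.range (n * m), c (l / m) * a l‖ ≤
      η * ∑ l ∈ Finset.range (n * m), ‖a l‖ := by
  rw [← Finset.sum_sub_distrib, Finset.mul_sum]
  refine norm_sum_le_of_le _ fun l hl ↦ ?_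
  rw [← sub_mul, norm_mul]
  exact mul_le_mul_of_nonneg_right (h l (Finset.mem_range.1 hl)) (norm_nonneg _)

/-- With `a n i` as the mass at the `i`-th dyadic point of level `n`, this is weak convergence of
measures from convergence of their distribution functions. -/
theorem tendsto_sum_mul_zero_of_tendsto_partial_sums {l : Filter ℕ} (hl : l ≤ atTop) {T : ℝ≥0}
    {g : ℝ≥0 → ℂ} (hg : Continuous g) {G a : ℕ → ℕ → ℂ} {B : ℝ}
    (hG : ∀ ε : ℝ, 0 < ε → ∀ᶠ n in l, ∀ i < 2 ^ n, ‖G n i - g (dyadicPt T n i)‖ ≤ ε)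
    (ha : ∀ᶠ n in l, ∑ i ∈ Finset.range (2 ^ n), ‖a n i‖ ≤ B)
    (hpart : ∀ K b : ℕ, b ≤ 2 ^ K →
      Tendsto (fun n ↦ ∑ i ∈ Finset.range (b * 2 ^ (n - K)), a n i) l (𝓝 0)) :
    Tendsto (fun n ↦ ∑ i ∈ Finset.range (2 ^ n), G n i * a n i) l (𝓝 0) := by
  rw [NormedAddGroup.tendsto_nhds_zero]
  intro ε hε
  obtain ⟨η, hη, hηB⟩ := exists_pos_mul_lt (half_pos hε) (2 * B)
  obtain ⟨K, hK⟩ := (eventually_forall_dist_dyadicPt_le hg T hη).exists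
  have hblock : Tendsto (fun n ↦ ∑ b ∈ Finset.range (2 ^ K), g (dyadicPt T K b) *
      (∑ i ∈ Finset.range ((b + 1) * 2 ^ (n - K)), a n i -
        ∑ i ∈ Finset.range (b * 2 ^ (n - K)), a n i)) l (𝓝 0) := by
    simpa using tendsto_finsetSum (Finset.range (2 ^ K)) fun b hb ↦
      ((hpart K (b + 1) (Finset.mem_range.1 hb)).sub
        (hpart K b (Finset.mem_range.1 hb).le)).const_mul (g (dyadicPt T K b))
  filter_upwards [NormedAddGroup.tendsto_nhds_zero.1 hblock _ (half_pos hε), hG η hη, ha,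
    hl (eventually_ge_atTop K)] with n hsum hGn han hKn
  obtain ⟨m, rfl⟩ := Nat.exists_eq_add_of_le hKn
  rw [Nat.add_sub_cancel_left, ← sum_range_mul_div_mul _ (by positivity)] at hsum
  rw [pow_add] at hGn han ⊢
  have hosc : ∀ i < 2 ^ K * 2 ^ m,
      ‖G (K + m) i - g (dyadicPt T K (i / 2 ^ m))‖ ≤ η + η := fun i hi ↦ by
    have hdist := hK (i / 2 ^ m) (Nat.div_lt_of_lt_mul (by rwa [mul_comm] at hi)) _
      ⟨dyadicPt_div_le T K m i, le_dyadicPt_div_succ T K m i⟩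
    rw [dist_eq_norm] at hdist
    exact (norm_sub_le_norm_sub_add_norm_sub _ _ _).trans (add_le_add (hGn i hi) hdist)
  have hdiff := (norm_sum_mul_sub_sum_div_mul_le (a := a (K + m))
    (c := fun b ↦ g (dyadicPt T K b)) hosc).trans
    (mul_le_mul_of_nonneg_left han (add_pos hη hη).le)
  linarith [norm_le_norm_add_norm_sub' (∑ i ∈ Finset.range (2 ^ K * 2 ^ m), G (K + m) i *
    a (K + m) i) (∑ i ∈ Finset.range (2 ^ K * 2 ^ m), g (dyadicPt T K (i / 2 ^ m)) * a (K + m) i)]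

end BlockSums

section Exp

theorem norm_exp_sub_one_sub_trapezoid_le {z : ℂ} (hz : ‖z‖ ≤ 1) :
    ‖Complex.exp z - 1 - z * ((1 + Complex.exp z) / 2)‖ ≤ ‖z‖ ^ 3 := by
  have hexp := Complex.exp_bound hz (n := 3) (by norm_num)
  simp only [Finset.sum_range_succ, Finset.sum_range_zero] at hexp
  norm_num [Nat.factorial] at hexp
  have hfactor : ‖1 - z / 2‖ ≤ 3 / 2 := by
    refine (norm_sub_le _ _).trans ?_
    rw [norm_one, norm_div, Complex.norm_ofNat]
    linarith
  calc ‖Complex.exp z - 1 - z * ((1 + Complex.exp z) / 2)‖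
      = ‖(Complex.exp z - (1 + z + z ^ 2 / 2)) * (1 - z / 2) - z ^ 3 / 4‖ := by ring_nf
    _ ≤ ‖Complex.exp z - (1 + z + z ^ 2 / 2)‖ * ‖1 - z / 2‖ + ‖z‖ ^ 3 / 4 := by
        refine (norm_sub_le _ _).trans_eq ?_
        rw [norm_mul, norm_div, norm_pow, Complex.norm_ofNat]
    _ ≤ ‖z‖ ^ 3 * (2 / 9) * (3 / 2) + ‖z‖ ^ 3 / 4 := by gcongr
    _ ≤ ‖z‖ ^ 3 := by linarith [pow_nonneg (norm_nonneg z) 3]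

theorem norm_exp_sub_exp_sub_trapezoid_le {z z' : ℂ} (h : ‖z' - z‖ ≤ 1) :
    ‖Complex.exp z' - Complex.exp z - (z' - z) * ((Complex.exp z + Complex.exp z') / 2)‖ ≤
      ‖Complex.exp z‖ * ‖z' - z‖ ^ 3 := by
  have hfactor : Complex.exp z' - Complex.exp z -
      (z' - z) * ((Complex.exp z + Complex.exp z') / 2) = Complex.exp z *
        (Complex.exp (z' - z) - 1 - (z' - z) * ((1 + Complex.exp (z' - z)) / 2)) := by
    have hexp : Complex.exp z' = Complex.exp z * Complex.exp (z' - z) := by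
      rw [← Complex.exp_add, add_sub_cancel]
    rw [hexp]
    ring
  rw [hfactor, norm_mul]
  exact mul_le_mul_of_nonneg_left (norm_exp_sub_one_sub_trapezoid_le h) (norm_nonneg _)

theorem norm_exp_ofReal_mul_I_sub_le (x y : ℝ) :
    ‖Complex.exp (x * Complex.I) - Complex.exp (y * Complex.I)‖ ≤ |x - y| := by
  have hfactor : Complex.exp (x * Complex.I) - Complex.exp (y * Complex.I) =
      Complex.exp (y * Complex.I) * (Complex.exp (Complex.I * (x - y : ℝ)) - 1) := by
    rw [mul_sub, ← Complex.exp_add]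
    push_cast
    ring_nf
  rw [hfactor, norm_mul, Complex.norm_exp_ofReal_mul_I, one_mul]
  exact Real.norm_exp_I_mul_ofReal_sub_one_le

end Exp

section DyadicAvg

/-- The mean of the values of `g` at the ends of the `i`-th dyadic interval of level `n`. -/
def dyadicAvg (T : ℝ≥0) (n : ℕ) (g : ℝ≥0 → ℂ) (i : ℕ) : ℂ :=
  (g (dyadicPt T n i) + g (dyadicPt T n (i + 1))) / 2

theorem dyadicIncr_mul (T : ℝ≥0) (n : ℕ) (f g : ℝ≥0 → ℂ) (i : ℕ) :
    dyadicIncr T n (fun t ↦ f t * g t) i =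
      dyadicAvg T n g i * dyadicIncr T n f i + dyadicAvg T n f i * dyadicIncr T n g i := by
  simp only [dyadicAvg, dyadicIncr]
  ring

theorem dyadicAvg_eq_add (T : ℝ≥0) (n : ℕ) (g : ℝ≥0 → ℂ) (i : ℕ) :
    dyadicAvg T n g i = g (dyadicPt T n i) + dyadicIncr T n g i / 2 := by
  simp only [dyadicAvg, dyadicIncr]
  ring

theorem norm_dyadicAvg_le {T : ℝ≥0} {g : ℝ≥0 → ℂ} {M : ℝ} (hg : ∀ t ≤ T, ‖g t‖ ≤ M) {n i : ℕ}
    (hi : i < 2 ^ n) : ‖dyadicAvg T n g i‖ ≤ M := by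
  rw [dyadicAvg, norm_div, Complex.norm_ofNat]
  linarith [norm_add_le (g (dyadicPt T n i)) (g (dyadicPt T n (i + 1))), hg _ (dyadicPt_le hi.le),
    hg _ (dyadicPt_le (Nat.succ_le_of_lt hi))]

theorem eventually_forall_norm_dyadicAvg_sub_le {g : ℝ≥0 → ℂ} (hg : Continuous g) (T : ℝ≥0)
    {ε : ℝ} (hε : 0 < ε) :
    ∀ᶠ n in atTop, ∀ i < 2 ^ n, ∀ s ∈ Set.Icc (dyadicPt T n i) (dyadicPt T n (i + 1)),
      ‖dyadicAvg T n g i - g s‖ ≤ ε := by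
  filter_upwards [eventually_forall_dist_dyadicPt_le hg T (half_pos hε)] with n hn i hi s hs
  have hend := hn i hi _ ⟨dyadicPt_mono T n i.le_succ, le_rfl⟩
  have hs' := hn i hi s hs
  rw [dist_eq_norm] at hend hs'
  calc ‖dyadicAvg T n g i - g s‖
      = ‖dyadicIncr T n g i / 2 - (g s - g (dyadicPt T n i))‖ := by
        rw [dyadicAvg_eq_add]
        ring_nf
    _ ≤ ‖dyadicIncr T n g i‖ / 2 + ‖g s - g (dyadicPt T n i)‖ := by
        refine (norm_sub_le _ _).trans_eq ?_
        rw [norm_div, Complex.norm_ofNat]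
    _ ≤ ε := by
        rw [dyadicIncr]
        linarith

end DyadicAvg

section Primitive

variable {H : ℝ → ℂ} {T : ℝ≥0}

theorem dyadicIncr_integral (hH : Continuous H) (n i : ℕ) :
    dyadicIncr T n (fun t ↦ ∫ s in (0 : ℝ)..t, H s) i =
      ∫ s in (dyadicPt T n i : ℝ)..dyadicPt T n (i + 1), H s :=
  intervalIntegral.integral_interval_sub_left (hH.intervalIntegrable _ _)
    (hH.intervalIntegrable _ _)

theorem sum_dyadicIncr_coe (n : ℕ) :
    ∑ i ∈ Finset.range (2 ^ n), dyadicIncr T n (fun t ↦ (t : ℝ)) i = T := by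
  rw [sum_range_dyadicIncr, dyadicPt_two_pow, NNReal.coe_zero, sub_zero]

theorem norm_integral_dyadic_le {M : ℝ} {n i : ℕ}
    (hH : ∀ s ∈ Set.Icc (dyadicPt T n i : ℝ) (dyadicPt T n (i + 1)), ‖H s‖ ≤ M) :
    ‖∫ s in (dyadicPt T n i : ℝ)..dyadicPt T n (i + 1), H s‖ ≤
      M * dyadicIncr T n (fun t ↦ (t : ℝ)) i := by
  have hle : (dyadicPt T n i : ℝ) ≤ dyadicPt T n (i + 1) :=
    NNReal.coe_le_coe.2 (dyadicPt_mono T n i.le_succ)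
  refine (intervalIntegral.norm_integral_le_of_norm_le_const fun s hs ↦ hH s ?_).trans_eq ?_
  · rw [Set.uIoc_of_le hle] at hs
    exact Set.Ioc_subset_Icc_self hs
  · rw [abs_of_nonneg (sub_nonneg.2 hle)]
    rfl

theorem sum_norm_integral_dyadic_le {M : ℝ} (hH : ∀ s ∈ Set.Icc (0 : ℝ) T, ‖H s‖ ≤ M) (n : ℕ) :
    ∑ i ∈ Finset.range (2 ^ n), ‖∫ s in (dyadicPt T n i : ℝ)..dyadicPt T n (i + 1), H s‖ ≤
      M * T := by
  rw [← sum_dyadicIncr_coe (T := T) n, Finset.mul_sum]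
  refine Finset.sum_le_sum fun i hi ↦ norm_integral_dyadic_le fun s hs ↦ hH s ⟨?_, ?_⟩
  · exact (NNReal.coe_nonneg _).trans hs.1
  · exact hs.2.trans (NNReal.coe_le_coe.2 (dyadicPt_le (Finset.mem_range.1 hi)))

theorem tendsto_sum_dyadicAvg_mul_integral {g : ℝ≥0 → ℂ} (hg : Continuous g) (hH : Continuous H)
    (T : ℝ≥0) :
    Tendsto (fun n ↦ ∑ i ∈ Finset.range (2 ^ n), dyadicAvg T n g i *
      dyadicIncr T n (fun t ↦ ∫ s in (0 : ℝ)..t, H s) i) atTop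
      (𝓝 (∫ s in (0 : ℝ)..T, g s.toNNReal * H s)) := by
  obtain ⟨M, hM⟩ := (isCompact_Icc (a := (0 : ℝ)) (b := T)).exists_bound_of_continuousOn
    hH.continuousOn
  have hgH : Continuous fun s : ℝ ↦ g s.toNNReal * H s := by fun_prop
  have hsum : ∀ n, ∑ i ∈ Finset.range (2 ^ n), dyadicIncr T n
      (fun t ↦ ∫ s in (0 : ℝ)..t, g s.toNNReal * H s) i = ∫ s in (0 : ℝ)..T, g s.toNNReal * H s :=
    fun n ↦ by simp [sum_range_dyadicIncr, dyadicPt_two_pow]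
  rw [tendsto_iff_norm_sub_tendsto_zero, NormedAddGroup.tendsto_nhds_zero]
  intro ε hε
  obtain ⟨η, hη, hηM⟩ := exists_pos_mul_lt hε (M * T)
  filter_upwards [eventually_forall_norm_dyadicAvg_sub_le hg T hη] with n hn
  have hterm : ∀ i ∈ Finset.range (2 ^ n), ‖dyadicAvg T n g i *
      dyadicIncr T n (fun t ↦ ∫ s in (0 : ℝ)..t, H s) i -
      dyadicIncr T n (fun t ↦ ∫ s in (0 : ℝ)..t, g s.toNNReal * H s) i‖ ≤
        η * M * dyadicIncr T n (fun t ↦ (t : ℝ)) i := fun i hi ↦ by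
    have hi' := Finset.mem_range.1 hi
    rw [dyadicIncr_integral hH, dyadicIncr_integral hgH, ← intervalIntegral.integral_const_mul,
      ← intervalIntegral.integral_sub ((hH.const_mul _).intervalIntegrable _ _)
        (hgH.intervalIntegrable _ _)]
    refine norm_integral_dyadic_le fun s hs ↦ ?_
    rw [← sub_mul, norm_mul]
    exact mul_le_mul
      (hn i hi' _ ⟨NNReal.le_toNNReal_of_coe_le hs.1, Real.toNNReal_le_iff_le_coe.2 hs.2⟩)
      (hM s ⟨(NNReal.coe_nonneg _).trans hs.1,
        hs.2.trans (NNReal.coe_le_coe.2 (dyadicPt_le hi'))⟩) (norm_nonneg _) hη.le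
  rw [norm_norm, ← hsum n, ← Finset.sum_sub_distrib]
  calc _ ≤ ∑ i ∈ Finset.range (2 ^ n), η * M * dyadicIncr T n (fun t ↦ (t : ℝ)) i :=
        norm_sum_le_of_le _ hterm
    _ = M * T * η := by
        rw [← Finset.mul_sum, sum_dyadicIncr_coe]
        ring
    _ < ε := hηM

end Primitive

section SquareSums

variable {E F : Type*} [SeminormedAddCommGroup E] [SeminormedAddCommGroup F] {l : Filter ℕ}
  {x : ℕ → ℕ → E}

/-- The sums `∑ i < 2 ^ n, ‖x n i‖ ^ 2` are eventually bounded along `l`. For increments over dyadic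
partitions this is the finiteness of the quadratic variation along `l`. -/
def HasBoundedSqSums (l : Filter ℕ) (x : ℕ → ℕ → E) : Prop :=
  ∃ B : ℝ, ∀ᶠ n in l, ∑ i ∈ Finset.range (2 ^ n), ‖x n i‖ ^ 2 ≤ B

theorem HasBoundedSqSums.of_norm_le {y : ℕ → ℕ → F} (hy : HasBoundedSqSums l y) {M : ℝ}
    (h : ∀ n, ∀ i < 2 ^ n, ‖x n i‖ ≤ M * ‖y n i‖) : HasBoundedSqSums l x := by
  obtain ⟨B, hB⟩ := hy
  refine ⟨M ^ 2 * B, hB.mono fun n hn ↦ ?_⟩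
  calc ∑ i ∈ Finset.range (2 ^ n), ‖x n i‖ ^ 2
      ≤ ∑ i ∈ Finset.range (2 ^ n), M ^ 2 * ‖y n i‖ ^ 2 := Finset.sum_le_sum fun i hi ↦ by
        rw [← mul_pow]
        exact pow_le_pow_left₀ (norm_nonneg _) (h n i (Finset.mem_range.1 hi)) 2
    _ ≤ M ^ 2 * B := by
        rw [← Finset.mul_sum]
        exact mul_le_mul_of_nonneg_left hn (sq_nonneg M)

theorem HasBoundedSqSums.add (hx : HasBoundedSqSums l x) (hy : HasBoundedSqSums l y) :
    HasBoundedSqSums l fun n i ↦ x n i + y n i := by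
  obtain ⟨B, hB⟩ := hx
  obtain ⟨B', hB'⟩ := hy
  refine ⟨2 * B + 2 * B', ?_⟩
  filter_upwards [hB, hB'] with n hn hn'
  calc ∑ i ∈ Finset.range (2 ^ n), ‖x n i + y n i‖ ^ 2
      ≤ ∑ i ∈ Finset.range (2 ^ n), (2 * ‖x n i‖ ^ 2 + 2 * ‖y n i‖ ^ 2) :=
        Finset.sum_le_sum fun i _ ↦ (pow_le_pow_left₀ (norm_nonneg _) (norm_add_le _ _) 2).trans
          (by linarith [add_sq_le (a := ‖x n i‖) (b := ‖y n i‖)])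
    _ ≤ 2 * B + 2 * B' := by
        rw [Finset.sum_add_distrib, ← Finset.mul_sum, ← Finset.mul_sum]
        linarith

theorem hasBoundedSqSums_of_sum_norm_le {V : ℝ}
    (h : ∀ n, ∑ i ∈ Finset.range (2 ^ n), ‖x n i‖ ≤ V) : HasBoundedSqSums l x :=
  ⟨V ^ 2, .of_forall fun n ↦
    (Finset.sum_sq_le_sq_sum_of_nonneg fun _ _ ↦ norm_nonneg _).trans
      (pow_le_pow_left₀ (Finset.sum_nonneg fun _ _ ↦ norm_nonneg _) (h n) 2)⟩

theorem hasBoundedSqSums_of_tendsto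
    (h : Tendsto (fun n ↦ ∑ i ∈ Finset.range (2 ^ n), ‖x n i‖ ^ 2) l (𝓝 0)) :
    HasBoundedSqSums l x :=
  ⟨1, h.eventually_le_const one_pos⟩

theorem HasBoundedSqSums.exists_sum_mul_le {y : ℕ → ℕ → F} (hx : HasBoundedSqSums l x)
    (hy : HasBoundedSqSums l y) :
    ∃ B : ℝ, ∀ᶠ n in l, ∑ i ∈ Finset.range (2 ^ n), ‖x n i‖ * ‖y n i‖ ≤ B := by
  obtain ⟨B, hB⟩ := hx
  obtain ⟨B', hB'⟩ := hy
  refine ⟨√B * √B', ?_⟩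
  filter_upwards [hB, hB'] with n hn hn'
  exact (Real.sum_mul_le_sqrt_mul_sqrt _ _ _).trans (by gcongr)

theorem HasBoundedSqSums.tendsto_sum_mul_zero {y : ℕ → ℕ → F} (hx : HasBoundedSqSums l x)
    (hy : Tendsto (fun n ↦ ∑ i ∈ Finset.range (2 ^ n), ‖y n i‖ ^ 2) l (𝓝 0)) :
    Tendsto (fun n ↦ ∑ i ∈ Finset.range (2 ^ n), ‖x n i‖ * ‖y n i‖) l (𝓝 0) := by
  obtain ⟨B, hB⟩ := hx
  have hlim : Tendsto (fun n ↦ √B * √(∑ i ∈ Finset.range (2 ^ n), ‖y n i‖ ^ 2)) l (𝓝 0) := by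
    simpa using hy.sqrt.const_mul √B
  refine squeeze_zero' (.of_forall fun n ↦ by positivity) ?_ hlim
  filter_upwards [hB] with n hn
  exact (Real.sum_mul_le_sqrt_mul_sqrt _ _ _).trans (by gcongr)

theorem HasBoundedSqSums.tendsto_sum_pow_three (hx : HasBoundedSqSums l x)
    (hsmall : ∀ ε : ℝ, 0 < ε → ∀ᶠ n in l, ∀ i < 2 ^ n, ‖x n i‖ ≤ ε) :
    Tendsto (fun n ↦ ∑ i ∈ Finset.range (2 ^ n), ‖x n i‖ ^ 3) l (𝓝 0) := by
  obtain ⟨B, hB⟩ := hx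
  rw [NormedAddGroup.tendsto_nhds_zero]
  intro ε hε
  obtain ⟨η, hη, hηB⟩ := exists_pos_mul_lt hε B
  filter_upwards [hB, hsmall η hη] with n hn hsm
  rw [Real.norm_of_nonneg (Finset.sum_nonneg fun _ _ ↦ pow_nonneg (norm_nonneg _) 3)]
  calc ∑ i ∈ Finset.range (2 ^ n), ‖x n i‖ ^ 3
      ≤ ∑ i ∈ Finset.range (2 ^ n), ‖x n i‖ ^ 2 * η := Finset.sum_le_sum fun i hi ↦
        mul_le_mul_of_nonneg_left (hsm i (Finset.mem_range.1 hi)) (sq_nonneg _)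
    _ ≤ B * η := by
        rw [← Finset.sum_mul]
        exact mul_le_mul_of_nonneg_right hn hη.le
    _ < ε := hηB

end SquareSums

/-- Along the filter `l` of levels, the sums over the dyadic partitions of `[0, T]` behave as they
do for an integrand `x`, its Itô integral `I` against `w` and the covariation `C` of `x` and `w`. -/
structure HasStratonovichSums (l : Filter ℕ) (T : ℝ≥0) (x : ℝ≥0 → ℂ) (w : ℝ≥0 → ℝ)
    (I C : ℝ≥0 → ℂ) : Prop where
  variation : ∃ V : ℝ, ∀ n, ∑ i ∈ Finset.range (2 ^ n), ‖dyadicIncr T n C i‖ ≤ V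
  error_sq : Tendsto (fun n ↦ ∑ i ∈ Finset.range (2 ^ n), ‖leftPointError T n x w I i‖ ^ 2) l (𝓝 0)
  exp_error : Tendsto (fun n ↦ ∑ i ∈ Finset.range (2 ^ n),
    Complex.exp (w (dyadicPt T n i) * Complex.I) * leftPointError T n x w I i) l (𝓝 0)
  covariation : ∀ K b : ℕ, b ≤ 2 ^ K → Tendsto (fun n ↦ ∑ i ∈ Finset.range (b * 2 ^ (n - K)),
    dyadicIncr T n w i • dyadicIncr T n x i) l (𝓝 (C (dyadicPt T K b)))

namespace HasStratonovichSums

variable {l l' : Filter ℕ} {T : ℝ≥0} {x y I J C D : ℝ≥0 → ℂ} {w : ℝ≥0 → ℝ}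

theorem mono (h : HasStratonovichSums l T x w I C) (hl : l' ≤ l) :
    HasStratonovichSums l' T x w I C where
  variation := h.variation
  error_sq := h.error_sq.mono_left hl
  exp_error := h.exp_error.mono_left hl
  covariation K b hb := (h.covariation K b hb).mono_left hl

theorem const_mul (h : HasStratonovichSums l T x w I C) (c : ℂ) :
    HasStratonovichSums l T (fun t ↦ c * x t) w (fun t ↦ c * I t) fun t ↦ c * C t := by
  have herr : ∀ n i, leftPointError T n (fun t ↦ c * x t) w (fun t ↦ c * I t) i =
      c * leftPointError T n x w I i := fun n i ↦ by
    simp only [leftPointError, dyadicIncr_const_mul, mul_sub, mul_smul_comm]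
  refine ⟨?_, ?_, ?_, fun K b hb ↦ ?_⟩
  · obtain ⟨V, hV⟩ := h.variation
    refine ⟨‖c‖ * V, fun n ↦ ?_⟩
    simp only [dyadicIncr_const_mul, norm_mul, ← Finset.mul_sum]
    exact mul_le_mul_of_nonneg_left (hV n) (norm_nonneg c)
  · simpa only [herr, norm_mul, mul_pow, ← Finset.mul_sum, mul_zero] using
      h.error_sq.const_mul (‖c‖ ^ 2)
  · simpa only [herr, mul_left_comm _ c, ← Finset.mul_sum, mul_zero] using h.exp_error.const_mul c
  · simpa only [dyadicIncr_const_mul, mul_smul_comm, Finset.mul_sum] using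
      (h.covariation K b hb).const_mul c

theorem add (hx : HasStratonovichSums l T x w I C) (hy : HasStratonovichSums l T y w J D) :
    HasStratonovichSums l T (fun t ↦ x t + y t) w (fun t ↦ I t + J t) fun t ↦ C t + D t := by
  have herr : ∀ n i, leftPointError T n (fun t ↦ x t + y t) w (fun t ↦ I t + J t) i =
      leftPointError T n x w I i + leftPointError T n y w J i := fun n i ↦ by
    simp only [leftPointError, dyadicIncr_add, smul_add, add_sub_add_comm]
  refine ⟨?_, ?_, ?_, fun K b hb ↦ ?_⟩
  · obtain ⟨V, hV⟩ := hx.variation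
    obtain ⟨V', hV'⟩ := hy.variation
    refine ⟨V + V', fun n ↦ ?_⟩
    simp only [dyadicIncr_add]
    exact (Finset.sum_le_sum fun i _ ↦ norm_add_le _ _).trans
      (Finset.sum_add_distrib.trans_le (add_le_add (hV n) (hV' n)))
  · have hlim := (hx.error_sq.const_mul 2).add (hy.error_sq.const_mul 2)
    rw [mul_zero, add_zero] at hlim
    refine squeeze_zero (fun n ↦ by positivity) (fun n ↦ ?_) hlim
    rw [Finset.mul_sum, Finset.mul_sum, ← Finset.sum_add_distrib]
    refine Finset.sum_le_sum fun i _ ↦ ?_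
    rw [herr, ← mul_add]
    exact (pow_le_pow_left₀ (norm_nonneg _) (norm_add_le _ _) 2).trans add_sq_le
  · simpa only [herr, mul_add, Finset.sum_add_distrib, add_zero] using
      hx.exp_error.add hy.exp_error
  · simpa only [dyadicIncr_add, smul_add, Finset.sum_add_distrib] using
      (hx.covariation K b hb).add (hy.covariation K b hb)

theorem covariation_zero [l.NeBot] (h : HasStratonovichSums l T x w I C) : C 0 = 0 := by
  have hlim := h.covariation 0 0 (Nat.zero_le _)
  simp only [zero_mul, Finset.range_zero, Finset.sum_empty, dyadicPt_zero] at hlim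
  exact tendsto_nhds_unique hlim tendsto_const_nhds

theorem tendsto_sum_dyadicAvg_mul_leftPointError (h : HasStratonovichSums l T x w I C)
    (hw : HasBoundedSqSums l fun n i ↦ dyadicIncr T n w i) :
    Tendsto (fun n ↦ ∑ i ∈ Finset.range (2 ^ n),
      dyadicAvg T n (fun t ↦ Complex.exp (w t * Complex.I)) i * leftPointError T n x w I i) l
      (𝓝 0) := by
  have hincr : HasBoundedSqSums l
      fun n i ↦ dyadicIncr T n (fun t ↦ Complex.exp (w t * Complex.I)) i :=
    hw.of_norm_le (M := 1) fun n i _ ↦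
      (norm_exp_ofReal_mul_I_sub_le _ _).trans_eq (one_mul _).symm
  have hprod : Tendsto (fun n ↦ ∑ i ∈ Finset.range (2 ^ n),
      dyadicIncr T n (fun t ↦ Complex.exp (w t * Complex.I)) i * leftPointError T n x w I i) l
      (𝓝 0) :=
    squeeze_zero_norm (fun n ↦ norm_sum_le_of_le _ fun i _ ↦ (norm_mul _ _).le)
      (hincr.tendsto_sum_mul_zero h.error_sq)
  have hlim := h.exp_error.add (hprod.div_const 2)
  rw [zero_div, add_zero] at hlim
  refine hlim.congr fun n ↦ ?_
  rw [Finset.sum_div, ← Finset.sum_add_distrib]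
  refine Finset.sum_congr rfl fun i _ ↦ ?_
  rw [dyadicAvg_eq_add]
  ring

theorem tendsto_sum_dyadicAvg_mul_covariation_sub [l.NeBot] (hl : l ≤ atTop)
    (h : HasStratonovichSums l T x w I C) (hw : HasBoundedSqSums l fun n i ↦ dyadicIncr T n w i)
    (hx : HasBoundedSqSums l fun n i ↦ dyadicIncr T n x i) {g : ℝ≥0 → ℂ} (hg : Continuous g) :
    Tendsto (fun n ↦ ∑ i ∈ Finset.range (2 ^ n), dyadicAvg T n g i *
      (dyadicIncr T n C i - dyadicIncr T n w i • dyadicIncr T n x i)) l (𝓝 0) := by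
  obtain ⟨V, hV⟩ := h.variation
  obtain ⟨B, hB⟩ := hw.exists_sum_mul_le hx
  refine tendsto_sum_mul_zero_of_tendsto_partial_sums hl (T := T) hg (B := V + B) (fun ε hε ↦ ?_) ?_
    fun K b hb ↦ ?_
  · filter_upwards [hl (eventually_forall_norm_dyadicAvg_sub_le hg T hε)] with n hn i hi
    exact hn i hi _ ⟨le_rfl, dyadicPt_mono T n i.le_succ⟩
  · filter_upwards [hB] with n hn
    refine (Finset.sum_le_sum fun i _ ↦ norm_sub_le _ _).trans ?_
    simp only [norm_smul, Finset.sum_add_distrib]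
    exact add_le_add (hV n) hn
  · have hlim := (h.covariation K b hb).const_sub (C (dyadicPt T K b))
    rw [sub_self] at hlim
    refine hlim.congr' ?_
    filter_upwards [hl (eventually_ge_atTop K)] with n hn
    obtain ⟨m, rfl⟩ := Nat.exists_eq_add_of_le hn
    rw [Finset.sum_sub_distrib, sum_range_dyadicIncr, h.covariation_zero, sub_zero,
      Nat.add_sub_cancel_left, dyadicPt_add_mul_two_pow]

end HasStratonovichSums

section Gauge

variable {l : Filter ℕ} {T : ℝ≥0} {u J C : ℝ≥0 → ℂ} {w : ℝ≥0 → ℝ} {H : ℝ → ℂ} {u₀ : ℂ}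

theorem tendsto_sum_dyadicAvg_mul_exp_trapezoid (hl : l ≤ atTop) (hu : Continuous u)
    (hwc : Continuous w) (hw : HasBoundedSqSums l fun n i ↦ dyadicIncr T n w i) :
    Tendsto (fun n ↦ ∑ i ∈ Finset.range (2 ^ n), dyadicAvg T n u i *
      (dyadicIncr T n (fun t ↦ Complex.exp (w t * Complex.I)) i - dyadicIncr T n w i * Complex.I *
        dyadicAvg T n (fun t ↦ Complex.exp (w t * Complex.I)) i)) l (𝓝 0) := by
  obtain ⟨M, hM⟩ := (isCompact_Icc (a := 0) (b := T)).exists_bound_of_continuousOn hu.continuousOn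
  have hM0 : 0 ≤ M := (norm_nonneg _).trans (hM 0 ⟨le_rfl, zero_le⟩)
  have hsmall : ∀ ε : ℝ, 0 < ε → ∀ᶠ n in l, ∀ i < 2 ^ n, ‖dyadicIncr T n w i‖ ≤ ε := fun ε hε ↦ by
    filter_upwards [hl (eventually_forall_dist_dyadicPt_le hwc T hε)] with n hn i hi
    exact hn i hi _ ⟨dyadicPt_mono T n i.le_succ, le_rfl⟩
  have hlim := (hw.tendsto_sum_pow_three hsmall).const_mul M
  rw [mul_zero] at hlim
  refine squeeze_zero_norm' ?_ hlim
  filter_upwards [hsmall 1 one_pos] with n hn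
  rw [Finset.mul_sum]
  refine norm_sum_le_of_le _ fun i hi ↦ ?_
  have hi' := Finset.mem_range.1 hi
  have hincr : (w (dyadicPt T n (i + 1)) * Complex.I - w (dyadicPt T n i) * Complex.I : ℂ) =
      dyadicIncr T n w i * Complex.I := by
    simp only [dyadicIncr]
    push_cast
    ring
  have htrap := norm_exp_sub_exp_sub_trapezoid_le (z := w (dyadicPt T n i) * Complex.I)
    (z' := w (dyadicPt T n (i + 1)) * Complex.I)
  rw [hincr, norm_mul, Complex.norm_I, mul_one, Complex.norm_real,
    Complex.norm_exp_ofReal_mul_I, one_mul] at htrap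
  rw [norm_mul]
  exact mul_le_mul (norm_dyadicAvg_le (fun t ht ↦ hM t ⟨zero_le, ht⟩) hi') (htrap (hn i hi'))
    (norm_nonneg _) hM0

variable (heq : ∀ t : ℝ≥0,
  u t = u₀ + (∫ s in (0 : ℝ)..t, H s) - Complex.I * (J t + C t / 2))

include heq

theorem dyadicIncr_eq_of_stratonovich_path (n i : ℕ) :
    dyadicIncr T n u i = dyadicIncr T n (fun t ↦ ∫ s in (0 : ℝ)..t, H s) i -
      Complex.I * (leftPointError T n u w J i + dyadicIncr T n w i • u (dyadicPt T n i) +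
        dyadicIncr T n C i / 2) := by
  simp only [leftPointError, dyadicIncr]
  linear_combination heq (dyadicPt T n (i + 1)) - heq (dyadicPt T n i)

theorem HasStratonovichSums.hasBoundedSqSums_dyadicIncr (hu : Continuous u) (hH : Continuous H)
    (h : HasStratonovichSums l T u w J C) (hw : HasBoundedSqSums l fun n i ↦ dyadicIncr T n w i) :
    HasBoundedSqSums l fun n i ↦ dyadicIncr T n u i := by
  obtain ⟨M, hM⟩ := (isCompact_Icc (a := (0 : ℝ)) (b := T)).exists_bound_of_continuousOn
    hH.continuousOn
  obtain ⟨Mu, hMu⟩ := (isCompact_Icc (a := 0) (b := T)).exists_bound_of_continuousOn hu.continuousOn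
  obtain ⟨V, hV⟩ := h.variation
  have hdrift : HasBoundedSqSums l
      fun n i ↦ dyadicIncr T n (fun t ↦ ∫ s in (0 : ℝ)..t, H s) i :=
    hasBoundedSqSums_of_sum_norm_le fun n ↦ by
      simpa only [dyadicIncr_integral hH] using sum_norm_integral_dyadic_le hM n
  have hnoise : HasBoundedSqSums l fun n i ↦ dyadicIncr T n w i • u (dyadicPt T n i) :=
    hw.of_norm_le fun n i hi ↦ by
      rw [norm_smul, mul_comm]
      exact mul_le_mul_of_nonneg_right (hMu _ ⟨zero_le, dyadicPt_le hi.le⟩) (norm_nonneg _)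
  have hcorr : HasBoundedSqSums l fun n i ↦ dyadicIncr T n C i / 2 :=
    (hasBoundedSqSums_of_sum_norm_le hV).of_norm_le (M := 1 / 2) fun n i _ ↦ by
      rw [norm_div, Complex.norm_ofNat]
      exact (div_eq_inv_mul _ _).trans_le (by norm_num)
  have hsum := ((hasBoundedSqSums_of_tendsto h.error_sq).add hnoise).add hcorr
  simp only [dyadicIncr_eq_of_stratonovich_path (w := w) heq, sub_eq_add_neg]
  exact hdrift.add (hsum.of_norm_le (M := 1) fun n i _ ↦ by simp)

theorem dyadicIncr_exp_mul_of_stratonovich_path (n i : ℕ) :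
    dyadicIncr T n (fun t ↦ Complex.exp (w t * Complex.I) * u t) i =
      dyadicAvg T n (fun t ↦ Complex.exp (w t * Complex.I)) i *
          dyadicIncr T n (fun t ↦ ∫ s in (0 : ℝ)..t, H s) i -
        Complex.I * (dyadicAvg T n (fun t ↦ Complex.exp (w t * Complex.I)) i *
          leftPointError T n u w J i) -
        Complex.I / 2 * (dyadicAvg T n (fun t ↦ Complex.exp (w t * Complex.I)) i *
          (dyadicIncr T n C i - dyadicIncr T n w i • dyadicIncr T n u i)) +
        dyadicAvg T n u i * (dyadicIncr T n (fun t ↦ Complex.exp (w t * Complex.I)) i -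
          dyadicIncr T n w i * Complex.I *
            dyadicAvg T n (fun t ↦ Complex.exp (w t * Complex.I)) i) := by
  have hpath := dyadicIncr_eq_of_stratonovich_path (T := T) (w := w) heq n i
  have hup := dyadicAvg_eq_add T n u i
  rw [dyadicIncr_mul]
  simp only [Complex.real_smul] at hpath ⊢
  linear_combination (dyadicAvg T n (fun t ↦ Complex.exp (w t * Complex.I)) i) * hpath +
    Complex.I * dyadicAvg T n (fun t ↦ Complex.exp (w t * Complex.I)) i *
      ((dyadicIncr T n w i : ℝ) : ℂ) * hup

/-- The ordinary product rule for `e^{iw} u` when `du = H dt - i u ∘ dw`: the trapezoidal sums of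
the Stratonovich integral leave no second-order term. -/
theorem HasStratonovichSums.exp_mul_sub_eq_integral [l.NeBot] (hl : l ≤ atTop) (hu : Continuous u)
    (hwc : Continuous w) (hH : Continuous H) (h : HasStratonovichSums l T u w J C)
    (hw : HasBoundedSqSums l fun n i ↦ dyadicIncr T n w i) :
    Complex.exp (w T * Complex.I) * u T - Complex.exp (w 0 * Complex.I) * u 0 =
      ∫ s in (0 : ℝ)..T, Complex.exp (w s.toNNReal * Complex.I) * H s := by
  have hexp : Continuous fun t ↦ Complex.exp (w t * Complex.I) := by fun_prop
  have hdrift := (tendsto_sum_dyadicAvg_mul_integral hexp hH T).mono_left hl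
  have herror := h.tendsto_sum_dyadicAvg_mul_leftPointError hw
  have hcov := h.tendsto_sum_dyadicAvg_mul_covariation_sub hl hw
    (h.hasBoundedSqSums_dyadicIncr heq hu hH hw) hexp
  have htrap := tendsto_sum_dyadicAvg_mul_exp_trapezoid hl hu hwc hw
  have hlim := ((hdrift.sub (herror.const_mul Complex.I)).sub (hcov.const_mul (Complex.I / 2))).add
    htrap
  simp only [mul_zero, sub_zero, add_zero] at hlim
  refine tendsto_nhds_unique (tendsto_const_nhds.congr fun n ↦ ?_) hlim
  have htel := sum_range_dyadicIncr T n (2 ^ n) fun t ↦ Complex.exp (w t * Complex.I) * u t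
  rw [dyadicPt_two_pow] at htel
  rw [← htel, Finset.mul_sum, Finset.mul_sum, ← Finset.sum_sub_distrib, ← Finset.sum_sub_distrib,
    ← Finset.sum_add_distrib]
  exact Finset.sum_congr rfl fun i _ ↦ dyadicIncr_exp_mul_of_stratonovich_path heq n i

end Gauge

/-! ### Almost sure convergence along a subsequence -/

theorem exists_forall_sum_norm_dyadicIncr_le {E : Type*} [SeminormedAddCommGroup E] {f : ℝ≥0 → E}
    (hf : LocallyBoundedVariationOn f Set.univ) (T : ℝ≥0) :
    ∃ V : ℝ, ∀ n, ∑ i ∈ Finset.range (2 ^ n), ‖dyadicIncr T n f i‖ ≤ V := by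
  have hfin := hf 0 T (Set.mem_univ _) (Set.mem_univ _)
  refine ⟨(eVariationOn f (Set.univ ∩ Set.Icc 0 T)).toReal, fun n ↦ ?_⟩
  rw [← ENNReal.ofReal_le_iff_le_toReal hfin,
    ENNReal.ofReal_sum_of_nonneg fun _ _ ↦ norm_nonneg _]
  simpa only [edist_eq_enorm_sub, ofReal_norm, dyadicIncr] using
    eVariationOn.sum_le_of_monotoneOn_Iic (f := f) (s := Set.univ ∩ Set.Icc 0 T)
      (n := 2 ^ n) (u := dyadicPt T n) ((dyadicPt_mono T n).monotoneOn _)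
      fun i hi ↦ ⟨Set.mem_univ _, zero_le, dyadicPt_le hi⟩

theorem hasStratonovichSums_ofReal {l : Filter ℕ} {T : ℝ≥0} {x w I C : ℝ≥0 → ℝ}
    (hC : LocallyBoundedVariationOn C Set.univ)
    (herr : Tendsto (fun n ↦ ∑ i ∈ Finset.range (2 ^ n), leftPointError T n x w I i ^ 2) l (𝓝 0))
    (hexp : Tendsto (fun n ↦ ‖∑ i ∈ Finset.range (2 ^ n), leftPointError T n x w I i •
      Complex.exp (w (dyadicPt T n i) * Complex.I)‖ ^ 2) l (𝓝 0))
    (hcov : ∀ K b : ℕ, Tendsto (fun n ↦ ∑ i ∈ Finset.range (b * 2 ^ (n - K)),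
      dyadicIncr T n x i * dyadicIncr T n w i) l (𝓝 (C (dyadicPt T K b)))) :
    HasStratonovichSums l T (fun t ↦ (x t : ℂ)) w (fun t ↦ (I t : ℂ)) fun t ↦ (C t : ℂ) := by
  have hincr : ∀ (f : ℝ≥0 → ℝ) (n i : ℕ),
      dyadicIncr T n (fun t ↦ (f t : ℂ)) i = (dyadicIncr T n f i : ℝ) := fun f n i ↦
    (Complex.ofReal_sub _ _).symm
  have hcast : ∀ n i, leftPointError T n (fun t ↦ (x t : ℂ)) w (fun t ↦ (I t : ℂ)) i =
      (leftPointError T n x w I i : ℝ) := fun n i ↦ by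
    simp only [leftPointError, hincr, Complex.real_smul, smul_eq_mul, Complex.ofReal_sub,
      Complex.ofReal_mul]
  refine ⟨?_, ?_, ?_, fun K b _ ↦ ?_⟩
  · simpa only [hincr, Complex.norm_real] using exists_forall_sum_norm_dyadicIncr_le hC T
  · simpa only [hcast, Complex.norm_real, Real.norm_eq_abs, sq_abs] using herr
  · have hnorm := hexp.sqrt
    simp only [Real.sqrt_sq (norm_nonneg _), Real.sqrt_zero] at hnorm
    simpa only [hcast, Complex.real_smul, mul_comm] using tendsto_zero_iff_norm_tendsto_zero.2 hnorm
  · have hlim := (Complex.continuous_ofReal.tendsto _).comp (hcov K b)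
    simpa only [hincr, Complex.real_smul, mul_comm, Function.comp_def, Complex.ofReal_sum,
      Complex.ofReal_mul] using hlim

section WienerField

variable {Ω : Type*} {mΩ : MeasurableSpace Ω} {P : Measure Ω} {ℱ : Filtration ℝ≥0 mΩ} {a b x : ℝ}
  {β : ℕ → ℝ≥0 → Ω → ℝ} {φ : ℕ → ℝ → ℝ} {W : ℝ≥0 → ℝ → Ω → ℝ}

theorem IsWienerField.measurable (hW : IsWienerField P ℱ a b β φ W) (hx : x ∈ Set.Icc a b)
    (t : ℝ≥0) : Measurable (W t x) :=
  (hW.adapted x hx t).mono (ℱ.le t) le_rfl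

theorem ae_exists_frequently_le_of_lintegral_le {f : ℕ → Ω → ℝ} (hf : ∀ k, Measurable (f k)) {c : ℝ}
    (h : ∀ k, ∫⁻ ω, ENNReal.ofReal (f k ω) ∂P ≤ ENNReal.ofReal c) :
    ∀ᵐ ω ∂P, ∃ B : ℝ, ∃ᶠ k in atTop, f k ω ≤ B := by
  have hm : ∀ k, Measurable fun ω ↦ ENNReal.ofReal (f k ω) := fun k ↦ (hf k).ennreal_ofReal
  have hfatou : ∫⁻ ω, liminf (fun k ↦ ENNReal.ofReal (f k ω)) atTop ∂P ≤ ENNReal.ofReal c :=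
    (lintegral_liminf_le hm).trans (liminf_le_of_frequently_le' (Frequently.of_forall h))
  filter_upwards [ae_lt_top (Measurable.liminf hm)
    (ne_top_of_le_ne_top ENNReal.ofReal_ne_top hfatou)] with ω hω
  obtain ⟨B, hlt, -⟩ := ENNReal.lt_iff_exists_nnreal_btwn.1 hω
  refine ⟨B, (frequently_lt_of_liminf_lt (by isBoundedDefault) hlt).mono fun k hk ↦ ?_⟩
  exact (ENNReal.ofReal_le_iff_le_toReal ENNReal.coe_ne_top).1 hk.le

variable [IsProbabilityMeasure P]

theorem IsWienerField.lintegral_sum_dyadicIncr_sq_le (hW : IsWienerField P ℱ a b β φ W)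
    (hx : x ∈ Set.Icc a b) (T : ℝ≥0) (n : ℕ) :
    ∫⁻ ω, ENNReal.ofReal (∑ i ∈ Finset.range (2 ^ n), dyadicIncr T n (W · x ω) i ^ 2) ∂P ≤
      ENNReal.ofReal ((∑' k, φ k x ^ 2) * T) := by
  have hκ : 0 ≤ ∑' k, φ k x ^ 2 := tsum_nonneg fun _ ↦ sq_nonneg _
  have hmeas : ∀ i, Measurable fun ω ↦ ENNReal.ofReal (dyadicIncr T n (W · x ω) i ^ 2) := fun i ↦
    (((hW.measurable hx _).sub (hW.measurable hx _)).pow_const 2).ennreal_ofReal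
  have hstep : ∀ i, ∫⁻ ω, ENNReal.ofReal (dyadicIncr T n (W · x ω) i ^ 2) ∂P ≤
      ENNReal.ofReal ((∑' k, φ k x ^ 2) * dyadicIncr T n (fun t ↦ (t : ℝ)) i) := fun i ↦ by
    have h := hW.lintegral_norm_sum_smul_sq_le hx (τ := fun l ↦ dyadicPt T n (i + l))
      (fun l l' hl ↦ dyadicPt_mono T n (Nat.add_le_add_left hl i)) (Y := fun _ _ ↦ (1 : ℝ)) (K := 1)
      (fun _ ↦ stronglyMeasurable_const) (fun _ _ ↦ norm_one.le) 1
    simpa [dyadicIncr] using h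
  simp only [ENNReal.ofReal_sum_of_nonneg fun _ _ ↦ sq_nonneg _]
  rw [lintegral_finsetSum _ fun i _ ↦ hmeas i]
  refine (Finset.sum_le_sum fun i _ ↦ hstep i).trans_eq ?_
  rw [← ENNReal.ofReal_sum_of_nonneg fun i _ ↦ mul_nonneg hκ (dyadicIncr_coe_nonneg T n i),
    ← Finset.mul_sum, sum_range_dyadicIncr, dyadicPt_two_pow, NNReal.coe_zero, sub_zero]

theorem IsWienerField.ae_exists_hasBoundedSqSums (hW : IsWienerField P ℱ a b β φ W)
    (hx : x ∈ Set.Icc a b) (T : ℝ≥0) (ns : ℕ → ℕ) :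
    ∀ᵐ ω ∂P, ∃ l : Filter ℕ, l.NeBot ∧ l ≤ map ns atTop ∧
      HasBoundedSqSums l fun n i ↦ dyadicIncr T n (W · x ω) i := by
  have hmeas : ∀ k, Measurable fun ω ↦
      ∑ i ∈ Finset.range (2 ^ ns k), dyadicIncr T (ns k) (W · x ω) i ^ 2 := fun k ↦
    Finset.measurable_fun_sum _ fun i _ ↦
      ((hW.measurable hx _).sub (hW.measurable hx _)).pow_const 2
  filter_upwards [ae_exists_frequently_le_of_lintegral_le hmeas fun k ↦
    hW.lintegral_sum_dyadicIncr_sq_le hx T (ns k)] with ω ⟨B, hB⟩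
  refine ⟨map ns (atTop ⊓ 𝓟 {k | ∑ i ∈ Finset.range (2 ^ ns k),
    dyadicIncr T (ns k) (W · x ω) i ^ 2 ≤ B}), ?_, map_mono inf_le_left, B, ?_⟩
  · exact (frequently_mem_iff_neBot.1 hB).map ns
  · simp only [Real.norm_eq_abs, sq_abs, eventually_map]
    exact mem_inf_of_right (mem_principal_self _)

variable {ι : Type*} [Countable ι] {X I C : ι → ℝ≥0 → Ω → ℝ}

theorem exists_strictMono_ae_hasStratonovichSums (hW : IsWienerField P ℱ a b β φ W)
    (hx : x ∈ Set.Icc a b) (hX : ∀ κ, Adapted ℱ (X κ)) (hXc : ∀ κ, ∀ᵐ ω ∂P, Continuous (X κ · ω))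
    (hI : ∀ κ, IsItoIntegral P (X κ) (W · x) (I κ))
    (hC : ∀ κ, IsCovariation P (X κ) (W · x) (C κ)) (T : ℝ≥0) :
    ∃ ns : ℕ → ℕ, StrictMono ns ∧ ∀ᵐ ω ∂P, ∀ κ, HasStratonovichSums (map ns atTop) T
      (fun t ↦ (X κ t ω : ℂ)) (W · x ω) (fun t ↦ (I κ t ω : ℂ)) fun t ↦ (C κ t ω : ℂ) := by
  obtain ⟨ns, hns, hlim⟩ := exists_strictMono_forall_ae_tendsto (P := P)
    (f := Sum.elim (Sum.elim
      (fun κ n ω ↦ ∑ i ∈ Finset.range (2 ^ n),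
        leftPointError T n (X κ · ω) (W · x ω) (I κ · ω) i ^ 2)
      (fun κ n ω ↦ ‖∑ i ∈ Finset.range (2 ^ n), leftPointError T n (X κ · ω) (W · x ω) (I κ · ω) i •
        Complex.exp (W (dyadicPt T n i) x ω * Complex.I)‖ ^ 2))
      fun (p : ι × ℕ × ℕ) n ω ↦ ∑ i ∈ Finset.range (p.2.2 * 2 ^ (n - p.2.1)),
        dyadicIncr T n (X p.1 · ω) i * dyadicIncr T n (W · x ω) i)
    (g := Sum.elim (fun _ _ ↦ 0) fun p ↦ C p.1 (dyadicPt T p.2.1 p.2.2)) (by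
      rintro ((κ | κ) | ⟨κ, K, b⟩)
      · exact (hI κ).tendstoInMeasure_sum_leftPointError_sq hW hx (hX κ) (hXc κ) T
      · exact (hI κ).tendstoInMeasure_norm_sum_leftPointError_smul_exp_sq hW hx (hX κ) (hXc κ) T
      · exact (hC κ).tendstoInMeasure_dyadic T K b)
  refine ⟨ns, hns, ?_⟩
  filter_upwards [hlim, ae_all_iff.2 fun κ ↦ (hC κ).1] with ω hω hCω κ
  exact hasStratonovichSums_ofReal (hCω κ).2 (hω (.inl (.inl κ))) (hω (.inl (.inr κ)))
    fun K b ↦ hω (.inr (κ, K, b))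

theorem IsWienerField.ae_exists_hasStratonovichSums (hW : IsWienerField P ℱ a b β φ W)
    (hx : x ∈ Set.Icc a b) (hX : ∀ κ, Adapted ℱ (X κ)) (hXc : ∀ κ, ∀ᵐ ω ∂P, Continuous (X κ · ω))
    (hI : ∀ κ, IsItoIntegral P (X κ) (W · x) (I κ))
    (hC : ∀ κ, IsCovariation P (X κ) (W · x) (C κ)) (T : ℝ≥0) :
    ∀ᵐ ω ∂P, ∃ l : Filter ℕ, l.NeBot ∧ l ≤ atTop ∧
      (HasBoundedSqSums l fun n i ↦ dyadicIncr T n (W · x ω) i) ∧ ∀ κ, HasStratonovichSums l T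
        (fun t ↦ (X κ t ω : ℂ)) (W · x ω) (fun t ↦ (I κ t ω : ℂ)) fun t ↦ (C κ t ω : ℂ) := by
  obtain ⟨ns, hns, hsums⟩ := exists_strictMono_ae_hasStratonovichSums hW hx hX hXc hI hC T
  filter_upwards [hsums, hW.ae_exists_hasBoundedSqSums hx T ns] with ω hω ⟨l, hl, hle, hsq⟩
  exact ⟨l, hl, hle.trans hns.tendsto_atTop, hsq, fun κ ↦ (hω κ).mono hle⟩

end WienerField

/-! ### The gauge transform of the semi-discrete system -/

section GaugedProcess

variable {Ω : Type*} {mΩ : MeasurableSpace Ω} {P : Measure Ω}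

theorem ae_eq_zero_of_tendstoInMeasure_zero {f : Ω → ℝ}
    (h : TendstoInMeasure P (fun (_ : ℕ) (_ : Ω) ↦ (0 : ℝ)) atTop f) : f =ᵐ[P] fun _ ↦ 0 :=
  tendstoInMeasure_ae_unique h fun ε hε ↦ by simp [hε.ne']

theorem IsItoIntegral.ae_eq_zero {X w J : ℝ≥0 → Ω → ℝ} (h : IsItoIntegral P X w J) :
    J 0 =ᵐ[P] fun _ ↦ 0 :=
  ae_eq_zero_of_tendstoInMeasure_zero (by simpa [dyadicPt] using h.tendstoInMeasure_dyadic 0 0 0)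

theorem IsCovariation.ae_eq_zero {X w C : ℝ≥0 → Ω → ℝ} (h : IsCovariation P X w C) :
    C 0 =ᵐ[P] fun _ ↦ 0 :=
  ae_eq_zero_of_tendstoInMeasure_zero (by simpa [dyadicPt] using h.tendstoInMeasure_dyadic 0 0 0)

variable [IsProbabilityMeasure P] {ℱ : Filtration ℝ≥0 mΩ} {a b x : ℝ} {β : ℕ → ℝ≥0 → Ω → ℝ}
  {φ : ℕ → ℝ → ℝ} {W : ℝ≥0 → ℝ → Ω → ℝ} {X J C : Fin 2 → ℝ≥0 → Ω → ℝ} {H : Ω → ℝ → ℂ} {u₀ : ℂ}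

theorem IsWienerField.forall_ae_exp_mul_sub_eq_integral (hW : IsWienerField P ℱ a b β φ W)
    (hx : x ∈ Set.Icc a b) (hX : ∀ c, Adapted ℱ (X c)) (hXc : ∀ c, ∀ᵐ ω ∂P, Continuous (X c · ω))
    (hJ : ∀ c, IsItoIntegral P (X c) (W · x) (J c)) (hC : ∀ c, IsCovariation P (X c) (W · x) (C c))
    (hH : ∀ᵐ ω ∂P, Continuous (H ω))
    (heq : ∀ᵐ ω ∂P, ∀ t : ℝ≥0, (X 0 t ω + Complex.I * X 1 t ω : ℂ) = u₀ +
      (∫ s in (0 : ℝ)..t, H ω s) - Complex.I * ((J 0 t ω + Complex.I * J 1 t ω) +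
        (C 0 t ω + Complex.I * C 1 t ω) / 2)) (t : ℝ≥0) :
    ∀ᵐ ω ∂P, Complex.exp (W t x ω * Complex.I) * (X 0 t ω + Complex.I * X 1 t ω) -
      Complex.exp (W 0 x ω * Complex.I) * (X 0 0 ω + Complex.I * X 1 0 ω) =
      ∫ s in (0 : ℝ)..t, Complex.exp (W s.toNNReal x ω * Complex.I) * H ω s := by
  filter_upwards [hW.ae_exists_hasStratonovichSums hx hX hXc hJ hC t, hW.continuous x hx, hXc 0,
    hXc 1, hH, heq] with ω ⟨l, hlne, hl, hsq, hsums⟩ hWω hX0 hX1 hHω heqω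
  exact ((hsums 0).add ((hsums 1).const_mul Complex.I)).exp_mul_sub_eq_integral heqω hl
    (by fun_prop) hWω hHω hsq

theorem IsWienerField.ae_forall_exp_mul_sub_eq_integral (hW : IsWienerField P ℱ a b β φ W)
    (hx : x ∈ Set.Icc a b) (hX : ∀ c, Adapted ℱ (X c)) (hXc : ∀ c, ∀ᵐ ω ∂P, Continuous (X c · ω))
    (hJ : ∀ c, IsItoIntegral P (X c) (W · x) (J c)) (hC : ∀ c, IsCovariation P (X c) (W · x) (C c))
    (hH : ∀ᵐ ω ∂P, Continuous (H ω))
    (heq : ∀ᵐ ω ∂P, ∀ t : ℝ≥0, (X 0 t ω + Complex.I * X 1 t ω : ℂ) = u₀ +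
      (∫ s in (0 : ℝ)..t, H ω s) - Complex.I * ((J 0 t ω + Complex.I * J 1 t ω) +
        (C 0 t ω + Complex.I * C 1 t ω) / 2)) :
    ∀ᵐ ω ∂P, ∀ t : ℝ≥0, Complex.exp ((W t x ω - W 0 x ω : ℝ) * Complex.I) *
      (X 0 t ω + Complex.I * X 1 t ω) = u₀ + ∫ s in (0 : ℝ)..t,
        Complex.exp ((W s.toNNReal x ω - W 0 x ω : ℝ) * Complex.I) * H ω s := by
  obtain ⟨S, hSc, hSd⟩ := TopologicalSpace.exists_countable_dense ℝ≥0
  filter_upwards [(ae_ball_iff hSc).2 fun t (_ : t ∈ S) ↦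
      hW.forall_ae_exp_mul_sub_eq_integral hx hX hXc hJ hC hH heq t,
    hW.continuous x hx, ae_all_iff.2 hXc, hH, heq, ae_all_iff.2 fun c ↦ (hJ c).ae_eq_zero,
    ae_all_iff.2 fun c ↦ (hC c).ae_eq_zero] with ω hS hWω hXω hHω heqω hJ0 hC0
  have hinit : (X 0 0 ω + Complex.I * X 1 0 ω : ℂ) = u₀ := by simp [heqω 0, hJ0, hC0]
  have hexp : Continuous fun t : ℝ≥0 ↦ Complex.exp ((W t x ω - W 0 x ω : ℝ) * Complex.I) := by
    fun_prop
  have _ := hXω 0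
  have _ := hXω 1
  have hrhs : Continuous fun t : ℝ≥0 ↦ u₀ + ∫ s in (0 : ℝ)..t,
      Complex.exp ((W s.toNNReal x ω - W 0 x ω : ℝ) * Complex.I) * H ω s :=
    continuous_const.add ((intervalIntegral.continuous_primitive (fun _ _ ↦
      ((hexp.comp continuous_real_toNNReal).mul hHω).intervalIntegrable _ _) 0).comp
        NNReal.continuous_coe)
  refine congrFun (Continuous.ext_on hSd (by fun_prop) hrhs fun t ht ↦ ?_)
  have hsplit : ∀ s, Complex.exp ((W s x ω - W 0 x ω : ℝ) * Complex.I) =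
      Complex.exp (-(W 0 x ω * Complex.I)) * Complex.exp (W s x ω * Complex.I) := fun s ↦ by
    rw [← Complex.exp_add]
    push_cast
    ring_nf
  have hone : Complex.exp (-(W 0 x ω * Complex.I)) * Complex.exp (W 0 x ω * Complex.I) = 1 := by
    rw [← Complex.exp_add, neg_add_cancel, Complex.exp_zero]
  simp only [hsplit, mul_assoc, intervalIntegral.integral_const_mul, ← hS t ht, hinit]
  linear_combination u₀ * hone

end GaugedProcess

theorem schrodingerField_complexState {N : ℕ} {D : Matrix (Fin N) (Fin N) ℝ} {lam σ : ℝ}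
    {z : Fin N → Fin 4 → ℝ} (hv : ∀ j, (D *ᵥ fun k ↦ z k 0) j = z j 2)
    (hw : ∀ j, (D *ᵥ fun k ↦ z k 1) j = z j 3) (j : Fin N) :
    schrodingerField (D * D) lam σ (complexState z) j =
      ⟨-(D *ᵥ fun k ↦ z k 3) j + lam * (z j 0 ^ 2 + z j 1 ^ 2) ^ σ * z j 1,
        (D *ᵥ fun k ↦ z k 2) j - lam * (z j 0 ^ 2 + z j 1 ^ 2) ^ σ * z j 0⟩ := by
  have hvw : mulVecCLM D (complexState z) = complexState fun k ↦ ![z k 2, z k 3, 0, 0] := by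
    ext k
    rw [mulVecCLM_complexState, hv, hw]
    rfl
  have hnorm : ‖complexState z j‖ ^ 2 = z j 0 ^ 2 + z j 1 ^ 2 := by
    rw [complexState, Complex.sq_norm, Complex.normSq_add_mul_I]
  rw [schrodingerField, mulVecCLM_mul, hvw, mulVecCLM_complexState, powerNonlin, hnorm]
  apply Complex.ext <;> simp [complexState] <;> ring

section SemidiscreteSolution

variable {Ω : Type*} {mΩ : MeasurableSpace Ω} {P : Measure Ω} {ℱ : Filtration ℝ≥0 mΩ}
  {α σ lam a b : ℝ} {N : ℕ} {W : ℝ≥0 → ℝ → Ω → ℝ} {y : Phase N} {z : ℝ≥0 → Ω → Fin N → Fin 4 → ℝ}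

theorem IsSemidiscreteSolution.exists_complexState_eq (hσ : 0 ≤ σ)
    (hz : IsSemidiscreteSolution P ℱ W α σ lam a b N y z) (j : Fin N) :
    ∃ J C : Fin 2 → ℝ≥0 → Ω → ℝ,
      (∀ c, IsItoIntegral P (![fun t ω ↦ z t ω j 0, fun t ω ↦ z t ω j 1] c)
        (W · (gridPoint a b N j)) (J c)) ∧
      (∀ c, IsCovariation P (![fun t ω ↦ z t ω j 0, fun t ω ↦ z t ω j 1] c)
        (W · (gridPoint a b N j)) (C c)) ∧
      ∀ᵐ ω ∂P, ∀ t : ℝ≥0, (z t ω j 0 + Complex.I * z t ω j 1 : ℂ) = complexEquiv N y j +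
        (∫ s in (0 : ℝ)..t, schrodingerField (D1 α a b N * D1 α a b N) lam σ
          (complexState (z s.toNNReal ω)) j) - Complex.I * ((J 0 t ω + Complex.I * J 1 t ω) +
            (C 0 t ω + Complex.I * C 1 t ω) / 2) := by
  obtain ⟨-, ⟨Iq, Cq, hIq, hCq, rfl⟩, hp⟩ := hz.eq_p j
  obtain ⟨-, ⟨Ip, Cp, hIp, hCp, rfl⟩, hq⟩ := hz.eq_q j
  refine ⟨![Ip, Iq], ![Cp, Cq], Fin.forall_fin_two.2 ⟨hIp, hIq⟩,
    Fin.forall_fin_two.2 ⟨hCp, hCq⟩, ?_⟩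
  filter_upwards [hz.continuous, hz.eq_v, hz.eq_w, hp, hq] with ω hc hv hw hpω hqω t
  have hfield : Continuous fun s : ℝ ↦ schrodingerField (D1 α a b N * D1 α a b N) lam σ
      (complexState (z s.toNNReal ω)) j :=
    (continuous_apply j).comp <| (continuous_schrodingerField _ lam hσ).comp <|
      continuous_complexState.comp <| hc.comp continuous_real_toNNReal
  have hint := hfield.intervalIntegrable (μ := volume) 0 t
  have hre := Complex.reCLM.intervalIntegral_comp_comm hint
  have him := Complex.imCLM.intervalIntegral_comp_comm hint
  simp only [Complex.reCLM_apply, Complex.imCLM_apply,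
    schrodingerField_complexState (hv _) (hw _)] at hre him ⊢
  rw [hpω t, hqω t, hre, him]
  apply Complex.ext <;> simp [complexEquiv_apply]
  ring

variable [IsProbabilityMeasure P] {β : ℕ → ℝ≥0 → Ω → ℝ} {φ : ℕ → ℝ → ℝ}

theorem IsSemidiscreteSolution.ae_exp_mul_complexState_eq (hσ : 0 ≤ σ) (hab : a ≤ b)
    (hW : IsWienerField P ℱ a b β φ W) (hz : IsSemidiscreteSolution P ℱ W α σ lam a b N y z)
    (j : Fin N) :
    ∀ᵐ ω ∂P, ∀ t : ℝ≥0, Complex.exp ((W t (gridPoint a b N j) ω - W 0 (gridPoint a b N j) ω : ℝ) *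
      Complex.I) * complexState (z t ω) j = complexEquiv N y j + ∫ s in (0 : ℝ)..t,
        Complex.exp ((W s.toNNReal (gridPoint a b N j) ω - W 0 (gridPoint a b N j) ω : ℝ) *
          Complex.I) * schrodingerField (D1 α a b N * D1 α a b N) lam σ
            (complexState (z s.toNNReal ω)) j := by
  obtain ⟨J, C, hJ, hC, heq⟩ := hz.exists_complexState_eq hσ j
  have hcont : ∀ c, ∀ᵐ ω ∂P, Continuous fun t ↦ z t ω j c := fun c ↦
    hz.continuous.mono fun ω hω ↦ (continuous_apply_apply j c).comp hω
  have hfield : ∀ᵐ ω ∂P, Continuous fun s : ℝ ↦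
      schrodingerField (D1 α a b N * D1 α a b N) lam σ (complexState (z s.toNNReal ω)) j :=
    hz.continuous.mono fun ω hω ↦ (continuous_apply j).comp <|
      (continuous_schrodingerField _ lam hσ).comp <|
        continuous_complexState.comp <| hω.comp continuous_real_toNNReal
  filter_upwards [hW.ae_forall_exp_mul_sub_eq_integral (gridPoint_mem_Icc hab j)
    (Fin.forall_fin_two.2 ⟨hz.adapted j 0, hz.adapted j 1⟩)
    (Fin.forall_fin_two.2 ⟨hcont 0, hcont 1⟩) hJ hC hfield heq] with ω hω t
  rw [complexState, mul_comm (z t ω j 1 : ℂ)]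
  exact hω t

end SemidiscreteSolution

/-! ### The gauged phase flow -/

section GaugedFlow

variable {N : ℕ} {D : Matrix (Fin N) (Fin N) ℝ} {lam σ : ℝ} {θ : ℝ → Fin N → ℝ}
  {z : ℝ≥0 → Phase N → Fin N → Fin 4 → ℝ}

/-- The flow of complex unknowns of the state flow `z`, in the frame rotating with the phases `θ`
and in complex coordinates on the space of initial data. -/
def gaugedFlow (θ : ℝ → Fin N → ℝ) (z : ℝ≥0 → Phase N → Fin N → Fin 4 → ℝ) (t : ℝ)
    (x : Fin N → ℂ) : Fin N → ℂ :=
  phaseShift (θ t) (complexState (z t.toNNReal ((complexEquiv N).symm x)))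

theorem gaugedFlow_complexEquiv (t : ℝ) (y : Phase N) :
    gaugedFlow θ z t (complexEquiv N y) = phaseShift (θ t) (complexState (z t.toNNReal y)) := by
  rw [gaugedFlow, ContinuousLinearEquiv.symm_apply_apply]

theorem stateFlow_gaugedFlow {t : ℝ≥0} {y : Phase N}
    (hv : ∀ j, (D *ᵥ fun k ↦ z t y k 0) j = z t y j 2)
    (hw : ∀ j, (D *ᵥ fun k ↦ z t y k 1) j = z t y j 3) :
    stateFlow D θ (gaugedFlow θ z) t y = z t y := by
  rw [stateFlow, gaugedFlow_complexEquiv, Real.toNNReal_coe, phaseShift_neg_phaseShift,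
    fullState_complexState hv hw]

theorem gaugedFlow_eq_integral (hσ : 0 ≤ σ) (hθ : Continuous θ) {y : Phase N}
    (hc : Continuous fun t ↦ z t y)
    (heq : ∀ j, ∀ t : ℝ≥0, Complex.exp (θ t j * Complex.I) * complexState (z t y) j =
      complexEquiv N y j + ∫ s in (0 : ℝ)..t, Complex.exp (θ s j * Complex.I) *
        schrodingerField (D * D) lam σ (complexState (z s.toNNReal y)) j) {t : ℝ} (ht : 0 ≤ t) :
    gaugedFlow θ z t (complexEquiv N y) = complexEquiv N y + ∫ s in (0 : ℝ)..t,
      gaugedField (D * D) lam σ (θ s) (gaugedFlow θ z s (complexEquiv N y)) := by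
  lift t to ℝ≥0 using ht
  simp only [gaugedFlow_complexEquiv, gaugedField, phaseShift_neg_phaseShift]
  have hfield : Continuous fun s : ℝ ↦ schrodingerField (D * D) lam σ
      (complexState (z s.toNNReal y)) :=
    (continuous_schrodingerField _ lam hσ).comp <| continuous_complexState.comp <|
      hc.comp continuous_real_toNNReal
  have hgauged : Continuous fun s : ℝ ↦ phaseShift (θ s)
      (schrodingerField (D * D) lam σ (complexState (z s.toNNReal y))) :=
    continuous_phaseShift_apply.comp₂ hθ hfield
  ext j
  have hproj := (ContinuousLinearMap.proj (R := ℝ) (φ := fun _ : Fin N ↦ ℂ)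
    j).intervalIntegral_comp_comm (hgauged.intervalIntegrable (μ := volume) 0 t)
  simp only [ContinuousLinearMap.proj_apply] at hproj
  rw [Pi.add_apply, ← hproj]
  simpa only [phaseShift_apply, Real.toNNReal_coe] using heq j t

theorem isBoundedFlow_gaugedFlow (hD : Dᵀ = -D) (hσ : 0 ≤ σ) (hθ : Continuous θ)
    {S : Set (Phase N)} (hS : Dense S) (hz : ∀ t, Continuous (z t))
    (hc : ∀ y ∈ S, Continuous fun t ↦ z t y)
    (heq : ∀ y ∈ S, ∀ j, ∀ t : ℝ≥0, Complex.exp (θ t j * Complex.I) * complexState (z t y) j =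
      complexEquiv N y j + ∫ s in (0 : ℝ)..t, Complex.exp (θ s j * Complex.I) *
        schrodingerField (D * D) lam σ (complexState (z s.toNNReal y)) j) :
    IsBoundedFlow (fun t ↦ gaugedField (D * D) lam σ (θ t)) (gaugedFlow θ z) := by
  have hfield := continuous_uncurry_gaugedField (D * D) lam hσ hθ
  have hcont : ∀ y ∈ S, Continuous fun t ↦ gaugedFlow θ z t (complexEquiv N y) := fun y hy ↦ by
    simp only [gaugedFlow_complexEquiv]
    exact continuous_phaseShift_apply.comp₂ hθ
      (continuous_complexState.comp ((hc y hy).comp continuous_real_toNNReal))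
  have hint := fun y hy {t : ℝ} (ht : 0 ≤ t) ↦
    gaugedFlow_eq_integral hσ hθ (hc y hy) (heq y hy) ht
  have hmass : ∀ y ∈ S, ∀ t, 0 ≤ t → ‖gaugedFlow θ z t (complexEquiv N y)‖ ≤
      √(Fintype.card (Fin N)) * ‖complexEquiv N y‖ := fun y hy t ht ↦ by
    have hinit : gaugedFlow θ z 0 (complexEquiv N y) = complexEquiv N y := by
      simp [hint y hy le_rfl]
    refine norm_le_of_sum_norm_sq_eq ?_
    rw [sum_norm_sq_eq_of_gaugedField lam (transpose_mul_self_of_skew hD) (fun s hs ↦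
      hasDerivWithinAt_of_integral_eq hfield (hcont y hy).continuousOn (fun r hr ↦ hint y hy hr) hs)
      ht, hinit]
  refine IsBoundedFlow.of_dense hfield ((complexEquiv N).surjective.denseRange.dense_image
    (complexEquiv N).continuous hS) (fun t _ ↦ ?_) ?_ ?_ fun r _ ↦
      ⟨√(Fintype.card (Fin N)) * r, ?_⟩
  · exact (phaseShift (θ t)).continuous.comp <| continuous_complexState.comp <|
      (hz _).comp (complexEquiv N).symm.continuous
  · rintro - ⟨y, hy, rfl⟩
    exact (hcont y hy).continuousOn
  · rintro - ⟨y, hy, rfl⟩ t ht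
    exact hint y hy ht
  · rintro - ⟨y, hy, rfl⟩ hr t ht
    exact (hmass y hy t ht.1).trans (by gcongr)

end GaugedFlow

section PhaseFlow

variable {Ω : Type*} {mΩ : MeasurableSpace Ω} {P : Measure Ω} {ℱ : Filtration ℝ≥0 mΩ}
  {α σ lam a b : ℝ} {N : ℕ} {W : ℝ≥0 → ℝ → Ω → ℝ} {Z : ℝ≥0 → Ω → Phase N → Fin N → Fin 4 → ℝ}

theorem IsPhaseFlow.ae_mulVec_eq (hZ : IsPhaseFlow P ℱ W α σ lam a b N Z) :
    ∀ᵐ ω ∂P, ∀ t y j, (D1 α a b N *ᵥ fun k ↦ Z t ω y k 0) j = Z t ω y j 2 ∧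
      (D1 α a b N *ᵥ fun k ↦ Z t ω y k 1) j = Z t ω y j 3 := by
  obtain ⟨S, hSc, hSd⟩ := TopologicalSpace.exists_countable_dense (Phase N)
  filter_upwards [hZ.continuous, (ae_ball_iff hSc).2 fun y (_ : y ∈ S) ↦ (hZ.solution y).eq_v,
    (ae_ball_iff hSc).2 fun y (_ : y ∈ S) ↦ (hZ.solution y).eq_w] with ω hc hv hw t y j
  have hZt := hc t
  have hmulVec : ∀ c, Continuous fun y ↦ (D1 α a b N *ᵥ fun k ↦ Z t ω y k c) j := fun c ↦
    (continuous_apply j).comp (continuous_const.matrix_mulVec (by fun_prop))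
  exact ⟨congrFun (Continuous.ext_on hSd (hmulVec 0) (by fun_prop) fun y hy ↦ hv y hy t j) y,
    congrFun (Continuous.ext_on hSd (hmulVec 1) (by fun_prop) fun y hy ↦ hw y hy t j) y⟩

variable [IsProbabilityMeasure P] {β : ℕ → ℝ≥0 → Ω → ℝ} {φ : ℕ → ℝ → ℝ}

theorem IsPhaseFlow.ae_exists_isBoundedFlow (hσ : 0 ≤ σ) (hab : a ≤ b)
    (hW : IsWienerField P ℱ a b β φ W) (hZ : IsPhaseFlow P ℱ W α σ lam a b N Z) :
    ∀ᵐ ω ∂P, ∃ (θ : ℝ → Fin N → ℝ) (U : ℝ → (Fin N → ℂ) → Fin N → ℂ), Continuous θ ∧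
      IsBoundedFlow (fun t ↦ gaugedField (D1 α a b N * D1 α a b N) lam σ (θ t)) U ∧
      ∀ t : ℝ≥0, Z t ω = stateFlow (D1 α a b N) θ U t := by
  obtain ⟨S, hSc, hSd⟩ := TopologicalSpace.exists_countable_dense (Phase N)
  filter_upwards [hZ.continuous, hZ.ae_mulVec_eq,
    ae_all_iff.2 fun j ↦ hW.continuous _ (gridPoint_mem_Icc (N := N) hab j),
    (ae_ball_iff hSc).2 fun y (_ : y ∈ S) ↦ (hZ.solution y).continuous,
    (ae_ball_iff hSc).2 fun y (_ : y ∈ S) ↦ ae_all_iff.2 fun j ↦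
      (hZ.solution y).ae_exp_mul_complexState_eq hσ hab hW j] with ω hc hvw hWω hcont heq
  have hθ : Continuous fun (t : ℝ) (j : Fin N) ↦
      W t.toNNReal (gridPoint a b N j) ω - W 0 (gridPoint a b N j) ω :=
    continuous_pi fun j ↦ ((hWω j).comp continuous_real_toNNReal).sub continuous_const
  refine ⟨_, gaugedFlow _ fun t ↦ Z t ω, hθ, isBoundedFlow_gaugedFlow (D1_transpose α a b N) hσ hθ
    hSd hc hcont fun y hy j t ↦ ?_, fun t ↦ funext fun y ↦ (stateFlow_gaugedFlow
      (z := fun t ↦ Z t ω) (fun j ↦ (hvw t y j).1) fun j ↦ (hvw t y j).2).symm⟩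
  simpa only [Real.toNNReal_coe] using heq y hy j t

end PhaseFlow

end StochFracNLS

end

theorem mainTheorem8_general {Ω : Type*} {mΩ : MeasurableSpace Ω} (P : Measure Ω)
    [IsProbabilityMeasure P] (ℱ : Filtration ℝ≥0 mΩ) (α σ lam a b : ℝ) (hσ : 0 ≤ σ) (hab : a < b)
    (N : ℕ) (β : ℕ → ℝ≥0 → Ω → ℝ) (φ : ℕ → ℝ → ℝ) (W : ℝ≥0 → ℝ → Ω → ℝ)
    (hW : StochFracNLS.IsWienerField P ℱ a b β φ W)
    (Z : ℝ≥0 → Ω → StochFracNLS.Phase N → Fin N → Fin 4 → ℝ)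
    (hZ : StochFracNLS.IsPhaseFlow P ℱ W α σ lam a b N Z) :
    (StochFracNLS.D1 α a b N)ᵀ = -StochFracNLS.D1 α a b N ∧
    ∀ᵐ ω ∂P,
      (∀ t, Differentiable ℝ (Z t ω)) ∧
      ∀ (y ξ η : StochFracNLS.Phase N) (t : ℝ≥0),
        (∀ j : Fin N, HasDerivWithinAt
          (fun s : ℝ ↦ StochFracNLS.symplForm (Z s.toNNReal ω) j y ξ η)
          (-StochFracNLS.wedgeMat (StochFracNLS.dz (Z t ω) j y) StochFracNLS.matK
            (StochFracNLS.dGz (StochFracNLS.D1 α a b N) (Z t ω) j y) ξ η)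
          (Set.Ici 0) t) ∧
        HasDerivWithinAt
          (fun s : ℝ ↦ ∑ j, StochFracNLS.symplForm (Z s.toNNReal ω) j y ξ η) 0 (Set.Ici 0) t ∧
        ∑ j, StochFracNLS.symplForm (Z t ω) j y ξ η =
          ∑ j, StochFracNLS.symplForm (Z 0 ω) j y ξ η := by
  have hD := StochFracNLS.D1_transpose α a b N
  refine ⟨hD, ?_⟩
  filter_upwards [hZ.ae_exists_isBoundedFlow hσ hab.le hW] with ω ⟨θ, U, hθ, hU, hZU⟩
  have hZs : ∀ s : ℝ, 0 ≤ s →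
      Z s.toNNReal ω = StochFracNLS.stateFlow (StochFracNLS.D1 α a b N) θ U s := fun s hs ↦ by
    rw [hZU, Real.coe_toNNReal s hs]
  refine ⟨fun t y ↦ ?_, fun y ξ η t ↦ ⟨fun j ↦ ?_, ?_, ?_⟩⟩
  · rw [hZU t]
    exact (StochFracNLS.hasFDerivAt_stateFlow_of_isBoundedFlow hσ hθ hU t.coe_nonneg
      y).differentiableAt
  · rw [hZU t]
    exact (StochFracNLS.hasDerivWithinAt_symplForm_stateFlow hσ hθ hU t.coe_nonneg j y ξ η).congr
      (fun s hs ↦ by rw [hZs s hs]) (by rw [Real.toNNReal_coe, hZU])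
  · exact (StochFracNLS.hasDerivWithinAt_sum_symplForm_stateFlow hD hσ hθ hU t.coe_nonneg y
      ξ η).congr (fun s hs ↦ by rw [hZs s hs]) (by rw [Real.toNNReal_coe, hZU])
  · rw [hZU t, hZU 0]
    exact StochFracNLS.sum_symplForm_stateFlow_eq hD hσ hθ hU t.coe_nonneg y ξ η

theorem mainTheorem8 {Ω : Type*} {mΩ : MeasurableSpace Ω} (P : Measure Ω) [IsProbabilityMeasure P]
    (ℱ : Filtration ℝ≥0 mΩ)
    (α σ lam a b : ℝ) (hα₀ : 1 / 2 < α) (hα₁ : α < 1) (hσ : 0 ≤ σ) (hlam : lam = 1 ∨ lam = -1)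
    (hab : a < b) (N : ℕ) (hN : 0 < N) (hN_even : Even N)
    (β : ℕ → ℝ≥0 → Ω → ℝ) (φ : ℕ → ℝ → ℝ) (W : ℝ≥0 → ℝ → Ω → ℝ)
    (hW : StochFracNLS.IsWienerField P ℱ a b β φ W)
    (Z : ℝ≥0 → Ω → StochFracNLS.Phase N → Fin N → Fin 4 → ℝ)
    (hZ : StochFracNLS.IsPhaseFlow P ℱ W α σ lam a b N Z) :
    (StochFracNLS.D1 α a b N)ᵀ = -StochFracNLS.D1 α a b N ∧
    ∀ᵐ ω ∂P,
      (∀ t, Differentiable ℝ (Z t ω)) ∧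
      ∀ (y ξ η : StochFracNLS.Phase N) (t : ℝ≥0),
        (∀ j : Fin N, HasDerivWithinAt
          (fun s : ℝ ↦ StochFracNLS.symplForm (Z s.toNNReal ω) j y ξ η)
          (-StochFracNLS.wedgeMat (StochFracNLS.dz (Z t ω) j y) StochFracNLS.matK
            (StochFracNLS.dGz (StochFracNLS.D1 α a b N) (Z t ω) j y) ξ η)
          (Set.Ici 0) t) ∧
        HasDerivWithinAt
          (fun s : ℝ ↦ ∑ j, StochFracNLS.symplForm (Z s.toNNReal ω) j y ξ η) 0 (Set.Ici 0) t ∧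
        ∑ j, StochFracNLS.symplForm (Z t ω) j y ξ η =
          ∑ j, StochFracNLS.symplForm (Z 0 ω) j y ξ η := by
  exact mainTheorem8_general P ℱ α σ lam a b hσ hab N β φ W hW Z hZ
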